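/- Let $a\in[0.3,0.6]$, $\lambda=0.8$, $\mu=1/\lambda$, and let $P$ be the closed convex quadrilateral with clockwise vertices $A=(0,1)$, $B=(a,1)$, $C=(1,0.2)$, $D=(0,0)$. Let $S$ be the union of the rays $\overrightarrow{AB},\overrightarrow{BC},\overrightarrow{CD},\overrightarrow{DA}$. For $x\notin P\cup S$ there is a unique vertex $v$ of $P$ such that $P$ lies on the left of the ray from $x$ through $v$, and the outer billiards map with contraction is $T(x)=v+\lambda(v-x)$. Let $X$ be the set of points outside $P$ whose forward $T$-orbit never meets $S$. Call $y$ an admissible image of $x$ if either $x\notin P\cup S$ and $y=T(x)$, or $x\in S$ and $y$ is a limit of values $T(x_n)$ with $x_n\notin P\cup S$, $x_n\to x$. A periodic orbit is a periodic sequence $(w_i)_{i\ge 0}$ in the plane such that each $w_{i+1}$ is an admissible image of $w_i$. The orbit of $p$ is asymptotic to it if, for some $k$, $|T^m p-w_{m+k}|\to0$ as $m\to\infty$; the periodic orbit is attracting if the set $\{w_i\}$ has an open neighborhood $U$ such that the orbits of all points of $X\cap U$ are asymptotic to it. A Cantor set is a set homeomorphic to $\{0,1\}^{\mathbb N}$.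 A set $K$ is invariant if every point of $K$ has an admissible image in $K$ and is an admissible image of a point of $K$. The orbit of $p$ is asymptotic to $K$ if $\operatorname{dist}(T^m p,K)\to0$ and $K$ is the set of all limit points of $(T^m p)_{m\ge0}$. Put $l=\mu+(1-a)\mu^2$ and $E=(-l,1)$. For $\varepsilon>0$ let $R_1=R_1(\varepsilon)=[-l+\varepsilon,0]\times[1,1+\varepsilon^2]$ and $R_2=R_2(\varepsilon)=[-l+\varepsilon,0]\times[1-\varepsilon^2,1]$. The reduced map $g$ of the segment $EA$ sends $(x,1)$ to $(v,1)$ if, for all sufficiently small $\varepsilon>0$ and all $0<\delta\le\varepsilon^2$, the first-return map of $T$ to $R_2(\varepsilon)$ is defined at $(x,1-\delta)$ and its value has first coordinate $v$. In the coordinate $s=1+x/l$, with the endpoints $E$ and $A$ identified, $g$ is a circle map defined off its discontinuities. A lift of $g$ is a strictly increasing $G:\mathbb R\to\mathbb R$ with $G(s+1)=G(s)+1$ that agrees with $g$ modulo $1$ wherever $g$ is defined, and the rotation number of $g$ is $\rho(g)=\lim_{m\to\infty}(G^m(s)-s)/m$. **Theorem.** The rotation number $\rho(g)$ is well-defined modulo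 $1$ (a lift of $g$ with such a limit, the same for all $s$, exists, and any two numbers so obtained differ by an integer). Moreover, there is $\varepsilon_0>0$ such that the following holds. 1. If $\rho(g)$ is rational, there is an attracting periodic orbit $w$ such that, for every $\varepsilon\in(0,\varepsilon_0)$, the orbit of every point of $X\cap(R_1\cup R_2)$ is asymptotic to $w$. It is unique up to a cyclic shift: if $w'$ is an attracting periodic orbit that, for some $\varepsilon\in(0,\varepsilon_0)$, either meets $R_1\cup R_2$ or has the orbits of all points of $X\cap(R_1\cup R_2)$ asymptotic to it, then $w'$ is a cyclic shift of $w$. 2. If $\rho(g)$ is irrational, there is an invariant Cantor set $K$ such that, for every $\varepsilon\in(0,\varepsilon_0)$, the orbit of every point of $X\cap(R_1\cup R_2)$ is asymptotic to $K$. It is unique: every invariant Cantor set $K'$ such that, for some $\varepsilon\in(0,\varepsilon_0)$, the orbits of all points of $X\cap(R_1\cup R_2)$ are asymptotic to $K'$ equals $K$. -/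

import Mathlib

open Set Filter Topology

noncomputable section

namespace OuterBilliards

/-- The plane, in Cartesian coordinates.  (Only its topology, its uniform structure and its affine
structure matter below, so the sup metric of the product serves as well as the Euclidean one.) -/
abbrev Plane : Type := ℝ × ℝ

/-- The oriented area `u × v`; it is nonnegative iff `v` points to the left of `u` (or along it). -/
def cross (u v : Plane) : ℝ := u.1 * v.2 - u.2 * v.1

section Polygon

/-! Outer billiards with contraction factor `lam` about the convex polygon whose vertices, in
clockwise order, are `V 0, …, V (n - 1)`. -/

variable {n : ℕ} [NeZero n] (V : Fin n → Plane) (lam : ℝ)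

/-- The closed filled-in polygon `P`. -/
def polygon : Set Plane := convexHull ℝ (range V)

/-- The union `S` of the singular rays: from each vertex through the next one
(the index `i + 1` is cyclic). -/
def singularSet : Set Plane :=
  {x | ∃ i : Fin n, ∃ t : ℝ, 0 ≤ t ∧ x = V i + t • (V (i + 1) - V i)}

/-- The polygon lies on the left of the ray that starts from `x` and passes through `V i`. -/
def IsTangentVertex (x : Plane) (i : Fin n) : Prop :=
  ∀ p ∈ polygon V, 0 ≤ cross (V i - x) (p - x)

open Classical in
/-- The outer billiards map with contraction: if `v` is the vertex such that `P` lies on the left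
of the ray from `x` through `v`, then `T x = v + lam (v - x)`.
This is meant on the domain `billiardDomain`; elsewhere the value is irrelevant. -/
def T (x : Plane) : Plane :=
  if h : ∃! i : Fin n, IsTangentVertex V x i then V h.choose + lam • (V h.choose - x) else x

/-- The set on which `T` is well-defined: the complement of `P` and of the singular rays. -/
def billiardDomain : Set Plane := (polygon V ∪ singularSet V)ᶜ

/-- The set `X` of the points outside `P` whose whole forward orbit avoids the singular rays. -/
def regularSet : Set Plane :=
  {x | x ∉ polygon V ∧ ∀ k : ℕ, (T V lam)^[k] x ∉ singularSet V}

/-- `y` is an admissible image of `x`: either `T` is defined at `x` and `y = T x`, or `x` lies on a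
singular ray and `y` is a limit of values of `T` at points of its domain tending to `x`,
i.e. one of the (at most two) images that make `T` continuous at `x` from one side. -/
def Step (x y : Plane) : Prop :=
  (x ∈ billiardDomain V ∧ y = T V lam x) ∨
    (x ∈ singularSet V ∧ MapClusterPt y (𝓝[billiardDomain V] x) (T V lam))

/-- A periodic orbit, possibly through singular points: a cyclic sequence `w 0, …, w (N - 1)`, given
as an `N`-periodic function on `ℕ`, each of whose terms is an admissible image of the previous
one. -/
def IsPeriodicOrbit (w : ℕ → Plane) : Prop :=
  (∃ N : ℕ, 0 < N ∧ ∀ i, w (i + N) = w i) ∧ ∀ i, Step V lam (w i) (w (i + 1))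

/-- The two periodic sequences are cyclic shifts of one another. -/
def SameOrbit (w w' : ℕ → Plane) : Prop := ∃ k : ℕ, ∀ i, w' i = w (i + k)

/-- The `T`-orbit of `p` is asymptotic to the periodic orbit `w`. -/
def AsymptoticToOrbit (p : Plane) (w : ℕ → Plane) : Prop :=
  ∃ k : ℕ, Tendsto (fun m : ℕ => dist ((T V lam)^[m] p) (w (m + k))) atTop (𝓝 0)

/-- The periodic orbit `w` is attracting: all regular points near it are asymptotic to it. -/
def IsAttracting (w : ℕ → Plane) : Prop :=
  ∃ U : Set Plane, IsOpen U ∧ range w ⊆ U ∧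
    ∀ p ∈ regularSet V lam ∩ U, AsymptoticToOrbit V lam p w

/-- The `ω`-limit set of `p` under `T`. -/
def limitSet (p : Plane) : Set Plane :=
  {x | MapClusterPt x atTop (fun m : ℕ => (T V lam)^[m] p)}

/-- The `T`-orbit of `p` is asymptotic to the set `K`: it converges to `K`, and `K` is exactly the
set of its limit points. -/
def AsymptoticToSet (p : Plane) (K : Set Plane) : Prop :=
  Tendsto (fun m : ℕ => Metric.infDist ((T V lam)^[m] p) K) atTop (𝓝 0) ∧ limitSet V lam p = K

/-- `K` is invariant: every point of `K` has an admissible image in `K` and is an admissible image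
of a point of `K`.  At the points of `K` where `T` is defined, the first part says `T x ∈ K`. -/
def IsInvariant (K : Set Plane) : Prop :=
  (∀ x ∈ K, ∃ y ∈ K, Step V lam x y) ∧ ∀ y ∈ K, ∃ x ∈ K, Step V lam x y

/-- `q'` is the image of `q` under the first-return map of `T` to the region `Y`. -/
def FirstReturn (Y : Set Plane) (q q' : Plane) : Prop :=
  ∃ m : ℕ, 0 < m ∧ (∀ j < m, (T V lam)^[j] q ∈ billiardDomain V) ∧
    (∀ j, 0 < j → j < m → (T V lam)^[j] q ∉ Y) ∧ (T V lam)^[m] q ∈ Y ∧ q' = (T V lam)^[m] q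

end Polygon

/-- A Cantor set: a set homeomorphic to the Cantor space `{0,1}^ℕ`. -/
def IsCantorSet (K : Set Plane) : Prop := Nonempty (K ≃ₜ (ℕ → Bool))

/-- The vertices `A = (0,1)`, `B = (a,1)`, `C = (1,0.2)`, `D = (0,0)`, in clockwise order. -/
def quad (a : ℝ) : Fin 4 → Plane := ![(0, 1), (a, 1), (1, 1 / 5), (0, 0)]

/-- The contraction factor `λ = 0.8`. -/
def lam : ℝ := 4 / 5

/-- The length `l` of the segment from `E = (-l, 1)` to `A = (0, 1)`,
`l = μ + (1 - a) μ ^ 2` with `μ = 1 / λ`. -/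
def ell (a : ℝ) : ℝ := lam⁻¹ + (1 - a) * lam⁻¹ ^ 2

/-- The point `G` on the line `BC`, beyond `C`, with `|BC| : |CG| = 1 : μ`. -/
def ptG (a : ℝ) : Plane := quad a 2 + lam⁻¹ • (quad a 2 - quad a 1)

/-- `E = (-l, 1)` is the intersection of the line `AB` (that is, `y = 1`) with the line `DG`. -/
theorem ptE_on_line_DG (a : ℝ) : ((-ell a, 1) : Plane) = (-lam⁻¹) • ptG a := by
  ext <;> simp [ptG, quad, ell, lam] <;> ring

/-- The rectangle `R₁`, above the segment `EA`. -/
def R1 (a ε : ℝ) : Set Plane := Icc (-ell a + ε) 0 ×ˢ Icc 1 (1 + ε ^ 2)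

/-- The rectangle `R₂`, the reflection of `R₁` in the segment `EA`. -/
def R2 (a ε : ℝ) : Set Plane := Icc (-ell a + ε) 0 ×ˢ Icc (1 - ε ^ 2) 1

/-- `g (x, 1) = (v, 1)`, where `g` is the reduced one-dimensional map of the segment `EA`: for all
small `ε`, the first-return map to `R₂` sends every point of `R₂` strictly below `(x, 1)` to a point
with first coordinate `v`.  (At the two circle discontinuities of `g`, where the return passes
through `P` or a singular ray, no value is prescribed.) -/
def ReducedMap (a x v : ℝ) : Prop :=
  -ell a < x ∧ x ≤ 0 ∧
    ∀ᶠ ε in 𝓝[>] (0 : ℝ), ∀ δ : ℝ, 0 < δ → ((x, 1 - δ) : Plane) ∈ R2 a ε →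
      ∃ q : Plane, FirstReturn (quad a) lam (R2 a ε) (x, 1 - δ) q ∧ q.1 = v

/-- `G` is a strictly increasing degree one lift of `g`, viewed as a circle map in the coordinate
`s = 1 + x / l`, in which `E` and `A` become `0` and `1` and are identified.  The values of `G` at
the discontinuities of `g` are free. -/
def IsLift (a : ℝ) (G : ℝ → ℝ) : Prop :=
  StrictMono G ∧ (∀ s, G (s + 1) = G s + 1) ∧
    ∀ s ∈ Ioc (0 : ℝ) 1, ∀ v, ReducedMap a (ell a * (s - 1)) v →
      ∃ k : ℤ, G s = 1 + v / ell a + k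

/-- `ρ` is a rotation number of the reduced map `g` (it is determined modulo `1` only):
`ρ = lim (Gᵐ(s) - s) / m` for a lift `G` and all `s`. -/
def IsRotationNumber (a ρ : ℝ) : Prop :=
  ∃ G : ℝ → ℝ, IsLift a G ∧ ∀ s, Tendsto (fun m : ℕ => (G^[m] s - s) / m) atTop (𝓝 ρ)

end OuterBilliards

end

open OuterBilliards

/-! A point just below `EA` is reflected in `D`, `C`, `B` and lands just above the line `AB`. If it
lands to the right of `A`, one reflection in `A` brings it back below `EA`; if it lands to the left,
it takes a second turn through `D`, `C`, `A` before it is back. Each return multiplies the distance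
to the line `y = 1` by 256/625 or 4096/15625, and acts on the first coordinate, independently of the
height, by a map with two increasing affine branches of these same slopes. Reflection in `D` and
then in `C` takes `E` to `B`; because of this choice of `E`, identifying `E` with `A` turns the
reduced map into an injective, order preserving, piecewise contracting circle map with jumps, a
contracted rotation. It has a strictly increasing lift of degree one, hence a translation number.

The long return is taken exactly when the lift passes an integer, so the itinerary of a point
consists of the increments of the integer parts along a lifted orbit (`code_eq`). Monotonicity
forces these integer parts to agree, from some time on, with those of an orbit of the rigid rotation
(`exists_floor_orbit_eq_of_irrational`, `exists_floor_orbit_eq_of_rational`). On the other hand,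
points with equal itineraries undergo the same reflections, so their distance is multiplied by 4/5
at each step (`Good.dist_iterate`). The asymptotic behaviour is thus governed by the combinatorics
of rotations.

For a rational number all itineraries are eventually shifts of one periodic word, so all orbits are
asymptotic to one periodic orbit, obtained as a limit along one of them; limits of consecutive
points are joined by admissible steps even on the singular rays. For an irrational number every late
finite window of one itinerary recurs in every other, so all orbits have the same limit set. This
set is perfect because orbits are ordered as under the rotation. It is totally disconnected because
its one-dimensional counterpart is covered by two affine copies of itself with ratios of sum less
than 1, hence is null. Brouwer's theorem then makes it a Cantor set. -/

/-! ### Brouwer's characterization of the Cantor space -/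

/-- A splitting of every nonempty clopen set of a nonempty perfect totally disconnected compact
space into two nonempty clopen pieces, along a prescribed clopen set if possible. -/
theorem exists_clopen_split {X : Type*} [TopologicalSpace X] [T2Space X] [CompactSpace X]
    [TotallyDisconnectedSpace X] (hX : ∀ x : X, ¬ IsOpen ({x} : Set X))
    (U C : Set X) (hU : IsClopen U) (hne : U.Nonempty) (hC : IsClopen C) :
    ∃ D : Set X, IsClopen D ∧ (U ∩ D).Nonempty ∧ (U \ D).Nonempty ∧
      ((U ∩ C).Nonempty → (U \ C).Nonempty → D = C) := by
  by_cases h : (U ∩ C).Nonempty ∧ (U \ C).Nonempty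
  · exact ⟨C, hC, h.1, h.2, fun _ _ => rfl⟩
  obtain ⟨x, hx⟩ := hne
  have hx' : U ≠ {x} := fun e => hX x (e ▸ hU.isOpen)
  obtain ⟨y, hy, hyx⟩ : ∃ y ∈ U, y ≠ x := by
    by_contra! hcon
    exact hx' (Subset.antisymm (fun y hy => hcon y hy) (singleton_subset_iff.2 hx))
  obtain ⟨D, hD, hxD, hDy⟩ := compact_exists_isClopen_in_isOpen
    (isOpen_compl_singleton (x := y)) (show x ∈ ({y} : Set X)ᶜ from fun e => hyx e.symm)
  refine ⟨D, hD, ⟨x, hx, hxD⟩, ⟨y, hy, fun hyD => hDy hyD rfl⟩, fun h1 h2 => absurd ⟨h1, h2⟩ h⟩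

/-- **Brouwer's theorem**: a nonempty, compact, second countable, totally disconnected space without
isolated points is homeomorphic to the Cantor space. -/
theorem nonempty_homeomorph_cantorSpace {X : Type*} [TopologicalSpace X] [T2Space X]
    [CompactSpace X] [TotallyDisconnectedSpace X] [SecondCountableTopology X] [Nonempty X]
    (hX : ∀ x : X, ¬ IsOpen ({x} : Set X)) : Nonempty (X ≃ₜ (ℕ → Bool)) := by
  classical
  have hcount : Countable (TopologicalSpace.Clopens X) :=
    TopologicalSpace.Clopens.countable_iff_secondCountable.2 inferInstance
  -- Level `n` of the scheme splits along the `n`-th clopen set whenever that set cuts the node, so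
  -- any two points are separated at some level.
  obtain ⟨C, hC⟩ := exists_surjective_nat (TopologicalSpace.Clopens X)
  choose! D hD1 hD2 hD3 hD4 using fun (U : TopologicalSpace.Clopens X) (n : ℕ)
    (hne : (U : Set X).Nonempty) =>
    exists_clopen_split hX (U : Set X) (C n : Set X) U.isClopen hne (C n).isClopen
  -- the nodes of the scheme along a branch
  let step : TopologicalSpace.Clopens X → ℕ → Bool → TopologicalSpace.Clopens X := fun U n b =>
    if hU : (U : Set X).Nonempty then
      (if b then U ⊓ ⟨D U n, hD1 U n hU⟩ else U \ ⟨D U n, hD1 U n hU⟩) else U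
  have step_true : ∀ (U : TopologicalSpace.Clopens X) n, (U : Set X).Nonempty → (step U n true : Set X) = (U : Set X) ∩ D U n := by
    intro U n hU; simp [step, hU]
  have step_false : ∀ (U : TopologicalSpace.Clopens X) n, (U : Set X).Nonempty → (step U n false : Set X) = (U : Set X) \ D U n := by
    intro U n hU; simp [step, hU]
  let node : (ℕ → Bool) → ℕ → TopologicalSpace.Clopens X := fun b n =>
    Nat.rec ⊤ (fun n U => step U n (b n)) n
  have node_zero : ∀ b, node b 0 = ⊤ := fun b => rfl
  have node_succ : ∀ b n, node b (n + 1) = step (node b n) n (b n) := fun b n => rfl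
  have node_ne : ∀ (b : ℕ → Bool) (n : ℕ), (SetLike.coe (node b n)).Nonempty := by
    intro b n
    induction n with
    | zero => simp [node_zero]
    | succ n ih =>
      rw [node_succ]
      cases b n
      · rw [step_false _ _ ih]; exact hD3 _ n ih
      · rw [step_true _ _ ih]; exact hD2 _ n ih
  have node_anti : ∀ (b : ℕ → Bool) (n : ℕ), SetLike.coe (node b (n + 1)) ⊆ SetLike.coe (node b n) := by
    intro b n
    rw [node_succ]
    cases b n
    · rw [step_false _ _ (node_ne b n)]; exact sdiff_subset
    · rw [step_true _ _ (node_ne b n)]; exact inter_subset_left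
  have node_congr : ∀ b b' n, (∀ i < n, b i = b' i) → node b n = node b' n := by
    intro b b' n h
    induction n with
    | zero => rfl
    | succ n ih => rw [node_succ, node_succ, ih fun i hi => h i (by omega), h n (by omega)]
  -- the branch through a point
  let pre : X → ℕ → TopologicalSpace.Clopens X := fun x n =>
    Nat.rec ⊤ (fun n U => step U n (decide (x ∈ D U n))) n
  let f : X → ℕ → Bool := fun x n => decide (x ∈ D (pre x n) n)
  have hpre : ∀ x n, pre x n = node (f x) n := by
    intro x n
    induction n with
    | zero => rfl
    | succ n ih =>
      rw [node_succ, ← ih]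
  have hf : ∀ x n, f x n = true ↔ x ∈ D (node (f x) n) n := by
    intro x n
    rw [← hpre]
    simp [f]
  have hmem : ∀ x n, x ∈ node (f x) n := by
    intro x n
    induction n with
    | zero => rw [node_zero]; trivial
    | succ n ih =>
      have : x ∈ SetLike.coe (node (f x) (n + 1)) := by
        rw [node_succ]
        rcases hb : f x n with _ | _
        · rw [step_false _ _ (node_ne _ n)]
          refine ⟨ih, fun h => ?_⟩
          rw [(hf x n).2 h] at hb
          cases hb
        · rw [step_true _ _ (node_ne _ n)]
          exact ⟨ih, (hf x n).1 hb⟩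
      exact this
  have huniq : ∀ x b, (∀ n, x ∈ node b n) → f x = b := by
    intro x b h
    have : ∀ n, ∀ i < n, f x i = b i := by
      intro n
      induction n with
      | zero => intro i hi; omega
      | succ n ih =>
        intro i hi
        rcases Nat.lt_succ_iff_lt_or_eq.1 hi with hi | rfl
        · exact ih i hi
        have h1 : x ∈ SetLike.coe (node b (i + 1)) := h (i + 1)
        have h2 := hf x i
        rw [node_congr _ _ i ih] at h2
        rw [node_succ] at h1
        rcases hb : b i with _ | _
        · rw [hb, step_false _ _ (node_ne b i)] at h1
          rw [Bool.eq_false_iff, Ne, h2]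
          exact h1.2
        · rw [hb, step_true _ _ (node_ne b i)] at h1
          exact h2.2 h1.2
    funext n
    exact this (n + 1) n (by omega)
  have hcont : Continuous f := by
    refine continuous_pi fun n => ?_
    rw [← IsLocallyConstant.iff_continuous, IsLocallyConstant.iff_eventually_eq]
    intro x
    filter_upwards [(node (f x) (n + 1)).isOpen.mem_nhds (hmem x (n + 1))] with y hy
    have hy' : ∀ m, m ≤ n + 1 → y ∈ node (f x) m := by
      intro m hm
      exact antitone_nat_of_succ_le (f := fun m => SetLike.coe (node (f x) m))
        (fun m => node_anti (f x) m) hm hy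
    have : ∀ m, m ≤ n + 1 → ∀ i < m, f y i = f x i := by
      intro m
      induction m with
      | zero => intro _ i hi; omega
      | succ m ih =>
        intro hm i hi
        rcases Nat.lt_succ_iff_lt_or_eq.1 hi with hi | rfl
        · exact ih (by omega) i hi
        have h1 : y ∈ SetLike.coe (node (f x) (i + 1)) := hy' (i + 1) hm
        have h2 := hf y i
        rw [node_congr _ _ i (ih (by omega))] at h2
        rw [node_succ] at h1
        rcases hb : f x i with _ | _
        · rw [hb, step_false _ _ (node_ne _ i)] at h1
          rw [Bool.eq_false_iff, Ne, h2]
          exact h1.2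
        · rw [hb, step_true _ _ (node_ne _ i)] at h1
          exact h2.2 h1.2
    exact this (n + 1) le_rfl n (by omega)
  have hinj : Function.Injective f := by
    intro x y hxy
    by_contra hne
    obtain ⟨E, hE, hxE, hEy⟩ := compact_exists_isClopen_in_isOpen
      (isOpen_compl_singleton (x := y)) (show x ∈ ({y} : Set X)ᶜ from hne)
    obtain ⟨n, hn⟩ := hC ⟨E, hE⟩
    have hyE : y ∉ E := fun h => hEy h rfl
    have hx := hmem x n
    have hy := hmem y n
    rw [← hxy] at hy
    have hCn : (C n : Set X) = E := by rw [hn]; rfl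
    -- Points with equal symbols share the node at level `n`. The set `E` cuts that node, so the
    -- splitting set there is `E` itself and the symbols differ after all.
    have hDC := hD4 (node (f x) n) n (node_ne _ n) ⟨x, hx, hCn ▸ hxE⟩ ⟨y, hy, hCn ▸ hyE⟩
    have h1 := hf x n
    have h2 := hf y n
    rw [← hxy, hDC, hCn] at h2
    rw [hDC, hCn] at h1
    exact hyE (h2.1 (h1.2 hxE))
  have hsurj : Function.Surjective f := by
    intro b
    obtain ⟨x, hx⟩ := IsCompact.nonempty_iInter_of_sequence_nonempty_isCompact_isClosed
      (fun n => SetLike.coe (node b n)) (node_anti b) (node_ne b) (node b 0).isClopen.isClosed.isCompact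
      (fun n => (node b n).isClopen.isClosed)
    exact ⟨x, huniq x b (fun n => mem_iInter.1 hx n)⟩
  exact ⟨(Continuous.homeoOfEquivCompactToT2 (f := Equiv.ofBijective f ⟨hinj, hsurj⟩) hcont)⟩

/-! ### Integer parts along orbits of degree one monotone maps -/

namespace CircleDeg1Lift

variable (f : CircleDeg1Lift)

/-- The order of the points of an orbit on the circle is that of an orbit of a rotation. -/
theorem orbit_order {s : ℝ} {m m' : ℕ} {k k' : ℤ} (h : f^[m] s + k ≤ f^[m'] s + k') :
    m * translationNumber f + k ≤ m' * translationNumber f + k' := by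
  rcases le_total m m' with hm | hm
  · obtain ⟨d, rfl⟩ := Nat.exists_eq_add_of_le' hm
    rw [Function.iterate_add_apply, ← coe_pow f d] at h
    have := (f ^ d).le_translationNumber_of_add_int_le (x := f^[m] s) (m := k - k')
      (by push_cast; linarith)
    rw [translationNumber_pow] at this
    push_cast at this ⊢
    linarith
  · obtain ⟨d, rfl⟩ := Nat.exists_eq_add_of_le' hm
    rw [Function.iterate_add_apply, ← coe_pow f d] at h
    have := (f ^ d).translationNumber_le_of_le_add_int (x := f^[m'] s) (m := k' - k)
      (by push_cast; linarith)
    rw [translationNumber_pow] at this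
    push_cast at this ⊢
    linarith

/-- A fractional part is nonnegative and a fractional part minus one is negative; `orbit_order`
transfers this comparison of translated orbit points to the rotation. -/
theorem floor_orbit_le (s : ℝ) (m n : ℕ) :
    ⌊f^[n] s⌋ - n * translationNumber f ≤ ⌊f^[m] s⌋ + 1 - m * translationNumber f := by
  have h := f.orbit_order (s := s) (m := m) (m' := n) (k := -(⌊f^[m] s⌋ + 1)) (k' := -⌊f^[n] s⌋)
    (by
      have h1 := Int.lt_floor_add_one (f^[m] s)
      have h2 := Int.floor_le (f^[n] s)
      push_cast
      linarith)
  push_cast at h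
  linarith

/-- The integer parts along an orbit of irrational rotation number are eventually those of an orbit
of the rotation. -/
theorem exists_floor_orbit_eq_of_irrational (h : Irrational (translationNumber f)) (s : ℝ) :
    ∃ θ : ℝ, ∃ n₀ : ℕ, ∀ n ≥ n₀, ⌊f^[n] s⌋ = ⌊θ + n * translationNumber f⌋ := by
  set τ := translationNumber f
  -- The supremum `θ` of `u` satisfies `⌊f^[n] s⌋ ≤ θ + n * τ ≤ ⌊f^[n] s⌋ + 1` for all `n`; only
  -- equality on the right has to be excluded.
  set u : ℕ → ℝ := fun n => ⌊f^[n] s⌋ - n * τ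
  have hb : BddAbove (range u) := ⟨⌊f^[0] s⌋ + 1 - (0 : ℕ) * τ, by
    rintro _ ⟨n, rfl⟩; exact f.floor_orbit_le s 0 n⟩
  have h1 : ∀ n, (⌊f^[n] s⌋ : ℝ) ≤ (⨆ i, u i) + n * τ := fun n => by
    have := le_ciSup hb n
    simp only [u] at this ⊢
    linarith
  have h2 : ∀ n, (⨆ i, u i) + n * τ ≤ ⌊f^[n] s⌋ + 1 := fun n => by
    have := ciSup_le fun i => f.floor_orbit_le s n i
    simp only [u] at this ⊢
    linarith
  generalize (⨆ i, u i) = θ at h1 h2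
  -- Equality makes `θ + n * τ` an integer, which for irrational `τ` happens at most once.
  have h3 : ∃ n₀ : ℕ, ∀ n ≥ n₀, θ + n * τ ≠ ⌊f^[n] s⌋ + 1 := by
    by_cases hex : ∃ n, θ + n * τ = ⌊f^[n] s⌋ + 1
    · obtain ⟨n, hn⟩ := hex
      refine ⟨n + 1, fun m hm he => ?_⟩
      refine (h.intCast_mul (m := (m : ℤ) - n) (by omega)).ne_int (⌊f^[m] s⌋ - ⌊f^[n] s⌋) ?_
      push_cast
      linarith
    · push Not at hex
      exact ⟨0, fun n _ => hex n⟩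
  obtain ⟨n₀, h3⟩ := h3
  refine ⟨θ, n₀, fun n hn => ?_⟩
  symm
  rw [Int.floor_eq_iff]
  exact ⟨h1 n, lt_of_le_of_ne (h2 n) (h3 n hn)⟩

/-- Along an orbit of rotation number `p / q`, the integer parts increase by exactly `p` every `q`
steps, eventually. -/
theorem exists_floor_orbit_add_eq {p : ℤ} {q : ℕ} (hq : 0 < q)
    (h : translationNumber f = p / q) (s : ℝ) :
    ∃ n₀ : ℕ, ∀ n ≥ n₀, ⌊f^[n + q] s⌋ = ⌊f^[n] s⌋ + p := by
  have hq' : (q : ℝ) ≠ 0 := by positivity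
  -- the bounded integer sequences `⌊f^[r + k q] s⌋ - k p` are monotone in `k`
  have key : ∀ r : ℕ, ∃ k₀ : ℕ, ∀ k ≥ k₀, ⌊f^[r + k * q + q] s⌋ = ⌊f^[r + k * q] s⌋ + p := by
    intro r
    set x : ℕ → ℝ := fun k => f^[r + k * q] s - k * p
    set b : ℕ → ℤ := fun k => ⌊x k⌋
    have hb : ∀ k, b k = ⌊f^[r + k * q] s⌋ - k * p := fun k => by
      simp only [b, x]
      rw [show f^[r + k * q] s - k * p = f^[r + k * q] s - ((k * p : ℤ) : ℝ) by push_cast; rfl,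
        Int.floor_sub_intCast]
    have hstep : ∀ k, x (k + 1) = (f ^ q) (x k) - p := fun k => by
      simp only [x]
      have : (f ^ q) (f^[r + k * q] s - ((k * p : ℤ) : ℝ))
          = (f ^ q) (f^[r + k * q] s) - ((k * p : ℤ) : ℝ) := map_sub_int _ _ _
      push_cast at this ⊢
      rw [this, coe_pow, ← Function.iterate_add_apply]
      rw [show r + (k + 1) * q = q + (r + k * q) by ring]
      ring
    have hbound : ∀ k k', b k ≤ b k' + 1 := fun k k' => by
      have := f.floor_orbit_le s (r + k' * q) (r + k * q)
      have h0 : (b k : ℝ) ≤ b k' + 1 := by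
        rw [hb, hb]
        rw [h] at this
        have e : ∀ j : ℕ, ((r + j * q : ℕ) : ℝ) * (p / q) = r * (p / q) + j * p := fun j => by
          push_cast; field_simp
        rw [e, e] at this
        push_cast
        linarith
      exact_mod_cast h0
    -- The sequence `x` is an orbit of the monotone map `f ^ q - p`, so it is monotone in the
    -- direction of its first step. Its integer parts are monotone with spread at most one, hence
    -- change at most once.
    have hfin : ∃ k₀, ∀ k ≥ k₀, b k = b k₀ := by
      rcases le_total (x 0) (x 1) with h01 | h01
      · have hmono : Monotone x := by
          refine monotone_nat_of_le_succ fun k => ?_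
          induction k with
          | zero => exact h01
          | succ k ih =>
            rw [hstep k, hstep (k + 1)]
            exact sub_le_sub_right ((f ^ q).monotone ih) _
        have hbm : Monotone b := fun i j hij => Int.floor_le_floor (hmono hij)
        by_cases hex : ∃ k, b k = b 0 + 1
        · obtain ⟨k₀, hk₀⟩ := hex
          exact ⟨k₀, fun k hk => le_antisymm (by rw [hk₀]; exact hbound k 0) (hbm hk)⟩
        · push Not at hex
          refine ⟨0, fun k hk => ?_⟩
          have := hbound k 0
          have := hbm hk
          have := hex k
          omega
      · have hmono : Antitone x := by
          refine antitone_nat_of_succ_le fun k => ?_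
          induction k with
          | zero => exact h01
          | succ k ih =>
            rw [hstep k, hstep (k + 1)]
            exact sub_le_sub_right ((f ^ q).monotone ih) _
        have hbm : Antitone b := fun i j hij => Int.floor_le_floor (hmono hij)
        by_cases hex : ∃ k, b k + 1 = b 0
        · obtain ⟨k₀, hk₀⟩ := hex
          exact ⟨k₀, fun k hk => le_antisymm (hbm hk) (by have := hbound 0 k; omega)⟩
        · push Not at hex
          refine ⟨0, fun k hk => ?_⟩
          have := hbound 0 k
          have := hbm hk
          have := hex k
          omega
    obtain ⟨k₀, hk₀⟩ := hfin
    refine ⟨k₀, fun k hk => ?_⟩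
    have h1 := hk₀ k hk
    have h2 := hk₀ (k + 1) (by omega)
    rw [← h1, hb, hb] at h2
    rw [show r + k * q + q = r + (k + 1) * q by ring]
    push_cast at h2
    linarith
  choose k₀ hk₀ using key
  refine ⟨(Finset.range q).sup k₀ * q + q, fun n hn => ?_⟩
  have hr : n % q < q := Nat.mod_lt _ hq
  have h1 : k₀ (n % q) ≤ (Finset.range q).sup k₀ := Finset.le_sup (Finset.mem_range.2 hr)
  have h2 : (Finset.range q).sup k₀ ≤ n / q := by
    rw [Nat.le_div_iff_mul_le hq]; omega
  have := hk₀ (n % q) (n / q) (h1.trans h2)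
  rwa [mul_comm (n / q), Nat.mod_add_div] at this

/-- The integer parts along an orbit of rotation number `p / q` are eventually those of an orbit of
the rotation. -/
theorem exists_floor_orbit_eq_of_rational {p : ℤ} {q : ℕ} (hq : 0 < q) (hpq : IsCoprime p q)
    (h : translationNumber f = p / q) (s : ℝ) :
    ∃ J : ℤ, ∃ n₀ : ℕ, ∀ n ≥ n₀, ⌊f^[n] s⌋ = (J + n * p) / q := by
  obtain ⟨n₀, hn₀⟩ := f.exists_floor_orbit_add_eq hq h s
  have hq' : (0 : ℝ) < q := by positivity
  set b : ℕ → ℤ := fun n => q * ⌊f^[n] s⌋ - n * p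
  have hbound : ∀ m n, b n ≤ b m + q := fun m n => by
    have := f.floor_orbit_le s m n
    have h0 : (b n : ℝ) ≤ b m + q := by
      simp only [b]
      rw [h] at this
      push_cast
      field_simp at this
      nlinarith
    exact_mod_cast h0
  have hper : ∀ n ≥ n₀, ∀ k : ℕ, b (n + k * q) = b n := by
    intro n hn k
    induction k with
    | zero => simp
    | succ k ih =>
      rw [← ih]
      have := hn₀ (n + k * q) (by omega)
      simp only [b]
      rw [show n + (k + 1) * q = n + k * q + q by ring, this]
      push_cast
      ring
  -- With `J` the maximum of `b`, all values of `b` lie in `[J - q, J]`. The formula holds with this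
  -- `J` at every `n` where the lower end is not attained.
  obtain ⟨J, ⟨n₁, rfl⟩, hJ⟩ : ∃ J ∈ range b, ∀ n, b n ≤ J := by
    obtain ⟨J, hJ1, hJ2⟩ := Int.exists_greatest_of_bdd (P := fun z => z ∈ range b)
      ⟨b 0 + q, by rintro _ ⟨n, rfl⟩; exact hbound 0 n⟩ ⟨b 0, 0, rfl⟩
    exact ⟨J, hJ1, fun n => hJ2 _ ⟨n, rfl⟩⟩
  have hdiv : ∀ (J : ℤ) n, b n ≤ J → J < b n + q → ⌊f^[n] s⌋ = (J + n * p) / q := by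
    intro J n h1 h2
    symm
    rw [Int.ediv_eq_iff_of_pos (by exact_mod_cast hq)]
    simp only [b] at h1 h2
    constructor <;> nlinarith
  -- If `J - q` is attained after `n₀`, then `J` is not: by coprimality the two times would be
  -- congruent modulo `q`, against the periodicity of `b`. All late values then lie in `[J - q, J -
  -- 1]`, and `J - 1` serves instead of `J`.
  by_cases hcase : ∃ n ≥ n₀, b n + q = b n₁
  · obtain ⟨n₂, hn₂, he⟩ := hcase
    refine ⟨b n₁ - 1, n₀, fun n hn => hdiv _ n ?_ ?_⟩
    · have h1 := hJ n
      rcases h1.lt_or_eq with h1 | h1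
      · omega
      exfalso
      -- `n` and `n₂` are congruent modulo `q`
      have hd : (q : ℤ) ∣ ((n : ℤ) - n₂) := by
        refine (hpq.symm).dvd_of_dvd_mul_right (y := (n : ℤ) - n₂) ⟨⌊f^[n] s⌋ - ⌊f^[n₂] s⌋ - 1, ?_⟩
        simp only [b] at h1 he
        linear_combination he - h1
      obtain ⟨c, hc⟩ := hd
      rcases le_total n n₂ with hle | hle
      · obtain ⟨k, hk⟩ : ∃ k : ℕ, n₂ = n + k * q := by
          obtain ⟨d, rfl⟩ := Nat.exists_eq_add_of_le hle
          have : (q : ℤ) ∣ d := ⟨-c, by push_cast at hc; linarith⟩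
          obtain ⟨k, rfl⟩ := Int.natCast_dvd_natCast.1 this
          exact ⟨k, by ring⟩
        have := hper n hn k
        rw [← hk] at this
        omega
      · obtain ⟨k, hk⟩ : ∃ k : ℕ, n = n₂ + k * q := by
          obtain ⟨d, rfl⟩ := Nat.exists_eq_add_of_le hle
          have : (q : ℤ) ∣ d := ⟨c, by push_cast at hc; linarith⟩
          obtain ⟨k, rfl⟩ := Int.natCast_dvd_natCast.1 this
          exact ⟨k, by ring⟩
        have := hper n₂ hn₂ k
        rw [← hk] at this
        omega
    · have := hbound n n₁
      omega
  · push Not at hcase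
    refine ⟨b n₁, n₀, fun n hn => hdiv _ n (hJ n) ?_⟩
    have := hbound n n₁
    have := hcase n hn
    omega

end CircleDeg1Lift

/-! ### Density and recurrence for irrational rotations -/

/-- The forward orbit of an irrational rotation is dense. -/
theorem Irrational.exists_nat_mul_sub_int_mem_Ioo {ρ : ℝ} (h : Irrational ρ) {u v : ℝ}
    (huv : u < v) (M : ℕ) : ∃ n ≥ M, ∃ k : ℤ, n * ρ - k ∈ Ioo u v := by
  have hd : DenseRange (fun n : ℕ => n • (ρ : AddCircle (1 : ℝ))) := by
    rw [← denseRange_zsmul_iff_nsmul]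
    exact AddCircle.denseRange_zsmul_coe_iff.2 (by simpa using h)
  obtain ⟨n, hn⟩ := hd.exists_mem_open (s := (QuotientAddGroup.mk : ℝ → AddCircle (1 : ℝ)) ''
    Ioo (u - M * ρ) (v - M * ρ)) (QuotientAddGroup.isOpenMap_coe _ isOpen_Ioo)
    ((nonempty_Ioo.2 (by linarith)).image _)
  obtain ⟨t, ht, he⟩ := hn
  have he' : ((t - n * ρ : ℝ) : AddCircle (1 : ℝ)) = 0 := by
    rw [AddCircle.coe_sub, ← nsmul_eq_mul, AddCircle.coe_nsmul, sub_eq_zero]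
    exact he
  obtain ⟨m, hm⟩ := AddCircle.coe_eq_zero_iff (1 : ℝ) |>.1 he'
  rw [zsmul_eq_mul, mul_one] at hm
  refine ⟨n + M, by omega, -m, ?_⟩
  have : ((n + M : ℕ) : ℝ) * ρ - ((-m : ℤ) : ℝ) = t + M * ρ := by
    push_cast; linarith
  rw [this]
  exact ⟨by linarith [ht.1], by linarith [ht.2]⟩

/-- Every finite pattern in the integer parts of an orbit of an irrational rotation recurs, at
arbitrarily late times, in every other orbit. -/
theorem Irrational.exists_floor_pattern {ρ : ℝ} (h : Irrational ρ) (θ θ' : ℝ) (r M : ℕ) :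
    ∃ n ≥ M, ∃ k : ℤ, ∀ i ≤ r, ⌊θ' + (n + i : ℕ) * ρ⌋ = ⌊θ + i * ρ⌋ + k := by
  -- The integer part is locally constant to the right, so the whole finite pattern is unchanged on
  -- a right neighbourhood of `θ`; density brings the other orbit into it.
  have hη : ∃ η > 0, ∀ i ≤ r, ∀ t ∈ Ioo θ (θ + η), ⌊t + i * ρ⌋ = ⌊θ + i * ρ⌋ := by
    have h1 : ∀ i ∈ Finset.range (r + 1), ∀ᶠ t in 𝓝[>] θ, ⌊t + i * ρ⌋ = ⌊θ + i * ρ⌋ := by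
      intro i _
      have h2 : Ioo θ (θ + (⌊θ + i * ρ⌋ + 1 - (θ + i * ρ))) ∈ 𝓝[>] θ :=
        Ioo_mem_nhdsGT (by linarith [Int.lt_floor_add_one (θ + i * ρ)])
      filter_upwards [h2] with t ht
      rw [Int.floor_eq_iff]
      exact ⟨by linarith [Int.floor_le (θ + i * ρ), ht.1], by linarith [ht.2]⟩
    obtain ⟨b, hb, hb'⟩ := mem_nhdsGT_iff_exists_Ioo_subset.1
      ((Filter.eventually_all_finset _).2 h1)
    refine ⟨b - θ, sub_pos.2 hb, fun i hi t ht => hb' ?_ i (Finset.mem_range_succ_iff.2 hi)⟩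
    rwa [add_sub_cancel] at ht
  obtain ⟨η, hη0, hη⟩ := hη
  obtain ⟨n, hn, k, hk1, hk2⟩ := h.exists_nat_mul_sub_int_mem_Ioo
    (show θ - θ' < θ + η - θ' by linarith) M
  refine ⟨n, hn, k, fun i hi => ?_⟩
  rw [← hη i hi (θ' + n * ρ - k) ⟨by linarith, by linarith⟩, ← Int.floor_add_intCast]
  congr 1
  push_cast
  ring

noncomputable section

namespace OuterBilliards

/-! ### The quadrilateral, the singular rays and the four affine branches of `T` -/

section Polygon

variable {n : ℕ} {V : Fin n → Plane}

theorem convex_cross_nonneg (u x : Plane) : Convex ℝ {p : Plane | 0 ≤ cross u (p - x)} := by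
  intro p hp q hq s t hs ht hst
  have h : cross u (s • p + t • q - x) = s * cross u (p - x) + t * cross u (q - x) := by
    simp only [cross, Prod.fst_sub, Prod.snd_sub, Prod.fst_add, Prod.snd_add, Prod.smul_fst,
      Prod.smul_snd, smul_eq_mul]
    linear_combination (u.1 * x.2 - u.2 * x.1) * hst
  have hp' : 0 ≤ cross u (p - x) := hp
  have hq' : 0 ≤ cross u (q - x) := hq
  rw [mem_ofPred_eq, h]
  positivity

theorem cross_self (u : Plane) : cross u u = 0 := by simp [cross, mul_comm]

theorem cross_swap (u v : Plane) : cross u v = -cross v u := by simp [cross]; ring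

/-- If all other vertices lie strictly to the left of the ray from `x` through `V i`, then `T`
reflects `x` in `V i`. -/
theorem T_eq_of_cross_pos (lam : ℝ) {x : Plane} {i : Fin n}
    (h : ∀ j, j ≠ i → 0 < cross (V i - x) (V j - x)) :
    T V lam x = V i + lam • (V i - x) := by
  have hi : IsTangentVertex V x i := by
    intro p hp
    refine convexHull_min ?_ (convex_cross_nonneg (V i - x) x) hp
    rintro _ ⟨j, rfl⟩
    rw [mem_ofPred_eq]
    by_cases hj : j = i
    · rw [hj, cross_self]
    · exact (h j hj).le
  have hu : ∀ j, IsTangentVertex V x j → j = i := by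
    intro j hj
    by_contra hne
    have h1 := hj (V i) (subset_convexHull ℝ _ (mem_range_self i))
    have h2 := h j hne
    rw [cross_swap] at h1
    linarith
  have hex : ∃! i : Fin n, IsTangentVertex V x i := ⟨i, hi, hu⟩
  rw [T, dif_pos hex, hu _ hex.choose_spec.1]

end Polygon

section Quad

variable {a : ℝ}

theorem fst_nonneg_of_mem_polygon (ha : 0 ≤ a) {p : Plane} (hp : p ∈ polygon (quad a)) :
    0 ≤ p.1 := by
  have h : Convex ℝ {p : Plane | 0 ≤ p.1} :=
    convex_halfSpace_ge (f := fun p : Plane => p.1) ⟨fun _ _ => rfl, fun _ _ => rfl⟩ 0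
  refine convexHull_min ?_ h hp
  rintro _ ⟨i, rfl⟩
  fin_cases i <;> simp [quad, ha]

theorem snd_le_one_of_mem_polygon {p : Plane} (hp : p ∈ polygon (quad a)) : p.2 ≤ 1 := by
  have h : Convex ℝ {p : Plane | p.2 ≤ 1} :=
    convex_halfSpace_le (f := fun p : Plane => p.2) ⟨fun _ _ => rfl, fun _ _ => rfl⟩ 1
  refine convexHull_min ?_ h hp
  rintro _ ⟨i, rfl⟩
  fin_cases i <;> simp [quad]; norm_num

theorem snd_nonneg_of_mem_polygon {p : Plane} (hp : p ∈ polygon (quad a)) : 0 ≤ p.2 := by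
  have h : Convex ℝ {p : Plane | 0 ≤ p.2} :=
    convex_halfSpace_ge (f := fun p : Plane => p.2) ⟨fun _ _ => rfl, fun _ _ => rfl⟩ 0
  refine convexHull_min ?_ h hp
  rintro _ ⟨i, rfl⟩
  fin_cases i <;> simp [quad]

theorem le_of_mem_polygon (ha0 : 0 ≤ a) (ha : a ≤ 1) {p : Plane} (hp : p ∈ polygon (quad a)) :
    4 / 5 * (p.1 - a) ≤ (1 - a) * (1 - p.2) := by
  have h : Convex ℝ {p : Plane | 4 / 5 * p.1 + (1 - a) * p.2 ≤ 4 / 5 * a + (1 - a)} :=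
    convex_halfSpace_le (f := fun p : Plane => 4 / 5 * p.1 + (1 - a) * p.2)
      ⟨fun _ _ => by simp; ring, fun _ _ => by simp; ring⟩ _
  have := convexHull_min ?_ h hp
  · simp only [mem_ofPred_eq] at this
    linarith
  rintro _ ⟨i, rfl⟩
  fin_cases i <;> simp [quad] <;> linarith

/-- The point lies on the vertical segment from `(x, x / 5)` on `DC` to `(x, 1)` on `AB`. This
excludes, among points outside `P` near `AB`, those that lie below it. -/
theorem mem_polygon_of_mem_strip {x y : ℝ} (hx : 0 ≤ x) (hxa : x ≤ a) (ha : a ≤ 1)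
    (hy : 1 / 2 ≤ y) (hy1 : y ≤ 1) : ((x, y) : Plane) ∈ polygon (quad a) := by
  have hc : Convex ℝ (polygon (quad a)) := convex_convexHull ℝ _
  have hV : ∀ i, quad a i ∈ polygon (quad a) :=
    fun i => subset_convexHull ℝ _ (mem_range_self i)
  have htop : ((x, 1) : Plane) ∈ polygon (quad a) := by
    rcases hx.eq_or_lt with rfl | hx0
    · exact hV 0
    have ha0 : 0 < a := hx0.trans_le hxa
    have := hc (hV 0) (hV 1) (a := 1 - x / a) (b := x / a)
      (by rw [sub_nonneg, div_le_one ha0]; exact hxa) (by positivity) (by ring)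
    convert this using 1
    ext <;> simp [quad]
    field_simp
  have hbot : ((x, x / 5) : Plane) ∈ polygon (quad a) := by
    have := hc (hV 3) (hV 2) (a := 1 - x) (b := x) (by linarith) hx (by ring)
    convert this using 1
    ext <;> simp [quad]
    ring
  have h5 : (0 : ℝ) < 1 - x / 5 := by linarith
  obtain ⟨t, ht⟩ : ∃ t, t * (1 - x / 5) = y - x / 5 := ⟨_, div_mul_cancel₀ _ h5.ne'⟩
  have ht0 : 0 ≤ t := by
    by_contra! h
    nlinarith
  have ht1 : t ≤ 1 := by
    by_contra! h
    nlinarith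
  have := hc hbot htop (a := 1 - t) (b := t) (by linarith) ht0 (by ring)
  convert this using 1
  ext <;> simp
  · ring
  · linarith

theorem mem_singularSet_iff {p : Plane} (ha : a ∈ Icc (0.3 : ℝ) 0.6) :
    p ∈ singularSet (quad a) ↔ (p.2 = 1 ∧ 0 ≤ p.1) ∨
      (4 / 5 * (p.1 - a) = (1 - a) * (1 - p.2) ∧ p.2 ≤ 1) ∨
      (p.2 = p.1 / 5 ∧ p.1 ≤ 1) ∨ (p.1 = 0 ∧ 0 ≤ p.2) := by
  obtain ⟨x, y⟩ := p
  obtain ⟨h1, h2⟩ := ha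
  norm_num at h1 h2
  have ha0 : 0 < a := by linarith
  constructor
  · rintro ⟨i, t, ht, h⟩
    fin_cases i <;> simp [quad, Prod.ext_iff] at h <;> obtain ⟨rfl, rfl⟩ := h
    · left; exact ⟨rfl, by positivity⟩
    · right; left; constructor
      · ring
      · show 1 + t * (5⁻¹ - 1) ≤ 1
        linarith
    · right; right; left; constructor
      · ring
      · show 1 + -t ≤ 1
        linarith
    · right; right; right; exact ⟨rfl, ht⟩
  · simp only
    rintro (⟨rfl, h⟩ | ⟨h, h'⟩ | ⟨h, h'⟩ | ⟨rfl, h⟩)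
    · refine ⟨0, x / a, by positivity, ?_⟩
      ext <;> simp [quad]
      field_simp
    · refine ⟨1, (1 - y) * (5 / 4), by linarith, ?_⟩
      ext <;> simp [quad] <;> linarith
    · refine ⟨2, 1 - x, by linarith, ?_⟩
      ext <;> simp [quad]; linarith
    · refine ⟨3, y, h, ?_⟩
      ext <;> simp [quad]

variable {x y : ℝ}

theorem T_D (ha : a ∈ Icc (0.3 : ℝ) 0.6) (hx : x < 0) (hy : 0 < y) :
    T (quad a) lam (x, y) = (-(4 / 5) * x, -(4 / 5) * y) := by
  obtain ⟨h1, h2⟩ := ha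
  norm_num at h1 h2
  have : 0 < a * y := by nlinarith
  rw [T_eq_of_cross_pos lam (i := 3)]
  · ext <;> simp [quad, lam]
  · intro j hj
    fin_cases j <;> simp [quad, cross] at hj ⊢ <;> nlinarith

theorem T_C (ha : a ∈ Icc (0.3 : ℝ) 0.6) (hy : y < 0) (hyx : y < x / 5)
    (hxy : 4 / 5 * (x - a) < (1 - a) * (1 - y)) :
    T (quad a) lam (x, y) = (9 / 5 - 4 / 5 * x, 9 / 25 - 4 / 5 * y) := by
  obtain ⟨h1, h2⟩ := ha
  norm_num at h1 h2
  have : a * y < 0 := by nlinarith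
  rw [T_eq_of_cross_pos lam (i := 2)]
  · ext <;> simp [quad, lam] <;> ring
  · intro j hj
    fin_cases j <;> simp [quad, cross] at hj ⊢ <;> nlinarith

theorem T_B (ha : a ∈ Icc (0.3 : ℝ) 0.6) (hy : 0 < y) (hy1 : y < 1)
    (hxy : (1 - a) * (1 - y) < 4 / 5 * (x - a)) :
    T (quad a) lam (x, y) = (9 / 5 * a - 4 / 5 * x, 9 / 5 - 4 / 5 * y) := by
  obtain ⟨h1, h2⟩ := ha
  norm_num at h1 h2
  have : 0 < (1 - a) * (1 - y) := by nlinarith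
  have : 0 < a * (1 - y) := by nlinarith
  rw [T_eq_of_cross_pos lam (i := 1)]
  · ext <;> simp [quad, lam] <;> ring
  · intro j hj
    fin_cases j <;> simp [quad, cross] at hj ⊢ <;> nlinarith

theorem T_A (ha : a ∈ Icc (0.3 : ℝ) 0.6) (hx : 0 < x) (hy : 1 < y) :
    T (quad a) lam (x, y) = (-(4 / 5) * x, 9 / 5 - 4 / 5 * y) := by
  obtain ⟨h1, h2⟩ := ha
  norm_num at h1 h2
  have : 0 < a * (y - 1) := by nlinarith
  rw [T_eq_of_cross_pos lam (i := 0)]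
  · ext <;> simp [quad, lam] ; ring
  · intro j hj
    fin_cases j <;> simp [quad, cross] at hj ⊢ <;> nlinarith

theorem mem_billiardDomain_D (ha : a ∈ Icc (0.3 : ℝ) 0.6) (hx : x < 0) (hy : 0 < y) :
    ((x, y) : Plane) ∈ billiardDomain (quad a) := by
  have h := ha
  obtain ⟨h1, h2⟩ := h
  norm_num at h1 h2
  rintro (h | h)
  · have := fst_nonneg_of_mem_polygon (by linarith) h
    simp at this; linarith
  · rw [mem_singularSet_iff ha] at h
    simp only at h
    rcases h with ⟨h, h'⟩ | ⟨h, h'⟩ | ⟨h, h'⟩ | ⟨h, h'⟩ <;> nlinarith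

theorem mem_billiardDomain_C (ha : a ∈ Icc (0.3 : ℝ) 0.6) (hy : y < 0) (hyx : y < x / 5)
    (hxy : 4 / 5 * (x - a) < (1 - a) * (1 - y)) :
    ((x, y) : Plane) ∈ billiardDomain (quad a) := by
  rintro (h | h)
  · have := snd_nonneg_of_mem_polygon h
    simp at this; linarith
  · rw [mem_singularSet_iff ha] at h
    simp only at h
    rcases h with ⟨h, h'⟩ | ⟨h, h'⟩ | ⟨h, h'⟩ | ⟨h, h'⟩ <;> linarith

theorem mem_billiardDomain_B (ha : a ∈ Icc (0.3 : ℝ) 0.6) (hy : 1 / 2 < y) (hy1 : y < 1)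
    (hxy : (1 - a) * (1 - y) < 4 / 5 * (x - a)) :
    ((x, y) : Plane) ∈ billiardDomain (quad a) := by
  have h := ha
  obtain ⟨h1, h2⟩ := h
  norm_num at h1 h2
  have h0 : 0 < (1 - a) * (1 - y) := by nlinarith
  rintro (h | h)
  · have := le_of_mem_polygon (by linarith) (by linarith) h
    simp at this; linarith
  · rw [mem_singularSet_iff ha] at h
    simp only at h
    rcases h with ⟨h, h'⟩ | ⟨h, h'⟩ | ⟨h, h'⟩ | ⟨h, h'⟩ <;> linarith

theorem mem_billiardDomain_A (ha : a ∈ Icc (0.3 : ℝ) 0.6) (hx : 0 < x) (hy : 1 < y) :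
    ((x, y) : Plane) ∈ billiardDomain (quad a) := by
  rintro (h | h)
  · have := snd_le_one_of_mem_polygon h
    simp at this; linarith
  · rw [mem_singularSet_iff ha] at h
    simp only at h
    rcases h with ⟨h, h'⟩ | ⟨h, h'⟩ | ⟨h, h'⟩ | ⟨h, h'⟩ <;> linarith

end Quad

/-! ### The return to the region below `EA` -/

/-- The reflection of `p` in `v`, contracted by the factor `lam`. -/
def reflect (p v : Plane) : Plane := v + lam • (v - p)

/-- Every contracted reflection is a similarity of ratio `lam`, so only the number of reflections
counts, not their centres. -/
theorem dist_foldl_reflect (l : List Plane) (p q : Plane) :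
    dist (l.foldl reflect p) (l.foldl reflect q) = lam ^ l.length * dist p q := by
  induction l generalizing p q with
  | nil => simp
  | cons v l ih =>
    have h : dist (reflect p v) (reflect q v) = lam * dist p q := by
      rw [reflect, reflect, dist_add_left, dist_smul₀, dist_sub_left]
      norm_num [lam]
    rw [List.foldl_cons, List.foldl_cons, ih, h, List.length_cons, pow_succ, mul_assoc]

/-- Reflections act on each coordinate separately. The nonzero slope carries null sets and
distinctness of points from the reduced map to the plane. -/
theorem exists_fst_foldl_reflect (l : List Plane) :
    ∃ β : ℝ, ∀ p : Plane, (l.foldl reflect p).1 = (-lam) ^ l.length * p.1 + β := by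
  induction l with
  | nil => exact ⟨0, by simp⟩
  | cons v l ih =>
    obtain ⟨β, hβ⟩ := ih
    refine ⟨(-lam) ^ l.length * (v.1 + lam * v.1) + β, fun p => ?_⟩
    rw [List.foldl_cons, hβ, List.length_cons]
    simp only [reflect, Prod.fst_add, Prod.smul_fst, Prod.fst_sub, smul_eq_mul]
    ring

theorem continuous_foldl_reflect (l : List Plane) :
    Continuous fun p : Plane => l.foldl reflect p := by
  induction l with
  | nil => exact continuous_id
  | cons v l ih =>
    simp only [List.foldl_cons]
    refine ih.comp ?_
    unfold reflect
    fun_prop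

/-- Starting below the segment `EA`, the first coordinate of the third iterate of `T`. -/
def crossing (a x : ℝ) : ℝ := 9 / 5 * a - 36 / 25 - 64 / 125 * x

/-- The reduced map `g`, extended to the real line. -/
def reduced (a x : ℝ) : ℝ :=
  if 0 < crossing a x then -(4 / 5) * crossing a x else -(36 / 25) - 64 / 125 * crossing a x

/-- The vertices used during one return to the region below `EA`. -/
def word (a : ℝ) : Bool → List Plane
  | true => [(0, 0), (1, 1 / 5), (a, 1), (0, 1)]
  | false => [(0, 0), (1, 1 / 5), (a, 1), (0, 0), (1, 1 / 5), (0, 1)]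

theorem word_length_pos (a : ℝ) (b : Bool) : 0 < (word a b).length := by
  cases b <;> simp [word]

theorem word_length_le (a : ℝ) (b : Bool) : (word a b).length ≤ 6 := by
  cases b <;> simp [word]

/-- At the discontinuity, where `crossing` vanishes, the symbol is `false`, in agreement with the
branch chosen in `reduced`. -/
def symbol (a x : ℝ) : Bool := decide (0 < crossing a x)

theorem ell_eq (a : ℝ) : ell a = 5 / 4 + (1 - a) * (25 / 16) := by
  norm_num [ell, lam]

/-- The points near the segment `EA` and the part of `AB` before the singular ray `BC`. -/
def Near (a : ℝ) (p : Plane) : Prop :=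
  -ell a < p.1 ∧ p.1 < a ∧ |p.2 - 1| ≤ 1 / 8 ∧ 2 * |p.2 - 1| ≤ p.1 + ell a

/-- The points near the segment `EA` and strictly below it. -/
def Below (a : ℝ) (p : Plane) : Prop := Near a p ∧ p.1 < 0 ∧ p.2 < 1

variable {a : ℝ}

/-- Reflection in `D` takes `E` to `G` on the line `BC`. The wedge condition at `E` in `Near` keeps
the reflected point strictly on the inner side of that line, which makes `C` the next tangent
vertex. -/
theorem T_near (ha : a ∈ Icc (0.3 : ℝ) 0.6) {x y : ℝ} (h : Near a (x, y)) (hx : x < 0) :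
    ((x, y) : Plane) ∈ billiardDomain (quad a) ∧
    T (quad a) lam (x, y) = (-(4 / 5) * x, -(4 / 5) * y) ∧
    ((-(4 / 5) * x, -(4 / 5) * y) : Plane) ∈ billiardDomain (quad a) ∧
    T (quad a) lam (-(4 / 5) * x, -(4 / 5) * y) = (9 / 5 + 16 / 25 * x, 9 / 25 + 16 / 25 * y) := by
  obtain ⟨h1, -, h3, h4⟩ := h
  have ha' := ha
  obtain ⟨ha1, ha2⟩ := ha'
  norm_num at ha1 ha2
  simp only [ell_eq] at h1 h3 h4
  have h5 := abs_le.1 h3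
  have h6 := neg_abs_le (y - 1)
  have h7 : (1 - a) * (1 - y) ≤ 7 / 10 * |y - 1| := by
    rcases le_total 0 (1 - y) with h | h
    · rw [abs_of_nonpos (by linarith)]; nlinarith
    · have := abs_nonneg (y - 1); nlinarith
  have h8 : 4 / 5 * (-(4 / 5) * x - a) < (1 - a) * (1 - -(4 / 5) * y) := by nlinarith
  refine ⟨mem_billiardDomain_D ha hx (by linarith), T_D ha hx (by linarith),
    mem_billiardDomain_C ha (by linarith) (by linarith) h8, ?_⟩
  rw [T_C ha (by linarith) (by linarith) h8]
  ext <;> simp <;> ring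

/-- After `D` and `C` the point `E` would sit at `B`; the same wedge condition puts the actual point
strictly beyond the line `BC`, so that `B` is the tangent vertex. -/
theorem T_right_below (ha : a ∈ Icc (0.3 : ℝ) 0.6) {x y : ℝ} (h : Near a (x, y)) (hy : y < 1) :
    ((9 / 5 + 16 / 25 * x, 9 / 25 + 16 / 25 * y) : Plane) ∈ billiardDomain (quad a) ∧
    T (quad a) lam (9 / 5 + 16 / 25 * x, 9 / 25 + 16 / 25 * y) =
      (crossing a x, 189 / 125 - 64 / 125 * y) := by
  obtain ⟨h1, -, h3, h4⟩ := h
  have ha' := ha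
  obtain ⟨ha1, ha2⟩ := ha'
  norm_num at ha1 ha2
  simp only [ell_eq] at h1 h3 h4
  rw [abs_of_neg (by linarith)] at h3 h4
  have h8 : (1 - a) * (1 - (9 / 25 + 16 / 25 * y)) < 4 / 5 * (9 / 5 + 16 / 25 * x - a) := by
    nlinarith
  refine ⟨mem_billiardDomain_B ha (by linarith) (by linarith) h8, ?_⟩
  rw [T_B ha (by linarith) (by linarith) h8, crossing]
  ext <;> simp <;> ring

theorem T_right_above (ha : a ∈ Icc (0.3 : ℝ) 0.6) {x y : ℝ} (h : Near a (x, y)) (hy : 1 < y) :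
    ((9 / 5 + 16 / 25 * x, 9 / 25 + 16 / 25 * y) : Plane) ∈ billiardDomain (quad a) ∧
    T (quad a) lam (9 / 5 + 16 / 25 * x, 9 / 25 + 16 / 25 * y) =
      (-(36 / 25) - 64 / 125 * x, 189 / 125 - 64 / 125 * y) := by
  obtain ⟨h1, -, h3, h4⟩ := h
  have ha' := ha
  obtain ⟨ha1, ha2⟩ := ha'
  norm_num at ha1 ha2
  simp only [ell_eq] at h1 h3 h4
  refine ⟨mem_billiardDomain_A ha (by linarith) (by linarith), ?_⟩
  rw [T_A ha (by linarith) (by linarith)]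
  ext <;> simp <;> ring

/-- `crossing` is decreasing and, by the choice of `ell`, equals `a` at `E`. -/
theorem crossing_bounds (ha : a ∈ Icc (0.3 : ℝ) 0.6) {x : ℝ} (h1 : -ell a < x) (h2 : x < 0) :
    -(9 / 10) < crossing a x ∧ crossing a x < a := by
  obtain ⟨ha1, ha2⟩ := ha
  norm_num at ha1 ha2
  rw [ell_eq] at h1
  unfold crossing
  constructor <;> linarith

theorem Below.near_crossing (ha : a ∈ Icc (0.3 : ℝ) 0.6) {x y : ℝ} (h : Below a (x, y)) :
    Near a (crossing a x, 189 / 125 - 64 / 125 * y) ∧ 1 < 189 / 125 - 64 / 125 * y := by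
  obtain ⟨⟨h1, -, h3, h4⟩, hx, hy⟩ := h
  obtain ⟨h5, h6⟩ := crossing_bounds ha h1 hx
  obtain ⟨ha1, ha2⟩ := ha
  norm_num at ha1 ha2
  simp only [ell_eq] at h1 h3 h4 hx hy
  rw [abs_of_neg (by linarith)] at h3 h4
  refine ⟨⟨?_, h6, ?_, ?_⟩, ?_⟩
  · simp only [ell_eq]; linarith
  · rw [abs_of_pos (by linarith)]; linarith
  · simp only [ell_eq]; rw [abs_of_pos (by linarith)]; linarith
  · linarith

/-- The iterates of `T` at a point below `EA`, up to the crossing of `EA`. -/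
theorem Below.iterate_three (ha : a ∈ Icc (0.3 : ℝ) 0.6) {x y : ℝ} (h : Below a (x, y)) :
    (∀ j < 3, (T (quad a) lam)^[j] (x, y) ∈ billiardDomain (quad a)) ∧
    (T (quad a) lam)^[1] (x, y) = (-(4 / 5) * x, -(4 / 5) * y) ∧
    (T (quad a) lam)^[2] (x, y) = (9 / 5 + 16 / 25 * x, 9 / 25 + 16 / 25 * y) ∧
    (T (quad a) lam)^[3] (x, y) = (crossing a x, 189 / 125 - 64 / 125 * y) := by
  obtain ⟨d0, e1, d1, e2⟩ := T_near ha h.1 h.2.1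
  obtain ⟨d2, e3⟩ := T_right_below ha h.1 h.2.2
  have f1 : (T (quad a) lam)^[1] (x, y) = (-(4 / 5) * x, -(4 / 5) * y) := e1
  have f2 : (T (quad a) lam)^[2] (x, y) = (9 / 5 + 16 / 25 * x, 9 / 25 + 16 / 25 * y) := by
    rw [Function.iterate_succ_apply', f1, e2]
  refine ⟨fun j hj => ?_, f1, f2, by rw [Function.iterate_succ_apply', f2, e3]⟩
  interval_cases j
  · exact d0
  · rw [f1]; exact d1
  · rw [f2]; exact d2

/-- The return to the region below `EA` when the crossing point lies above `AB`. -/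
theorem Below.iterate_four (ha : a ∈ Icc (0.3 : ℝ) 0.6) {x y : ℝ} (h : Below a (x, y))
    (hc : 0 < crossing a x) :
    (T (quad a) lam)^[3] (x, y) ∈ billiardDomain (quad a) ∧
    (T (quad a) lam)^[4] (x, y) = (-(4 / 5) * crossing a x, 1 -
      256 / 625 * (1 - y)) := by
  obtain ⟨-, -, -, e3⟩ := h.iterate_three ha
  obtain ⟨hn, h1⟩ := h.near_crossing ha
  rw [Function.iterate_succ_apply' _ 3, e3, T_A ha hc h1]
  refine ⟨mem_billiardDomain_A ha hc h1, ?_⟩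
  ext <;> simp; ring

/-- The return to the region below `EA` when the crossing point lies on `EA`. -/
theorem Below.iterate_six (ha : a ∈ Icc (0.3 : ℝ) 0.6) {x y : ℝ} (h : Below a (x, y))
    (hc : crossing a x < 0) :
    (∀ j < 6, (T (quad a) lam)^[j] (x, y) ∈ billiardDomain (quad a)) ∧
    (T (quad a) lam)^[4] (x, y) =
      (-(4 / 5) * crossing a x, -(4 / 5) * (189 / 125 - 64 / 125 * y)) ∧
    (T (quad a) lam)^[5] (x, y) =
      (9 / 5 + 16 / 25 * crossing a x, 9 / 25 + 16 / 25 * (189 / 125 - 64 / 125 * y)) ∧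
    (T (quad a) lam)^[6] (x, y) =
      (-(36 / 25) - 64 / 125 * crossing a x, 1 - 4096 / 15625 * (1 - y)) := by
  obtain ⟨d, -, -, e3⟩ := h.iterate_three ha
  obtain ⟨hn, h1⟩ := h.near_crossing ha
  obtain ⟨d3, f4, d4, f5⟩ := T_near ha hn hc
  obtain ⟨d5, f6⟩ := T_right_above ha hn h1
  have e4 : (T (quad a) lam)^[4] (x, y) =
      (-(4 / 5) * crossing a x, -(4 / 5) * (189 / 125 - 64 / 125 * y)) := by
    rw [Function.iterate_succ_apply', e3, f4]
  have e5 : (T (quad a) lam)^[5] (x, y) =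
      (9 / 5 + 16 / 25 * crossing a x, 9 / 25 + 16 / 25 * (189 / 125 - 64 / 125 * y)) := by
    rw [Function.iterate_succ_apply', e4, f5]
  refine ⟨fun j hj => ?_, e4, e5, ?_⟩
  · rcases Nat.lt_or_ge j 3 with h3 | h3
    · exact d j h3
    interval_cases j
    · rw [e3]; exact d3
    · rw [e4]; exact d4
    · rw [e5]; exact d5
  · rw [Function.iterate_succ_apply', e5, f6]
    ext <;> simp; ring

/-- The bound -36/25 is the value of the long branch at the discontinuity. It exceeds `-ell a`, so
returns stay at a definite distance from `E`. -/
theorem reduced_mem (ha : a ∈ Icc (0.3 : ℝ) 0.6) {x : ℝ} (h1 : -ell a < x) (h2 : x < 0) :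
    -(36 / 25) ≤ reduced a x ∧ reduced a x < 0 := by
  obtain ⟨h3, h4⟩ := crossing_bounds ha h1 h2
  obtain ⟨ha1, ha2⟩ := ha
  norm_num at ha1 ha2
  unfold reduced
  split_ifs with h
  · constructor <;> linarith
  · constructor <;> linarith

theorem neg_ell_lt (ha : a ∈ Icc (0.3 : ℝ) 0.6) : -ell a < -(8 / 5) := by
  obtain ⟨ha1, ha2⟩ := ha
  norm_num at ha1 ha2
  rw [ell_eq]
  linarith

/-- The orbit of a point below `EA` until its return. -/
theorem Below.cycle (ha : a ∈ Icc (0.3 : ℝ) 0.6) {p : Plane} (h : Below a p)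
    (hc : crossing a p.1 ≠ 0) :
    (∀ j ≤ (word a (symbol a p.1)).length,
      (T (quad a) lam)^[j] p = ((word a (symbol a p.1)).take j).foldl reflect p) ∧
    (∀ j < (word a (symbol a p.1)).length, (T (quad a) lam)^[j] p ∈ billiardDomain (quad a)) ∧
    (∀ j, 0 < j → j < (word a (symbol a p.1)).length →
      0 < ((T (quad a) lam)^[j] p).1 ∨ 1 < ((T (quad a) lam)^[j] p).2) ∧
    ((T (quad a) lam)^[(word a (symbol a p.1)).length] p).1 = reduced a p.1 ∧
    ((T (quad a) lam)^[(word a (symbol a p.1)).length] p).2 < 1 ∧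
    1 - ((T (quad a) lam)^[(word a (symbol a p.1)).length] p).2 ≤ 64 / 125 * (1 - p.2) := by
  obtain ⟨x, y⟩ := p
  simp only at hc ⊢
  obtain ⟨d, e1, e2, e3⟩ := h.iterate_three ha
  obtain ⟨hn, h1⟩ := h.near_crossing ha
  have hx : x < 0 := h.2.1
  have hy : y < 1 := h.2.2
  have ha1 := ha.1
  norm_num at ha1
  have hxl : 0 < 9 / 5 + 16 / 25 * x := by
    have := h.1.1
    simp only [ell_eq] at this
    linarith
  rcases lt_or_gt_of_ne hc with hc | hc
  · obtain ⟨d', e4, e5, e6⟩ := h.iterate_six ha hc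
    have hs : symbol a x = false := by simp [symbol, hc.le]
    have hlen : (word a (symbol a x)).length = 6 := by rw [hs]; rfl
    obtain ⟨hc1, -⟩ := crossing_bounds ha h.1.1 hx
    refine ⟨fun j hj => ?_, ?_, fun j hj0 hj => ?_, ?_, ?_, ?_⟩
    · rw [hlen] at hj
      rw [hs]
      interval_cases j
      · rfl
      · rw [e1]; simp [word, reflect, lam]
      · rw [e2]; simp [word, reflect, lam]; constructor <;> ring
      · rw [e3]; simp [word, reflect, lam, crossing]; constructor <;> ring
      · rw [e4]; simp [word, reflect, lam, crossing]; constructor <;> ring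
      · rw [e5]; simp [word, reflect, lam, crossing]; constructor <;> ring
      · rw [e6]; simp [word, reflect, lam, crossing]; constructor <;> ring
    · rwa [hlen]
    · rw [hlen] at hj
      interval_cases j
      · rw [e1]; left; show 0 < -(4 / 5) * x; linarith
      · rw [e2]; left; exact hxl
      · rw [e3]; right; exact h1
      · rw [e4]; left; show 0 < -(4 / 5) * crossing a x; linarith
      · rw [e5]; left; show 0 < 9 / 5 + 16 / 25 * crossing a x; linarith
    · rw [hlen, e6, reduced, if_neg hc.not_gt]
    · rw [hlen, e6]; show 1 - 4096 / 15625 * (1 - y) < 1; linarith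
    · rw [hlen, e6]; show 1 - (1 - 4096 / 15625 * (1 - y)) ≤ _; linarith
  · obtain ⟨d', e4⟩ := h.iterate_four ha hc
    have hs : symbol a x = true := by simp [symbol, hc]
    have hlen : (word a (symbol a x)).length = 4 := by rw [hs]; rfl
    refine ⟨fun j hj => ?_, fun j hj => ?_, fun j hj0 hj => ?_, ?_, ?_, ?_⟩
    · rw [hlen] at hj
      rw [hs]
      interval_cases j
      · rfl
      · rw [e1]; simp [word, reflect, lam]
      · rw [e2]; simp [word, reflect, lam]; constructor <;> ring
      · rw [e3]; simp [word, reflect, lam, crossing]; constructor <;> ring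
      · rw [e4]; simp [word, reflect, lam, crossing]; constructor <;> ring
    · rw [hlen] at hj
      rcases Nat.lt_or_ge j 3 with h3 | h3
      · exact d j h3
      · obtain rfl : j = 3 := by omega
        exact d'
    · rw [hlen] at hj
      interval_cases j
      · rw [e1]; left; show 0 < -(4 / 5) * x; linarith
      · rw [e2]; left; exact hxl
      · rw [e3]; right; exact h1
    · rw [hlen, e4, reduced, if_pos hc]
    · rw [hlen, e4]; show 1 - 256 / 625 * (1 - y) < 1; linarith
    · rw [hlen, e4]; show 1 - (1 - 256 / 625 * (1 - y)) ≤ _; linarith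

/-- The wedge condition reproduces itself: a returned point is at distance more than 8/5 - 36/25 =
4/25 from `E` horizontally, while twice its depth is at most 2 · (64/125) · (1/8) = 16/125. -/
theorem Below.return (ha : a ∈ Icc (0.3 : ℝ) 0.6) {p : Plane} (h : Below a p)
    (hc : crossing a p.1 ≠ 0) :
    Below a ((T (quad a) lam)^[(word a (symbol a p.1)).length] p) := by
  obtain ⟨-, -, -, h1, h2, h3⟩ := h.cycle ha hc
  obtain ⟨⟨h4, -, h5, -⟩, h6, h7⟩ := h
  obtain ⟨h8, h9⟩ := reduced_mem ha h4 h6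
  have := neg_ell_lt ha
  rw [abs_of_neg (by linarith)] at h5
  have ha1 := ha.1
  norm_num at ha1
  refine ⟨⟨?_, ?_, ?_, ?_⟩, ?_, h2⟩
  · rw [h1]; linarith
  · rw [h1]; linarith
  · rw [abs_of_neg (by linarith)]; linarith
  · rw [abs_of_neg (by linarith), h1]; linarith
  · rw [h1]; exact h9

/-! ### Itineraries, return times and contraction -/

/-- The symbolic itinerary of `x` under the reduced map. -/
def code (a x : ℝ) (n : ℕ) : Bool := symbol a ((reduced a)^[n] x)

/-- The time at which the `n`-th return takes place. -/
def time (a x : ℝ) (n : ℕ) : ℕ := ∑ i ∈ Finset.range n, (word a (code a x i)).length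

/-- The points below `EA` whose orbits avoid the discontinuities. -/
def Good (a : ℝ) (p : Plane) : Prop :=
  Below a p ∧ ∀ n, crossing a ((reduced a)^[n] p.1) ≠ 0

theorem code_iterate (x : ℝ) (k n : ℕ) : code a ((reduced a)^[k] x) n = code a x (n + k) := by
  rw [code, code, Function.iterate_add_apply]

theorem time_succ (x : ℝ) (n : ℕ) :
    time a x (n + 1) = (word a (code a x n)).length + time a x n := by
  rw [time, time, Finset.sum_range_succ, add_comm]

theorem time_succ' (x : ℝ) (n : ℕ) :
    time a x (n + 1) = (word a (symbol a x)).length + time a (reduced a x) n := by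
  rw [time, time, Finset.sum_range_succ', add_comm]
  rfl

theorem le_time (x : ℝ) (n : ℕ) : n ≤ time a x n := by
  induction n with
  | zero => simp
  | succ n ih =>
    have := word_length_pos a (code a x n)
    rw [time_succ]; omega

theorem time_le (x : ℝ) (n : ℕ) : time a x n ≤ 6 * n := by
  induction n with
  | zero => simp [time]
  | succ n ih =>
    have := word_length_le a (code a x n)
    rw [time_succ]; omega

theorem exists_eq_time_add (x : ℝ) (m : ℕ) :
    ∃ n j, m = time a x n + j ∧ j < (word a (code a x n)).length := by
  induction m with
  | zero => exact ⟨0, 0, by simp [time], word_length_pos _ _⟩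
  | succ m ih =>
    obtain ⟨n, j, rfl, hj⟩ := ih
    by_cases h : j + 1 < (word a (code a x n)).length
    · exact ⟨n, j + 1, by ring, h⟩
    · refine ⟨n + 1, 0, ?_, word_length_pos _ _⟩
      rw [time_succ]; omega

theorem Good.ne {p : Plane} (h : Good a p) : crossing a p.1 ≠ 0 := h.2 0

theorem Good.return (ha : a ∈ Icc (0.3 : ℝ) 0.6) {p : Plane} (h : Good a p) :
    Good a ((T (quad a) lam)^[(word a (symbol a p.1)).length] p) := by
  refine ⟨h.1.return ha h.ne, fun n => ?_⟩
  rw [(h.1.cycle ha h.ne).2.2.2.1]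
  exact h.2 (n + 1)

theorem Good.iterate_time (ha : a ∈ Icc (0.3 : ℝ) 0.6) {p : Plane} (h : Good a p) (n : ℕ) :
    Good a ((T (quad a) lam)^[time a p.1 n] p) ∧
    ((T (quad a) lam)^[time a p.1 n] p).1 = (reduced a)^[n] p.1 ∧
    1 - ((T (quad a) lam)^[time a p.1 n] p).2 ≤ (64 / 125) ^ n := by
  induction n with
  | zero =>
    refine ⟨h, rfl, ?_⟩
    have := abs_le.1 h.1.1.2.2.1
    simp [time]; linarith
  | succ n ih =>
    obtain ⟨h1, h2, h3⟩ := ih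
    have hs : code a p.1 n = symbol a ((T (quad a) lam)^[time a p.1 n] p).1 := by rw [h2, code]
    obtain ⟨-, -, -, h4, -, h5⟩ := h1.1.cycle ha h1.ne
    rw [time_succ, Function.iterate_add_apply, hs]
    refine ⟨h1.return ha, ?_, ?_⟩
    · rw [h4, h2, Function.iterate_succ_apply']
    · rw [pow_succ]; linarith

theorem Good.iterate_time_add (ha : a ∈ Icc (0.3 : ℝ) 0.6) {p : Plane} (h : Good a p) {n j : ℕ}
    (hj : j ≤ (word a (code a p.1 n)).length) :
    (T (quad a) lam)^[time a p.1 n + j] p =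
      ((word a (code a p.1 n)).take j).foldl reflect ((T (quad a) lam)^[time a p.1 n] p) := by
  obtain ⟨h1, h2, -⟩ := h.iterate_time ha n
  have hs : code a p.1 n = symbol a ((T (quad a) lam)^[time a p.1 n] p).1 := by rw [h2, code]
  rw [hs] at hj
  rw [add_comm, Function.iterate_add_apply, (h1.1.cycle ha h1.ne).1 j hj, hs]

theorem Good.mem_billiardDomain (ha : a ∈ Icc (0.3 : ℝ) 0.6) {p : Plane} (h : Good a p) (m : ℕ) :
    (T (quad a) lam)^[m] p ∈ billiardDomain (quad a) := by
  obtain ⟨n, j, rfl, hj⟩ := exists_eq_time_add (a := a) p.1 m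
  obtain ⟨h1, h2, -⟩ := h.iterate_time ha n
  have hs : code a p.1 n = symbol a ((T (quad a) lam)^[time a p.1 n] p).1 := by rw [h2, code]
  rw [hs] at hj
  rw [add_comm, Function.iterate_add_apply]
  exact (h1.1.cycle ha h1.ne).2.1 j hj

theorem Good.mem_regularSet (ha : a ∈ Icc (0.3 : ℝ) 0.6) {p : Plane} (h : Good a p) :
    p ∈ regularSet (quad a) lam :=
  ⟨fun hp => h.mem_billiardDomain ha 0 (Or.inl hp),
    fun k hk => h.mem_billiardDomain ha k (Or.inr hk)⟩

/-- Points with the same itinerary approach one another under `T`. -/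
theorem Good.dist_iterate (ha : a ∈ Icc (0.3 : ℝ) 0.6) {n : ℕ} {p q : Plane} (hp : Good a p)
    (hq : Good a q) (h : ∀ i < n, code a p.1 i = code a q.1 i) :
    time a p.1 n = time a q.1 n ∧ ∀ m ≤ time a p.1 n,
      dist ((T (quad a) lam)^[m] p) ((T (quad a) lam)^[m] q) = lam ^ m * dist p q := by
  induction n generalizing p q with
  | zero => simp [time]
  | succ n ih =>
    have h0 : symbol a p.1 = symbol a q.1 := h 0 (by omega)
    obtain ⟨c1, -, -, c2, -⟩ := hp.1.cycle ha hp.ne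
    obtain ⟨d1, -, -, d2, -⟩ := hq.1.cycle ha hq.ne
    have hpr := hp.return ha
    have hqr := hq.return ha
    have hd : ∀ j ≤ (word a (symbol a p.1)).length,
        dist ((T (quad a) lam)^[j] p) ((T (quad a) lam)^[j] q) = lam ^ j * dist p q := by
      intro j hj
      rw [c1 j hj, d1 j (h0 ▸ hj), h0, dist_foldl_reflect, List.length_take, min_eq_left (h0 ▸ hj)]
    have := ih hpr hqr fun i hi => by
      rw [c2, d2]
      have := h (i + 1) (by omega)
      rwa [← code_iterate p.1 1 i, ← code_iterate q.1 1 i] at this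
    rw [c2, d2] at this
    obtain ⟨h1, h2⟩ := this
    refine ⟨by rw [time_succ', time_succ', h1, h0], fun m hm => ?_⟩
    rcases le_total m (word a (symbol a p.1)).length with hle | hle
    · exact hd m hle
    · obtain ⟨j, rfl⟩ := Nat.exists_eq_add_of_le' hle
      rw [time_succ'] at hm
      have h3 := h2 j (by omega)
      have h4 := hd _ le_rfl
      rw [← h0] at h3
      rw [Function.iterate_add_apply, Function.iterate_add_apply, pow_add, mul_assoc, ← h4, ← h3]

theorem Below.good (ha : a ∈ Icc (0.3 : ℝ) 0.6) {p : Plane} (h : Below a p)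
    (hS : ∀ k, (T (quad a) lam)^[k] p ∉ singularSet (quad a)) : Good a p := by
  refine ⟨h, fun n => ?_⟩
  have hc : ∀ p : Plane, Below a p → (∀ k, (T (quad a) lam)^[k] p ∉ singularSet (quad a)) →
      crossing a p.1 ≠ 0 := by
    rintro ⟨x, y⟩ h hS he
    -- A vanishing crossing coordinate puts the third iterate on the ray `DA`.
    refine hS 3 ?_
    rw [(h.iterate_three ha).2.2.2, mem_singularSet_iff ha]
    right; right; right
    have := (h.near_crossing ha).2
    exact ⟨he, by show 0 ≤ 189 / 125 - 64 / 125 * y; linarith⟩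
  induction n generalizing p with
  | zero => exact hc p h hS
  | succ n ih =>
    have := ih (h.return ha (hc p h hS)) fun k => by
      rw [← Function.iterate_add_apply]; exact hS _
    rwa [(h.cycle ha (hc p h hS)).2.2.2.1] at this

/-- The orbit of every regular point near `EA` enters the set of good points. -/
theorem Near.exists_good (ha : a ∈ Icc (0.3 : ℝ) 0.6) {p : Plane} (h : Near a p)
    (hp : p ∉ polygon (quad a)) (hS : ∀ k, (T (quad a) lam)^[k] p ∉ singularSet (quad a)) :
    ∃ k, Good a ((T (quad a) lam)^[k] p) := by
  suffices ∃ k, Below a ((T (quad a) lam)^[k] p) by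
    obtain ⟨k, hk⟩ := this
    exact ⟨k, hk.good ha fun j => by rw [← Function.iterate_add_apply]; exact hS _⟩
  obtain ⟨x, y⟩ := p
  have ha' := ha
  obtain ⟨ha1, ha2⟩ := ha'
  norm_num at ha1 ha2
  have hl := ell_eq a
  have hx1 : -ell a < x := h.1
  have hxa : x < a := h.2.1
  have hy : |y - 1| ≤ 1 / 8 := h.2.2.1
  have hy' : 2 * |y - 1| ≤ x + ell a := h.2.2.2
  have hyb := abs_le.1 hy
  have hS0 := hS 0
  simp only [Function.iterate_zero, id_eq, mem_singularSet_iff ha, not_or] at hS0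
  rcases lt_or_ge x 0 with hx | hx
  · obtain ⟨-, e1, -, e2⟩ := T_near ha h hx
    have e : (T (quad a) lam)^[2] (x, y) = (9 / 5 + 16 / 25 * x, 9 / 25 + 16 / 25 * y) := by
      rw [Function.iterate_succ_apply', Function.iterate_one, e1, e2]
    rcases lt_trichotomy y 1 with h1 | rfl | h1
    · exact ⟨0, h, hx, h1⟩
    -- A point of `EA` itself reaches the ray `AB` after two steps.
    · exfalso
      refine hS 2 ?_
      rw [e, mem_singularSet_iff ha]
      left
      constructor
      · norm_num
      · show 0 ≤ 9 / 5 + 16 / 25 * x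
        linarith
    · refine ⟨3, ?_⟩
      rw [Function.iterate_succ_apply', e, (T_right_above ha h h1).2]
      rw [abs_of_pos (by linarith)] at hy hy'
      refine ⟨⟨?_, ?_, ?_, ?_⟩, ?_, ?_⟩ <;> simp only <;>
        (try rw [abs_of_neg (by linarith)]) <;> linarith
  · rcases lt_trichotomy y 1 with h1 | rfl | h1
    · exact absurd (mem_polygon_of_mem_strip hx hxa.le (by linarith) (by linarith) h1.le) hp
    · exact absurd ⟨rfl, hx⟩ hS0.1
    · rcases hx.eq_or_lt with rfl | hx
      · exact absurd ⟨rfl, by linarith⟩ hS0.2.2.2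
      refine ⟨1, ?_⟩
      rw [Function.iterate_one, T_A ha hx h1]
      rw [abs_of_pos (by linarith)] at hy hy'
      refine ⟨⟨?_, ?_, ?_, ?_⟩, ?_, ?_⟩ <;> simp only <;>
        (try rw [abs_of_neg (by linarith)]) <;> linarith

/-! ### A trapping neighbourhood and the long-term location of orbits -/

/-- A neighbourhood of the attractor, all of whose regular points are eventually good. -/
def trap (a : ℝ) : Set Plane :=
  {p | (-(8 / 5) < p.1 ∧ p.1 < a ∧ |p.2 - 1| < 1 / 10) ∨
    (-(1 / 8) < p.1 ∧ p.1 < 257 / 200 ∧ |p.2 + 4 / 5| < 1 / 8) ∨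
    (77 / 100 < p.1 ∧ p.1 < 19 / 10 ∧ |p.2 - 1| < 1 / 10)}

/-- The part of the plane visited by the orbits of good points in the long run. -/
def core (a η : ℝ) : Set Plane :=
  {p | (-(36 / 25) ≤ p.1 ∧ p.1 ≤ max 0 (9 / 5 * a - 7 / 10) ∧ |p.2 - 1| ≤ η) ∨
    (0 ≤ p.1 ∧ p.1 ≤ 5 / 4 ∧ |p.2 + 4 / 5| ≤ η) ∨
    (17 / 20 ≤ p.1 ∧ p.1 ≤ 9 / 5 ∧ |p.2 - 1| ≤ η)}

theorem isOpen_trap : IsOpen (trap a) := by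
  have h1 : Continuous fun p : Plane => p.1 := continuous_fst
  have h2 : Continuous fun p : Plane => |p.2 - 1| := by fun_prop
  have h3 : Continuous fun p : Plane => |p.2 + 4 / 5| := by fun_prop
  refine IsOpen.union ?_ (IsOpen.union ?_ ?_)
  · exact (isOpen_lt continuous_const h1).inter
      ((isOpen_lt h1 continuous_const).inter (isOpen_lt h2 continuous_const))
  · exact (isOpen_lt continuous_const h1).inter
      ((isOpen_lt h1 continuous_const).inter (isOpen_lt h3 continuous_const))
  · exact (isOpen_lt continuous_const h1).inter
      ((isOpen_lt h1 continuous_const).inter (isOpen_lt h2 continuous_const))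

theorem isClosed_core (η : ℝ) : IsClosed (core a η) := by
  have h1 : Continuous fun p : Plane => p.1 := continuous_fst
  have h2 : Continuous fun p : Plane => |p.2 - 1| := by fun_prop
  have h3 : Continuous fun p : Plane => |p.2 + 4 / 5| := by fun_prop
  refine IsClosed.union ?_ (IsClosed.union ?_ ?_)
  · exact (isClosed_le continuous_const h1).inter
      ((isClosed_le h1 continuous_const).inter (isClosed_le h2 continuous_const))
  · exact (isClosed_le continuous_const h1).inter
      ((isClosed_le h1 continuous_const).inter (isClosed_le h3 continuous_const))
  · exact (isClosed_le continuous_const h1).inter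
      ((isClosed_le h1 continuous_const).inter (isClosed_le h2 continuous_const))

theorem core_subset_trap (ha : a ∈ Icc (0.3 : ℝ) 0.6) : core a (1 / 20) ⊆ trap a := by
  obtain ⟨ha1, ha2⟩ := ha
  norm_num at ha1 ha2
  rintro p (⟨h1, h2, h3⟩ | ⟨h1, h2, h3⟩ | ⟨h1, h2, h3⟩)
  · left; exact ⟨by linarith, h2.trans_lt (max_lt (by linarith) (by linarith)), by linarith⟩
  · right; left; exact ⟨by linarith, by linarith, by linarith⟩
  · right; right; exact ⟨by linarith, by linarith, by linarith⟩

/-- The left box lies in `Near`; the right box is mapped into `Near`, outside `P`, by a reflection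
in `A` or `B`; the lower box is mapped into the right one by the reflection in `C`. The numerical
bounds of `trap` are chosen to fit this chain. -/
theorem exists_good_of_mem_trap (ha : a ∈ Icc (0.3 : ℝ) 0.6) {p : Plane} (hp : p ∈ trap a)
    (hr : p ∈ regularSet (quad a) lam) : ∃ k, Good a ((T (quad a) lam)^[k] p) := by
  have ha' := ha
  obtain ⟨ha1, ha2⟩ := ha'
  norm_num at ha1 ha2
  have hl := ell_eq a
  have right : ∀ x y : ℝ, 77 / 100 < x → x < 19 / 10 → |y - 1| < 1 / 10 →
      (∀ k, (T (quad a) lam)^[k] (x, y) ∉ singularSet (quad a)) →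
      ∃ k, Good a ((T (quad a) lam)^[k] (x, y)) := by
    intro x y h1 h2 h3 hS
    have h4 := abs_lt.1 h3
    suffices Near a (T (quad a) lam (x, y)) ∧ T (quad a) lam (x, y) ∉ polygon (quad a) by
      obtain ⟨k, hk⟩ := this.1.exists_good ha this.2 fun k => by
        rw [← Function.iterate_succ_apply]; exact hS _
      exact ⟨k + 1, by rwa [Function.iterate_succ_apply]⟩
    rcases lt_trichotomy y 1 with h5 | rfl | h5
    · rw [abs_of_neg (by linarith)] at h3
      rw [T_B ha (by linarith) h5 (by nlinarith)]
      refine ⟨⟨?_, ?_, ?_, ?_⟩, fun h => ?_⟩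
      · show -ell a < 9 / 5 * a - 4 / 5 * x; linarith
      · show 9 / 5 * a - 4 / 5 * x < a; linarith
      · show |9 / 5 - 4 / 5 * y - 1| ≤ 1 / 8
        rw [abs_of_pos (by linarith)]; linarith
      · show 2 * |9 / 5 - 4 / 5 * y - 1| ≤ 9 / 5 * a - 4 / 5 * x + ell a
        rw [abs_of_pos (by linarith)]; linarith
      · have : 9 / 5 - 4 / 5 * y ≤ 1 := snd_le_one_of_mem_polygon h
        linarith
    · refine absurd ?_ (hS 0)
      rw [Function.iterate_zero, id_eq, mem_singularSet_iff ha]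
      exact Or.inl ⟨rfl, by show 0 ≤ x; linarith⟩
    · rw [abs_of_pos (by linarith)] at h3
      rw [T_A ha (by linarith) h5]
      refine ⟨⟨?_, ?_, ?_, ?_⟩, fun h => ?_⟩
      · show -ell a < -(4 / 5) * x; linarith
      · show -(4 / 5) * x < a; linarith
      · show |9 / 5 - 4 / 5 * y - 1| ≤ 1 / 8
        rw [abs_of_neg (by linarith)]; linarith
      · show 2 * |9 / 5 - 4 / 5 * y - 1| ≤ -(4 / 5) * x + ell a
        rw [abs_of_neg (by linarith)]; linarith
      · have : 0 ≤ -(4 / 5) * x := fst_nonneg_of_mem_polygon (by linarith) h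
        linarith
  obtain ⟨x, y⟩ := p
  rcases hp with ⟨h1, h2, h3⟩ | ⟨h1, h2, h3⟩ | ⟨h1, h2, h3⟩ <;> simp only at h1 h2 h3
  · exact Near.exists_good ha ⟨by show -ell a < x; linarith, h2, by show |y - 1| ≤ 1 / 8; linarith,
      by show 2 * |y - 1| ≤ x + ell a; linarith⟩ hr.1 hr.2
  · obtain ⟨h4, h5⟩ := abs_lt.1 h3
    have e := T_C ha (x := x) (y := y) (by linarith) (by linarith) (by nlinarith)
    obtain ⟨k, hk⟩ := right (9 / 5 - 4 / 5 * x) (9 / 25 - 4 / 5 * y) (by linarith) (by linarith)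
      (by rw [abs_lt]; constructor <;> linarith) fun k => by
        rw [← e, ← Function.iterate_succ_apply]; exact hr.2 _
    rw [← e, ← Function.iterate_succ_apply] at hk
    exact ⟨_, hk⟩
  · exact right x y h1 h2 h3 hr.2

/-- The bounds of `core` are roomy estimates of the affine formulas for the iterates when the first
coordinate starts in `[-36/25, 0)`, the range available after one return. -/
theorem Below.iterate_mem_core (ha : a ∈ Icc (0.3 : ℝ) 0.6) {p : Plane} (h : Below a p)
    (hc : crossing a p.1 ≠ 0) (hp : -(36 / 25) ≤ p.1) {η : ℝ} (hη : 1 - p.2 ≤ η) {j : ℕ}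
    (hj : j < (word a (symbol a p.1)).length) : (T (quad a) lam)^[j] p ∈ core a η := by
  obtain ⟨x, y⟩ := p
  simp only at hc hj hp hη
  obtain ⟨-, e1, e2, e3⟩ := h.iterate_three ha
  have hx : x < 0 := h.2.1
  have hy : y < 1 := h.2.2
  have ha' := ha
  obtain ⟨ha1, ha2⟩ := ha'
  norm_num at ha1 ha2
  have h3 : j < 3 → (T (quad a) lam)^[j] (x, y) ∈ core a η := by
    intro hj
    interval_cases j
    · left
      refine ⟨hp, hx.le.trans (le_max_left _ _), ?_⟩
      show |y - 1| ≤ η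
      rw [abs_of_neg (by linarith)]; linarith
    · rw [e1]; right; left
      refine ⟨by show 0 ≤ -(4 / 5) * x; linarith, by show -(4 / 5) * x ≤ 5 / 4; linarith, ?_⟩
      show |-(4 / 5) * y + 4 / 5| ≤ η
      rw [abs_of_pos (by linarith)]; linarith
    · rw [e2]; right; right
      refine ⟨by show 17 / 20 ≤ 9 / 5 + 16 / 25 * x; linarith,
        by show 9 / 5 + 16 / 25 * x ≤ 9 / 5; linarith, ?_⟩
      show |9 / 25 + 16 / 25 * y - 1| ≤ η
      rw [abs_of_neg (by linarith)]; linarith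
  have h3' : (T (quad a) lam)^[3] (x, y) ∈ core a η := by
    rw [e3]; left
    refine ⟨?_, ?_, ?_⟩
    · show -(36 / 25) ≤ crossing a x
      unfold crossing; linarith
    · refine le_trans ?_ (le_max_right _ _)
      show crossing a x ≤ 9 / 5 * a - 7 / 10
      unfold crossing; linarith
    · show |189 / 125 - 64 / 125 * y - 1| ≤ η
      rw [abs_of_pos (by linarith)]; linarith
  rcases Nat.lt_trichotomy j 3 with h4 | rfl | h4
  · exact h3 h4
  · exact h3'
  rcases lt_or_gt_of_ne hc with hc | hc
  · obtain ⟨-, e4, e5, -⟩ := h.iterate_six ha hc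
    have hs : symbol a x = false := by simp [symbol, hc.le]
    have hj' : j < 6 := by rw [hs] at hj; exact hj
    have hc' : -(9 / 10) < crossing a x := by unfold crossing; linarith
    interval_cases j
    · rw [e4]; right; left
      refine ⟨by show 0 ≤ -(4 / 5) * crossing a x; linarith,
        by show -(4 / 5) * crossing a x ≤ 5 / 4; linarith, ?_⟩
      show |-(4 / 5) * (189 / 125 - 64 / 125 * y) + 4 / 5| ≤ η
      rw [abs_of_neg (by linarith)]; linarith
    · rw [e5]; right; right
      refine ⟨by show 17 / 20 ≤ 9 / 5 + 16 / 25 * crossing a x; linarith,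
        by show 9 / 5 + 16 / 25 * crossing a x ≤ 9 / 5; linarith, ?_⟩
      show |9 / 25 + 16 / 25 * (189 / 125 - 64 / 125 * y) - 1| ≤ η
      rw [abs_of_pos (by linarith)]; linarith
  · have hs : symbol a x = true := by simp [symbol, hc]
    have : j < 4 := by rw [hs] at hj; exact hj
    omega

/-! ### Limit sets and admissible steps in the limit -/

section General

variable {n : ℕ} {V : Fin n → Plane} {lam : ℝ}

theorem limitSet_iterate (k : ℕ) (p : Plane) :
    limitSet V lam ((T V lam)^[k] p) = limitSet V lam p := by
  ext x
  have h : (fun m : ℕ => (T V lam)^[m] ((T V lam)^[k] p))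
      = (fun m : ℕ => (T V lam)^[m] p) ∘ (fun m => m + k) := by
    funext m; simp [Function.iterate_add_apply]
  show MapClusterPt _ _ _ ↔ MapClusterPt _ _ _
  rw [h, MapClusterPt, ← Filter.map_map, map_add_atTop_eq_nat, MapClusterPt]

theorem asymptoticToSet_of_iterate {k : ℕ} {p : Plane} {K : Set Plane}
    (h : AsymptoticToSet V lam ((T V lam)^[k] p) K) : AsymptoticToSet V lam p K := by
  refine ⟨?_, by rw [← h.2, limitSet_iterate]⟩
  rw [← tendsto_add_atTop_iff_nat k]
  simpa only [Function.iterate_add_apply] using h.1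

theorem asymptoticToOrbit_of_iterate {k N : ℕ} {p : Plane} {w : ℕ → Plane} (hN : 0 < N)
    (hw : ∀ i, w (i + N) = w i) (h : AsymptoticToOrbit V lam ((T V lam)^[k] p) w) :
    AsymptoticToOrbit V lam p w := by
  obtain ⟨j, hj⟩ := h
  have hw' : ∀ c i, w (i + c * N) = w i := by
    intro c
    induction c with
    | zero => simp
    | succ c ih => intro i; rw [← ih i, ← hw (i + c * N)]; ring_nf
  -- Adding `k` periods before going back `k` steps keeps the shift a natural number.
  refine ⟨j + k * N - k, ?_⟩
  rw [← tendsto_add_atTop_iff_nat k]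
  refine hj.congr fun m => ?_
  have hk : k ≤ k * N := Nat.le_mul_of_pos_right _ hN
  rw [Function.iterate_add_apply, show m + k + (j + k * N - k) = m + j + k * N by omega, hw']

end General

theorem core_mono {η η' : ℝ} (h : η ≤ η') : core a η ⊆ core a η' := by
  rintro p (⟨h1, h2, h3⟩ | ⟨h1, h2, h3⟩ | ⟨h1, h2, h3⟩)
  · left; exact ⟨h1, h2, h3.trans h⟩
  · right; left; exact ⟨h1, h2, h3.trans h⟩
  · right; right; exact ⟨h1, h2, h3.trans h⟩

theorem isCompact_core (ha : a ∈ Icc (0.3 : ℝ) 0.6) : IsCompact (core a (1 / 20)) := by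
  refine (isCompact_Icc (a := ((-2, -2) : Plane)) (b := (2, 2))).of_isClosed_subset
    (isClosed_core _) ?_
  obtain ⟨ha1, ha2⟩ := ha
  norm_num at ha1 ha2
  rintro ⟨x, y⟩ (⟨h1, h2, h3⟩ | ⟨h1, h2, h3⟩ | ⟨h1, h2, h3⟩) <;> simp only at h1 h2 h3 <;>
    rw [abs_le] at h3 <;> (try rw [le_max_iff] at h2) <;>
    refine ⟨⟨?_, ?_⟩, ⟨?_, ?_⟩⟩ <;> simp only <;> (try rcases h2 with h2 | h2) <;> linarith

theorem Good.eventually_mem_core (ha : a ∈ Icc (0.3 : ℝ) 0.6) {p : Plane} (h : Good a p) {η : ℝ}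
    (hη : 0 < η) : ∀ᶠ m in atTop, (T (quad a) lam)^[m] p ∈ core a η := by
  obtain ⟨n₀, hn₀⟩ := exists_pow_lt_of_lt_one hη (show (64 / 125 : ℝ) < 1 by norm_num)
  filter_upwards [eventually_ge_atTop (6 * (n₀ + 2))] with m hm
  obtain ⟨n, j, rfl, hj⟩ := exists_eq_time_add (a := a) p.1 m
  have h1 := time_le (a := a) p.1 n
  have h2 := word_length_le a (code a p.1 n)
  -- After at least one return the first coordinate is a value of `reduced`, hence at least -36/25.
  obtain ⟨k, rfl⟩ : ∃ k, n = k + 1 := ⟨n - 1, by omega⟩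
  obtain ⟨h3, h4, h5⟩ := h.iterate_time ha (k + 1)
  have hs : code a p.1 (k + 1) = symbol a ((T (quad a) lam)^[time a p.1 (k + 1)] p).1 := by
    rw [h4, code]
  obtain ⟨h6, h7, -⟩ := h.iterate_time ha k
  rw [add_comm, Function.iterate_add_apply]
  refine h3.1.iterate_mem_core ha h3.ne ?_ (h5.trans (le_trans ?_ hn₀.le)) (hs ▸ hj)
  · rw [h4, Function.iterate_succ_apply']
    rw [← h7]
    exact (reduced_mem ha h6.1.1.1 h6.1.2.1).1
  · exact pow_le_pow_of_le_one (by norm_num) (by norm_num) (by omega)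

/-- The box containing `z` might vary with `η`, but the heights 1 and -4/5 are far apart. Once the
height is known to be one of them, the horizontal bounds found for `η = 1/20` suffice. -/
theorem mem_core_zero_of_forall {z : Plane} (h : ∀ η > 0, z ∈ core a η) : z ∈ core a 0 := by
  by_cases h1 : z.2 = 1
  · rcases h (1 / 20) (by norm_num) with ⟨h2, h3, -⟩ | ⟨-, -, h4⟩ | ⟨h2, h3, -⟩
    · exact Or.inl ⟨h2, h3, by simp [h1]⟩
    · rw [h1, abs_of_pos (by norm_num)] at h4; norm_num at h4
    · exact Or.inr (Or.inr ⟨h2, h3, by simp [h1]⟩)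
  by_cases h2 : z.2 = -(4 / 5)
  · rcases h (1 / 20) (by norm_num) with ⟨-, -, h4⟩ | ⟨h3, h4, -⟩ | ⟨-, -, h4⟩
    · rw [h2, abs_of_neg (by norm_num)] at h4; norm_num at h4
    · exact Or.inr (Or.inl ⟨h3, h4, by simp [h2]⟩)
    · rw [h2, abs_of_neg (by norm_num)] at h4; norm_num at h4
  exfalso
  have h3 : 0 < |z.2 - 1| := abs_pos.2 (sub_ne_zero.2 h1)
  have h4 : 0 < |z.2 + 4 / 5| := abs_pos.2 fun e => h2 (by linarith)
  have h5 := min_le_left |z.2 - 1| |z.2 + 4 / 5|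
  have h6 := min_le_right |z.2 - 1| |z.2 + 4 / 5|
  have h7 := lt_min h3 h4
  rcases h (min |z.2 - 1| |z.2 + 4 / 5| / 2) (by linarith) with ⟨-, -, h8⟩ | ⟨-, -, h8⟩ | ⟨-, -, h8⟩ <;>
    linarith

/-- In `core a 0` the right piece, and the part of the left piece with nonnegative first coordinate,
lie on the ray `AB`. Elsewhere `T` is locally the reflection in `D` or `C`. -/
theorem continuousAt_T_of_mem_core (ha : a ∈ Icc (0.3 : ℝ) 0.6) {z : Plane} (h : z ∈ core a 0)
    (hS : z ∉ singularSet (quad a)) : ContinuousAt (T (quad a) lam) z ∧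
      z ∈ billiardDomain (quad a) := by
  have ha' := ha
  obtain ⟨ha1, ha2⟩ := ha'
  norm_num at ha1 ha2
  obtain ⟨x, y⟩ := z
  rw [mem_singularSet_iff ha] at hS
  simp only [not_or] at hS
  rcases h with ⟨h1, h2, h3⟩ | ⟨h1, h2, h3⟩ | ⟨h1, h2, h3⟩
  · have hy : y = 1 := by
      have : |y - 1| = 0 := le_antisymm h3 (abs_nonneg _)
      linarith [abs_eq_zero.1 this]
    have hx : x < 0 := by
      by_contra! hx
      exact hS.1 ⟨hy, hx⟩
    refine ⟨?_, mem_billiardDomain_D ha hx (by linarith)⟩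
    have ho : IsOpen {p : Plane | p.1 < 0 ∧ 0 < p.2} :=
      (isOpen_lt continuous_fst continuous_const).inter
        (isOpen_lt continuous_const continuous_snd)
    have hm : {p : Plane | p.1 < 0 ∧ 0 < p.2} ∈ 𝓝 ((x, y) : Plane) :=
      ho.mem_nhds ⟨hx, by show 0 < y; linarith⟩
    refine ContinuousAt.congr (f := fun p : Plane => (-(4 / 5) * p.1, -(4 / 5) * p.2)) ?_ ?_
    · exact Continuous.continuousAt (by fun_prop)
    · filter_upwards [hm] with p hp
      exact (T_D ha hp.1 hp.2).symm
  · have hy : y = -(4 / 5) := by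
      have : |y + 4 / 5| = 0 := le_antisymm h3 (abs_nonneg _)
      linarith [abs_eq_zero.1 this]
    simp only at h1 h2
    have hc : 4 / 5 * (x - a) < (1 - a) * (1 - y) := by rw [hy]; linarith
    refine ⟨?_, mem_billiardDomain_C ha (by linarith) (by linarith) hc⟩
    have ho : IsOpen {p : Plane | p.2 < 0 ∧ p.2 < p.1 / 5 ∧
        4 / 5 * (p.1 - a) < (1 - a) * (1 - p.2)} :=
      (isOpen_lt continuous_snd continuous_const).inter
        ((isOpen_lt (f := fun p : Plane => p.2) (g := fun p => p.1 / 5) (by fun_prop)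
          (by fun_prop)).inter (isOpen_lt (f := fun p : Plane => 4 / 5 * (p.1 - a))
          (g := fun p => (1 - a) * (1 - p.2)) (by fun_prop) (by fun_prop)))
    have hm : {p : Plane | p.2 < 0 ∧ p.2 < p.1 / 5 ∧
        4 / 5 * (p.1 - a) < (1 - a) * (1 - p.2)} ∈ 𝓝 ((x, y) : Plane) :=
      ho.mem_nhds ⟨by show y < 0; linarith, by show y < x / 5; linarith, hc⟩
    refine ContinuousAt.congr
      (f := fun p : Plane => (9 / 5 - 4 / 5 * p.1, 9 / 25 - 4 / 5 * p.2)) ?_ ?_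
    · exact Continuous.continuousAt (by fun_prop)
    · filter_upwards [hm] with p hp
      exact (T_C ha hp.1 hp.2.1 hp.2.2).symm
  · exfalso
    have hy : y = 1 := by
      have : |y - 1| = 0 := le_antisymm h3 (abs_nonneg _)
      linarith [abs_eq_zero.1 this]
    simp only at h1
    exact hS.1 ⟨hy, by linarith⟩

theorem Good.mem_core_zero (ha : a ∈ Icc (0.3 : ℝ) 0.6) {p z : Plane} (h : Good a p)
    {φ : ℕ → ℕ} (hφ : Tendsto φ atTop atTop)
    (hz : Tendsto (fun k => (T (quad a) lam)^[φ k] p) atTop (𝓝 z)) : z ∈ core a 0 :=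
  mem_core_zero_of_forall fun η hη =>
    (isClosed_core η).mem_of_tendsto hz (hφ.eventually (h.eventually_mem_core ha hη))

/-- Limits of consecutive points of an orbit are joined by an admissible step. -/
theorem Good.step_of_tendsto (ha : a ∈ Icc (0.3 : ℝ) 0.6) {p z z' : Plane} (h : Good a p)
    {φ : ℕ → ℕ} (hφ : Tendsto φ atTop atTop)
    (hz : Tendsto (fun k => (T (quad a) lam)^[φ k] p) atTop (𝓝 z))
    (hz' : Tendsto (fun k => (T (quad a) lam)^[φ k + 1] p) atTop (𝓝 z')) :
    Step (quad a) lam z z' := by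
  have hT : Tendsto (T (quad a) lam ∘ fun k => (T (quad a) lam)^[φ k] p) atTop (𝓝 z') := by
    refine hz'.congr fun k => ?_
    rw [Function.iterate_succ_apply']; rfl
  by_cases hS : z ∈ singularSet (quad a)
  · right
    refine ⟨hS, ?_⟩
    have h1 : Tendsto (fun k => (T (quad a) lam)^[φ k] p) atTop (𝓝[billiardDomain (quad a)] z) :=
      tendsto_nhdsWithin_iff.2 ⟨hz, Eventually.of_forall fun k => h.mem_billiardDomain ha _⟩
    exact hT.mapClusterPt.of_comp h1
  · obtain ⟨h1, h2⟩ := continuousAt_T_of_mem_core ha (h.mem_core_zero ha hφ hz) hS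
    exact Or.inl ⟨h2, tendsto_nhds_unique hT (h1.tendsto.comp hz)⟩

theorem isClosed_limitSet (p : Plane) : IsClosed (limitSet (quad a) lam p) :=
  isClosed_setOfPred_clusterPt

theorem Good.limitSet_subset_core (ha : a ∈ Icc (0.3 : ℝ) 0.6) {p : Plane} (h : Good a p) :
    limitSet (quad a) lam p ⊆ core a (1 / 20) := fun _ hz =>
  (isClosed_core _).mem_of_mapClusterPt hz (h.eventually_mem_core ha (by norm_num))

theorem Good.isCompact_limitSet (ha : a ∈ Icc (0.3 : ℝ) 0.6) {p : Plane} (h : Good a p) :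
    IsCompact (limitSet (quad a) lam p) :=
  (isCompact_core ha).of_isClosed_subset (isClosed_limitSet p) (h.limitSet_subset_core ha)

theorem Good.exists_subseq (ha : a ∈ Icc (0.3 : ℝ) 0.6) {p : Plane} (h : Good a p)
    {φ : ℕ → ℕ} (hφ : Tendsto φ atTop atTop) :
    ∃ z ∈ limitSet (quad a) lam p, ∃ ψ : ℕ → ℕ, StrictMono ψ ∧
      Tendsto (fun k => (T (quad a) lam)^[φ (ψ k)] p) atTop (𝓝 z) := by
  obtain ⟨z, -, ψ, hψ, hz⟩ := (isCompact_core ha).tendsto_subseq' (x := fun k => (T (quad a) lam)^[φ k] p)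
    (hφ.eventually (h.eventually_mem_core ha (by norm_num))).frequently
  refine ⟨z, ?_, ψ, hψ, hz⟩
  exact hz.mapClusterPt.of_comp (φ := fun k => φ (ψ k)) (u := fun m => (T (quad a) lam)^[m] p)
    (hφ.comp hψ.tendsto_atTop)

theorem Good.limitSet_nonempty (ha : a ∈ Icc (0.3 : ℝ) 0.6) {p : Plane} (h : Good a p) :
    (limitSet (quad a) lam p).Nonempty :=
  let ⟨z, hz, _⟩ := h.exists_subseq ha tendsto_id
  ⟨z, hz⟩

theorem exists_subseq_of_mem_limitSet {p z : Plane} (h : z ∈ limitSet (quad a) lam p) :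
    ∃ ψ : ℕ → ℕ, StrictMono ψ ∧ Tendsto (fun k => (T (quad a) lam)^[ψ k] p) atTop (𝓝 z) :=
  MapClusterPt.tendsto_subseq h

/-- By compactness of the core, the next and the previous points along a convergent subsequence also
converge after thinning; `Good.step_of_tendsto` joins the limits. -/
theorem Good.isInvariant_limitSet (ha : a ∈ Icc (0.3 : ℝ) 0.6) {p : Plane} (h : Good a p) :
    IsInvariant (quad a) lam (limitSet (quad a) lam p) := by
  constructor
  · intro x hx
    obtain ⟨φ, hφ, hlim⟩ := exists_subseq_of_mem_limitSet hx
    obtain ⟨z, hz, ψ, hψ, hlim'⟩ := h.exists_subseq ha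
      ((tendsto_add_atTop_nat 1).comp hφ.tendsto_atTop)
    exact ⟨z, hz, h.step_of_tendsto ha (hφ.comp hψ).tendsto_atTop
      (hlim.comp hψ.tendsto_atTop) hlim'⟩
  · intro y hy
    obtain ⟨φ, hφ, hlim⟩ := exists_subseq_of_mem_limitSet hy
    obtain ⟨z, hz, ψ, hψ, hlim'⟩ := h.exists_subseq ha
      ((tendsto_sub_atTop_nat 1).comp hφ.tendsto_atTop)
    refine ⟨z, hz, h.step_of_tendsto ha (((tendsto_sub_atTop_nat 1).comp hφ.tendsto_atTop).comp
      hψ.tendsto_atTop) hlim' ?_⟩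
    refine (hlim.comp hψ.tendsto_atTop).congr' ?_
    filter_upwards [(hφ.comp hψ).tendsto_atTop.eventually (eventually_ge_atTop 1)] with k hk
    have hk : 1 ≤ φ (ψ k) := hk
    simp only [Function.comp]
    rw [Nat.sub_add_cancel hk]

theorem Good.asymptoticToSet_limitSet (ha : a ∈ Icc (0.3 : ℝ) 0.6) {p : Plane} (h : Good a p) :
    AsymptoticToSet (quad a) lam p (limitSet (quad a) lam p) := by
  refine ⟨?_, rfl⟩
  by_contra hcon
  rw [Metric.tendsto_atTop] at hcon
  push Not at hcon
  obtain ⟨η, hη, hcon⟩ := hcon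
  choose φ hφ1 hφ2 using hcon
  obtain ⟨z, hz, ψ, hψ, hlim⟩ := h.exists_subseq ha
    (tendsto_atTop_mono hφ1 tendsto_id)
  obtain ⟨k, hk⟩ := ((Metric.tendsto_nhds.1 hlim) η hη).exists
  have h1 := hφ2 (ψ k)
  rw [Real.dist_eq, sub_zero, abs_of_nonneg Metric.infDist_nonneg] at h1
  have h2 := Metric.infDist_le_dist_of_mem (x := (T (quad a) lam)^[φ (ψ k)] p) hz
  linarith

/-! ### The degree one lift and the coding by integer parts -/

theorem ell_pos (ha : a ∈ Icc (0.3 : ℝ) 0.6) : 0 < ell a := by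
  linarith [neg_ell_lt ha]

/-- The lift of the reduced map on the fundamental domain `(0, 1]`. -/
def liftAux (a s : ℝ) : ℝ :=
  1 + reduced a (ell a * (s - 1)) / ell a +
    if symbol a (ell a * (s - 1)) then 0 else 1

/-- The lower bound is the limit at `E`, where `crossing` equals `a`; the long branch ends at `A`
below that limit plus one. All values thus lie in an interval of length one, which makes the
periodic extension monotone across the integers. -/
theorem liftAux_bounds (ha : a ∈ Icc (0.3 : ℝ) 0.6) {s : ℝ} (hs : s ∈ Ioc (0 : ℝ) 1) :
    1 - 4 / 5 * a / ell a < liftAux a s ∧ liftAux a s < 2 - 4 / 5 * a / ell a := by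
  obtain ⟨h0, h1⟩ := hs
  have hl := ell_pos ha
  have hx1 : -ell a < ell a * (s - 1) := by nlinarith
  have hx2 : ell a * (s - 1) ≤ 0 := by nlinarith
  obtain ⟨ha1, ha2⟩ := ha
  norm_num at ha1 ha2
  have hl' := ell_eq a
  rw [liftAux]
  generalize ell a * (s - 1) = x at hx1 hx2
  by_cases hc : 0 < crossing a x
  · have hs : symbol a x = true := by simp [symbol, hc]
    rw [hs, reduced, if_pos hc]
    have h2 : crossing a x < a := by unfold crossing; linarith
    have h3 : 4 / 5 * crossing a x / ell a < 4 / 5 * a / ell a := by gcongr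
    have h4 : 0 < 4 / 5 * crossing a x / ell a := by positivity
    have h5 : -(4 / 5) * crossing a x / ell a = -(4 / 5 * crossing a x / ell a) := by ring
    have h6 : 4 / 5 * a / ell a < 1 := by rw [div_lt_one hl]; linarith
    rw [if_pos rfl, h5]
    constructor <;> linarith
  · have hs : symbol a x = false := by simpa [symbol] using hc
    rw [hs, reduced, if_neg hc]
    push Not at hc
    have h2 : -(9 / 10) ≤ crossing a x := by unfold crossing; linarith
    have h3 : (-(36 / 25) - 64 / 125 * crossing a x) / ell a < -(4 / 5 * a) / ell a := by
      gcongr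
      unfold crossing
      linarith
    have h4 : -1 < (-(36 / 25) - 64 / 125 * crossing a x) / ell a := by
      rw [lt_div_iff₀ hl]; linarith
    have h5 : -(4 / 5 * a) / ell a = -(4 / 5 * a / ell a) := by ring
    have h6 : 0 < 4 / 5 * a / ell a := by positivity
    rw [if_neg (by simp)]
    constructor <;> linarith

theorem liftAux_strictMonoOn (ha : a ∈ Icc (0.3 : ℝ) 0.6) : StrictMonoOn (liftAux a) (Ioc 0 1) := by
  intro s hs t ht hst
  have hl := ell_pos ha
  have hxy : ell a * (s - 1) < ell a * (t - 1) := by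
    apply mul_lt_mul_of_pos_left _ hl; linarith
  have hy : ell a * (t - 1) ≤ 0 := by nlinarith [ht.2]
  obtain ⟨ha1, ha2⟩ := ha
  norm_num at ha1 ha2
  have hl' := ell_eq a
  rw [liftAux, liftAux]
  generalize ell a * (s - 1) = x at *
  generalize ell a * (t - 1) = y at *
  have hcr : crossing a y < crossing a x := by unfold crossing; linarith
  by_cases hcy : 0 < crossing a y
  · have hcx : 0 < crossing a x := by linarith
    have : -(4 / 5) * crossing a x / ell a < -(4 / 5) * crossing a y / ell a :=
      div_lt_div_of_pos_right (by linarith) hl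
    simp only [symbol, hcx, hcy, decide_true, reduced, if_true]
    linarith
  · by_cases hcx : 0 < crossing a x
    · have h1 : -(4 / 5) * crossing a x / ell a < 0 := div_neg_of_neg_of_pos (by linarith) hl
      have h2 : -1 < (-(36 / 25) - 64 / 125 * crossing a y) / ell a := by
        rw [lt_div_iff₀ hl]; linarith
      simp only [symbol, hcx, hcy, decide_true, decide_false, reduced, if_true, if_false]
      simp only [Bool.false_eq_true, if_false]
      linarith
    · have : (-(36 / 25) - 64 / 125 * crossing a x) / ell a <
          (-(36 / 25) - 64 / 125 * crossing a y) / ell a := by gcongr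
      simp only [symbol, hcx, hcy, decide_false, reduced, if_false, Bool.false_eq_true]
      linarith

/-- The degree one lift of the reduced map. -/
def liftFun (a s : ℝ) : ℝ := liftAux a (s - (⌈s⌉ - 1)) + (⌈s⌉ - 1)

/-- The fundamental domain is open at 0 and closed at 1, so `⌈s⌉ - 1` replaces the integer part. -/
theorem sub_ceil_mem (s : ℝ) : s - (⌈s⌉ - 1) ∈ Ioc (0 : ℝ) 1 :=
  ⟨by linarith [Int.ceil_lt_add_one s], by linarith [Int.le_ceil s]⟩

theorem liftFun_of_mem {s : ℝ} (hs : s ∈ Ioc (0 : ℝ) 1) : liftFun a s = liftAux a s := by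
  have : ⌈s⌉ = 1 := by
    rw [Int.ceil_eq_iff]; simpa using hs
  simp [liftFun, this]

theorem liftFun_strictMono (ha : a ∈ Icc (0.3 : ℝ) 0.6) : StrictMono (liftFun a) := by
  intro s t hst
  rw [liftFun, liftFun]
  have hs := sub_ceil_mem s
  have ht := sub_ceil_mem t
  rcases (Int.ceil_mono hst.le).eq_or_lt with h | h
  · rw [← h] at ht ⊢
    have := liftAux_strictMonoOn ha hs ht (by linarith)
    linarith
  · have h1 := (liftAux_bounds ha hs).2
    have h2 := (liftAux_bounds ha ht).1
    have h3 : (⌈s⌉ : ℝ) + 1 ≤ ⌈t⌉ := by exact_mod_cast h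
    linarith

theorem liftFun_add_one (s : ℝ) : liftFun a (s + 1) = liftFun a s + 1 := by
  rw [liftFun, liftFun, Int.ceil_add_one]
  push_cast
  rw [show s + 1 - ((⌈s⌉ : ℝ) + 1 - 1) = s - (⌈s⌉ - 1) by ring]
  ring

def lift (ha : a ∈ Icc (0.3 : ℝ) 0.6) : CircleDeg1Lift where
  toFun := liftFun a
  monotone' := (liftFun_strictMono ha).monotone
  map_add_one' := liftFun_add_one

theorem lift_apply_coord (ha : a ∈ Icc (0.3 : ℝ) 0.6) {x : ℝ} (h1 : -ell a < x) (h2 : x ≤ 0) :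
    lift ha (1 + x / ell a) = 1 + reduced a x / ell a + if symbol a x then 0 else 1 := by
  have hl := ell_pos ha
  have hs : 1 + x / ell a ∈ Ioc (0 : ℝ) 1 := by
    constructor
    · have : -1 < x / ell a := by rw [lt_div_iff₀ hl]; linarith
      linarith
    · have : x / ell a ≤ 0 := div_nonpos_of_nonpos_of_nonneg h2 hl.le
      linarith
  show liftFun a _ = _
  rw [liftFun_of_mem hs, liftAux, show ell a * (1 + x / ell a - 1) = x by field_simp; ring]

theorem iterate_reduced_mem (ha : a ∈ Icc (0.3 : ℝ) 0.6) {x : ℝ} (h1 : -ell a < x) (h2 : x < 0)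
    (n : ℕ) : -ell a < (reduced a)^[n] x ∧ (reduced a)^[n] x < 0 := by
  induction n with
  | zero => exact ⟨h1, h2⟩
  | succ n ih =>
    rw [Function.iterate_succ_apply']
    obtain ⟨h3, h4⟩ := reduced_mem ha ih.1 ih.2
    exact ⟨by linarith [neg_ell_lt ha], h4⟩

theorem coord_mem (ha : a ∈ Icc (0.3 : ℝ) 0.6) {x : ℝ} (h1 : -ell a < x) (h2 : x < 0) :
    1 + x / ell a ∈ Ioo (0 : ℝ) 1 := by
  have hl := ell_pos ha
  constructor
  · have : -1 < x / ell a := by rw [lt_div_iff₀ hl]; linarith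
    linarith
  · have : x / ell a < 0 := div_neg_of_neg_of_pos h2 hl
    linarith

/-- The orbits of the reduced map in terms of those of its lift. -/
theorem lift_iterate_coord (ha : a ∈ Icc (0.3 : ℝ) 0.6) {x : ℝ} (h1 : -ell a < x) (h2 : x < 0)
    (n : ℕ) : (lift ha)^[n] (1 + x / ell a) =
      1 + (reduced a)^[n] x / ell a + ⌊(lift ha)^[n] (1 + x / ell a)⌋ := by
  have key : ∃ k : ℤ, (lift ha)^[n] (1 + x / ell a) = 1 + (reduced a)^[n] x / ell a + k := by
    induction n with
    | zero => exact ⟨0, by simp⟩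
    | succ n ih =>
      obtain ⟨k, hk⟩ := ih
      obtain ⟨h3, h4⟩ := iterate_reduced_mem ha h1 h2 n
      rw [Function.iterate_succ_apply', hk, CircleDeg1Lift.map_add_int,
        lift_apply_coord ha h3 h4.le, Function.iterate_succ_apply']
      split_ifs
      · exact ⟨k, by ring⟩
      · exact ⟨k + 1, by push_cast; ring⟩
  obtain ⟨k, hk⟩ := key
  obtain ⟨h3, h4⟩ := iterate_reduced_mem ha h1 h2 n
  obtain ⟨h5, h6⟩ := coord_mem ha h3 h4
  have : ⌊(lift ha)^[n] (1 + x / ell a)⌋ = k := by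
    rw [hk, Int.floor_add_intCast, Int.floor_eq_zero_iff.2 ⟨h5.le, h6⟩, zero_add]
  rw [this, hk]

/-- The integer part of the lifted orbit of `x`. -/
def turns (ha : a ∈ Icc (0.3 : ℝ) 0.6) (x : ℝ) (n : ℕ) : ℤ := ⌊(lift ha)^[n] (1 + x / ell a)⌋

/-- The lift adds 1 exactly on the branch with symbol `false`, and the circle coordinate of a
reduced orbit stays in the open interval `(0, 1)`; so the integer part counts the long returns. -/
theorem code_eq (ha : a ∈ Icc (0.3 : ℝ) 0.6) {x : ℝ} (h1 : -ell a < x) (h2 : x < 0) (n : ℕ) :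
    code a x n = decide (turns ha x (n + 1) = turns ha x n) := by
  obtain ⟨h3, h4⟩ := iterate_reduced_mem ha h1 h2 n
  have e := lift_iterate_coord ha h1 h2 n
  have e' : (lift ha)^[n + 1] (1 + x / ell a) = 1 + (reduced a)^[n + 1] x / ell a +
      ((turns ha x n + if code a x n then 0 else 1 : ℤ) : ℝ) := by
    rw [Function.iterate_succ_apply', e, CircleDeg1Lift.map_add_int,
      lift_apply_coord ha h3 h4.le, Function.iterate_succ_apply', ← code, turns]
    split_ifs <;> push_cast <;> ring
  obtain ⟨h5, h6⟩ := iterate_reduced_mem ha h1 h2 (n + 1)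
  obtain ⟨h7, h8⟩ := coord_mem ha h5 h6
  have : turns ha x (n + 1) = turns ha x n + if code a x n then 0 else 1 := by
    rw [turns, e', Int.floor_add_intCast, Int.floor_eq_zero_iff.2 ⟨h7.le, h8⟩, zero_add]
  rw [this]
  cases code a x n <;> simp

/-! ### The reduced map and the uniqueness of its rotation number -/

/-- The intermediate points of a cycle lie to the right of the `y`-axis or above `y = 1`, so the
cycle is a first return. For `ε < 1/4` one has `ε ^ 2 ≤ ε / 4`, which gives the wedge condition. -/
theorem firstReturn_cycle (ha : a ∈ Icc (0.3 : ℝ) 0.6) {ε x δ : ℝ} (hε : 0 < ε) (hε' : ε < 1 / 4)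
    (hx : x < 0) (hδ : 0 < δ) (h : ((x, 1 - δ) : Plane) ∈ R2 a ε) :
    Below a (x, 1 - δ) ∧ (crossing a x ≠ 0 →
      ∃ q, FirstReturn (quad a) lam (R2 a ε) (x, 1 - δ) q ∧ q.1 = reduced a x) := by
  have hx1 : -ell a + ε ≤ x := h.1.1
  have hδ' : 1 - ε ^ 2 ≤ 1 - δ := h.2.1
  have ha' := ha
  obtain ⟨ha1, ha2⟩ := ha'
  norm_num at ha1 ha2
  have hsq : ε ^ 2 ≤ ε / 4 := by nlinarith
  have hB : Below a (x, 1 - δ) := by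
    have habs : |1 - δ - 1| = δ := by rw [abs_of_neg (by linarith)]; ring
    refine ⟨⟨?_, ?_, ?_, ?_⟩, hx, ?_⟩ <;> simp only [habs] <;> linarith
  refine ⟨hB, fun hc => ?_⟩
  obtain ⟨-, h1, h2, h3, h4, h5⟩ := hB.cycle ha hc
  simp only at h1 h2 h3 h4 h5
  refine ⟨_, ⟨_, word_length_pos _ _, h1, fun j hj hj' hR => ?_, ⟨⟨?_, ?_⟩, ⟨?_, ?_⟩⟩, rfl⟩, h3⟩
  · rcases h2 j hj hj' with h6 | h6
    · exact absurd hR.1.2 (not_le.2 h6)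
    · exact absurd hR.2.2 (not_le.2 h6)
  · rw [h3]
    have := (reduced_mem ha hB.1.1 hx).1
    rw [ell_eq]; linarith
  · rw [h3]
    exact (reduced_mem ha hB.1.1 hx).2.le
  · linarith
  · exact h4.le

theorem reducedMap_reduced (ha : a ∈ Icc (0.3 : ℝ) 0.6) {x : ℝ} (h1 : -ell a < x) (h2 : x < 0)
    (hc : crossing a x ≠ 0) : ReducedMap a x (reduced a x) := by
  refine ⟨h1, h2.le, ?_⟩
  filter_upwards [Ioo_mem_nhdsGT (show (0 : ℝ) < 1 / 4 by norm_num)] with ε hε δ hδ hm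
  exact (firstReturn_cycle ha hε.1 hε.2 h2 hδ hm).2 hc

theorem firstReturn_unique {n : ℕ} [NeZero n] {V : Fin n → Plane} {lam : ℝ} {Y : Set Plane}
    {p q q' : Plane} (h : FirstReturn V lam Y p q) (h' : FirstReturn V lam Y p q') : q = q' := by
  obtain ⟨m, h1, -, h2, h3, rfl⟩ := h
  obtain ⟨m', h1', -, h2', h3', rfl⟩ := h'
  rcases lt_trichotomy m m' with hm | rfl | hm
  · exact absurd h3 (h2' m h1 hm)
  · rfl
  · exact absurd h3' (h2 m' h1' hm)

theorem eq_of_reducedMap (ha : a ∈ Icc (0.3 : ℝ) 0.6) {x v : ℝ} (h : ReducedMap a x v) :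
    x < 0 ∧ crossing a x ≠ 0 ∧ v = reduced a x := by
  obtain ⟨h1, h2, h3⟩ := h
  -- The scale is small enough for the cycle computation and for `(x, 1 - ε ^ 2)` to belong to the
  -- rectangle.
  obtain ⟨ε, h4, hε, hε'⟩ := (h3.and (Ioo_mem_nhdsGT
    (show (0 : ℝ) < min (1 / 4) (x + ell a) from lt_min (by norm_num) (by linarith)))).exists
  rw [lt_min_iff] at hε'
  have hsq : 0 < ε ^ 2 := by positivity
  have hR : ((x, 1 - ε ^ 2) : Plane) ∈ R2 a ε :=
    ⟨⟨by show -ell a + ε ≤ x; linarith, h2⟩, ⟨le_rfl, by show 1 - ε ^ 2 ≤ 1; linarith⟩⟩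
  obtain ⟨q, hq, rfl⟩ := h4 (ε ^ 2) hsq hR
  have hx : x < 0 := by
    rcases h2.lt_or_eq with h2 | rfl
    · exact h2
    exfalso
    obtain ⟨m, hm, hd, -⟩ := hq
    refine hd 0 hm (Or.inr ?_)
    rw [Function.iterate_zero, id_eq, mem_singularSet_iff ha]
    right; right; right
    exact ⟨rfl, by show 0 ≤ 1 - ε ^ 2; nlinarith [hε'.1]⟩
  obtain ⟨hB, hret⟩ := firstReturn_cycle ha hε hε'.1 hx hsq hR
  have hc : crossing a x ≠ 0 := by
    intro hc
    obtain ⟨m, hm, hd, -, hm', -⟩ := hq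
    obtain ⟨-, e1, e2, e3⟩ := hB.iterate_three ha
    have h6 := (hB.near_crossing ha).2
    rcases Nat.lt_or_ge 3 m with h5 | h5
    · refine hd 3 h5 (Or.inr ?_)
      rw [e3, mem_singularSet_iff ha]
      right; right; right
      exact ⟨hc, by show 0 ≤ 189 / 125 - 64 / 125 * (1 - ε ^ 2); linarith⟩
    · interval_cases m
      · rw [e1] at hm'
        have : -(4 / 5) * x ≤ 0 := hm'.1.2
        linarith
      · rw [e2] at hm'
        have : 9 / 5 + 16 / 25 * x ≤ 0 := hm'.1.2
        have ha1 := ha.1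
        have hl := ell_eq a
        norm_num at ha1
        linarith
      · rw [e3] at hm'
        exact absurd hm'.2.2 (not_le.2 h6)
  refine ⟨hx, hc, ?_⟩
  obtain ⟨q', hq', e⟩ := hret hc
  rw [firstReturn_unique hq hq', e]

theorem isLift_lift (ha : a ∈ Icc (0.3 : ℝ) 0.6) : IsLift a (lift ha) := by
  refine ⟨liftFun_strictMono ha, liftFun_add_one, fun s hs v hv => ?_⟩
  obtain ⟨h1, h2, rfl⟩ := eq_of_reducedMap ha hv
  have hl := ell_pos ha
  have := lift_apply_coord ha hv.1 hv.2.1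
  rw [show 1 + ell a * (s - 1) / ell a = s by field_simp; ring] at this
  rw [this]
  split_ifs
  · exact ⟨0, by simp⟩
  · exact ⟨1, by simp⟩

theorem isRotationNumber_translationNumber (ha : a ∈ Icc (0.3 : ℝ) 0.6) :
    IsRotationNumber a (CircleDeg1Lift.translationNumber (lift ha)) := by
  refine ⟨lift ha, isLift_lift ha, fun s => ?_⟩
  simpa only [CircleDeg1Lift.coe_pow] using (lift ha).tendsto_translationNumber s

/-- Only countably many orbits of the reduced map meet its discontinuity. -/
theorem countable_bad (a : ℝ) : {x | ∃ n, crossing a ((reduced a)^[n] x) = 0}.Countable := by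
  have h1 : ∀ n, {x | crossing a ((reduced a)^[n] x) = 0}.Countable := by
    intro n
    have hpre : ∀ B : Set ℝ, B.Countable → (reduced a ⁻¹' B).Countable := by
      intro B hB
      have i1 : Function.Injective fun x => -(4 / 5) * crossing a x := by
        intro x y h; simp only [crossing] at h; linarith
      have i2 : Function.Injective fun x => -(36 / 25) - 64 / 125 * crossing a x := by
        intro x y h; simp only [crossing] at h; linarith
      refine ((hB.preimage i1).union (hB.preimage i2)).mono fun x hx => ?_
      have hx : reduced a x ∈ B := hx
      rw [reduced] at hx
      split_ifs at hx
      · exact Or.inl hx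
      · exact Or.inr hx
    have h2 : ((reduced a)^[n] ⁻¹' {x | crossing a x = 0}).Countable := by
      induction n with
      | zero =>
        refine (countable_singleton ((9 / 5 * a - 36 / 25) * (125 / 64))).mono fun x hx => ?_
        have hx : crossing a x = 0 := hx
        rw [mem_singleton_iff]
        unfold crossing at hx
        linarith
      | succ n ih => rw [Function.iterate_succ, preimage_comp]; exact hpre _ ih
    exact h2
  have : {x | ∃ n, crossing a ((reduced a)^[n] x) = 0} =
      ⋃ n, {x | crossing a ((reduced a)^[n] x) = 0} := by
    ext x; simp
  rw [this]
  exact countable_iUnion h1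

theorem exists_avoiding {u v : ℝ} (huv : u < v) {B : Set ℝ} (hB : B.Countable) :
    ∃ x ∈ Ioo u v, x ∉ B := by
  by_contra! h
  exact (Cardinal.Real.Ioo_countable_iff.1 (hB.mono h)).not_gt huv

/-- Two lifts of the reduced map differ by an integer, away from the discontinuities. -/
theorem exists_lift_eq_add (ha : a ∈ Icc (0.3 : ℝ) 0.6) {G : ℝ → ℝ} (hG : IsLift a G) :
    ∃ k : ℤ, ∀ x, -ell a < x → x < 0 → crossing a x ≠ 0 →
      G (1 + x / ell a) = lift ha (1 + x / ell a) + k := by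
  have hl := ell_pos ha
  have hF : StrictMono (lift ha) := liftFun_strictMono ha
  have h1 : ∀ x, -ell a < x → x < 0 → crossing a x ≠ 0 →
      ∃ k : ℤ, G (1 + x / ell a) = lift ha (1 + x / ell a) + k := by
    intro x hx1 hx2 hc
    have e : ell a * (1 + x / ell a - 1) = x := by field_simp; ring
    have hv := reducedMap_reduced ha hx1 hx2 hc
    obtain ⟨k, hk⟩ := hG.2.2 (1 + x / ell a) (Ioo_subset_Ioc_self (coord_mem ha hx1 hx2))
      (reduced a x) (by rwa [e])
    rw [lift_apply_coord ha hx1 hx2.le, hk]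
    split_ifs
    · exact ⟨k, by ring⟩
    · exact ⟨k - 1, by push_cast; ring⟩
  -- Between points less than a period apart both lifts increase by an amount in `(0, 1)`, so the
  -- two integers differ by less than 1.
  have h2 : ∀ x y, -ell a < x → x < y → y < 0 → ∀ k k' : ℤ,
      G (1 + x / ell a) = lift ha (1 + x / ell a) + k →
      G (1 + y / ell a) = lift ha (1 + y / ell a) + k' → k = k' := by
    intro x y hx hxy hy k k' e e'
    have hst : 1 + x / ell a < 1 + y / ell a := by gcongr
    have hts : 1 + y / ell a < 1 + x / ell a + 1 := by
      linarith [(coord_mem ha hx (hxy.trans hy)).1, (coord_mem ha (hx.trans hxy) hy).2]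
    have g1 := hG.1 hst
    have g2 := hG.1 hts
    have f1 := hF hst
    have f2 := hF hts
    rw [hG.2.1] at g2
    rw [CircleDeg1Lift.map_add_one] at f2
    apply le_antisymm
    · have : (k : ℝ) < k' + 1 := by linarith
      exact Int.lt_add_one_iff.1 (by exact_mod_cast this)
    · have : (k' : ℝ) < k + 1 := by linarith
      exact Int.lt_add_one_iff.1 (by exact_mod_cast this)
  obtain ⟨x₀, hx₀, hb⟩ := exists_avoiding (show -ell a < 0 by linarith) (countable_bad a)
  have hc₀ : crossing a x₀ ≠ 0 := fun h => hb ⟨0, h⟩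
  obtain ⟨k, hk⟩ := h1 x₀ hx₀.1 hx₀.2 hc₀
  refine ⟨k, fun x hx1 hx2 hc => ?_⟩
  obtain ⟨k', hk'⟩ := h1 x hx1 hx2 hc
  rcases lt_trichotomy x x₀ with h | rfl | h
  · rw [hk', h2 x x₀ hx1 h hx₀.2 k' k hk' hk]
  · exact hk
  · rw [hk', h2 x₀ x hx₀.1 h hx2 k k' hk hk']

/-- Lifts are free at the discontinuities, so they are compared along one orbit that avoids them.
There the iterates differ by exactly `n * k`. -/
theorem isRotationNumber_unique (ha : a ∈ Icc (0.3 : ℝ) 0.6) {ρ : ℝ} (h : IsRotationNumber a ρ) :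
    ∃ k : ℤ, ρ = CircleDeg1Lift.translationNumber (lift ha) + k := by
  obtain ⟨G, hG, hρ⟩ := h
  obtain ⟨k, hk⟩ := exists_lift_eq_add ha hG
  refine ⟨k, ?_⟩
  have hl := ell_pos ha
  obtain ⟨x, hx, hb⟩ := exists_avoiding (show -ell a < 0 by linarith) (countable_bad a)
  let G' : CircleDeg1Lift := ⟨⟨G, hG.1.monotone⟩, hG.2.1⟩
  have hGG : ∀ s, G' s = G s := fun s => rfl
  have hiter : ∀ n : ℕ, G^[n] (1 + x / ell a) = (lift ha)^[n] (1 + x / ell a) + n * k := by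
    intro n
    induction n with
    | zero => simp
    | succ n ih =>
      obtain ⟨h1, h2⟩ := iterate_reduced_mem ha hx.1 hx.2 n
      have h3 : crossing a ((reduced a)^[n] x) ≠ 0 := fun h => hb ⟨n, h⟩
      rw [Function.iterate_succ_apply', Function.iterate_succ_apply', ih,
        lift_iterate_coord ha hx.1 hx.2 n]
      generalize ⌊(lift ha)^[n] (1 + x / ell a)⌋ = N
      have e : (1 + (reduced a)^[n] x / ell a + (N : ℝ) + n * k : ℝ) =
          1 + (reduced a)^[n] x / ell a + ((N + n * k : ℤ) : ℝ) := by push_cast; ring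
      rw [e, ← hGG, CircleDeg1Lift.map_add_int, hGG, hk _ h1 h2 h3, CircleDeg1Lift.map_add_int]
      push_cast
      ring
  have h1 := hρ (1 + x / ell a)
  have h2 : Tendsto (fun n : ℕ => ((lift ha)^[n] (1 + x / ell a) - (1 + x / ell a)) / n + (k : ℝ))
      atTop (𝓝 (CircleDeg1Lift.translationNumber (lift ha) + k)) := by
    refine Tendsto.add_const _ ?_
    simpa only [CircleDeg1Lift.coe_pow] using (lift ha).tendsto_translationNumber (1 + x / ell a)
  refine tendsto_nhds_unique h1 (h2.congr' ?_)
  filter_upwards [eventually_gt_atTop 0] with n hn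
  have : (n : ℝ) ≠ 0 := by positivity
  rw [hiter]
  field_simp
  ring

/-! ### Regular points in the rectangles -/

theorem near_of_mem_rectangle (ha : a ∈ Icc (0.3 : ℝ) 0.6) {ε : ℝ} (hε : ε ∈ Ioo (0 : ℝ) (1 / 4))
    {p : Plane} (hp : p ∈ R1 a ε ∪ R2 a ε) : Near a p := by
  obtain ⟨h0, h1⟩ := hε
  have hsq : ε ^ 2 ≤ ε / 4 := by nlinarith
  have ha1 := ha.1
  norm_num at ha1
  rcases hp with ⟨⟨h2, h3⟩, h4, h5⟩ | ⟨⟨h2, h3⟩, h4, h5⟩ <;>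
    refine ⟨by linarith, by linarith, ?_, ?_⟩
  · rw [abs_of_nonneg (by linarith)]; linarith
  · rw [abs_of_nonneg (by linarith)]; linarith
  · rw [abs_of_nonpos (by linarith)]; linarith
  · rw [abs_of_nonpos (by linarith)]; linarith

/-- The regular points are dense in the two rectangles. -/
theorem exists_regular_mem (ha : a ∈ Icc (0.3 : ℝ) 0.6) {ε : ℝ} (hε : ε ∈ Ioo (0 : ℝ) (1 / 4))
    {z : Plane} (hz : z ∈ R1 a ε ∪ R2 a ε) {U : Set Plane} (hU : IsOpen U) (hzU : z ∈ U) :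
    ∃ p ∈ U, p ∈ regularSet (quad a) lam ∩ (R1 a ε ∪ R2 a ε) := by
  obtain ⟨r, hr, hball⟩ := Metric.isOpen_iff.1 hU z hzU
  have hε0 := hε.1
  have hε1 := hε.2
  have hl := neg_ell_lt ha
  have hsq : 0 < ε ^ 2 := by positivity
  set B := {x | ∃ n, crossing a ((reduced a)^[n] x) = 0}
  have hB : B.Countable := countable_bad a
  -- This is the first coordinate at which a point above `EA` arrives below it after three steps; it
  -- has to avoid the bad set too.
  have hinj : Function.Injective fun x : ℝ => -(36 / 25) - 64 / 125 * x := by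
    intro x y h; simp only at h; linarith
  have hx : -ell a + ε ≤ z.1 ∧ z.1 ≤ 0 := by
    rcases hz with hz | hz
    · exact hz.1
    · exact hz.1
  obtain ⟨x, ⟨hx1, hx2⟩, hxB⟩ := exists_avoiding
    (show max (-ell a + ε) (z.1 - r) < min 0 (z.1 + r) by
      rw [max_lt_iff, lt_min_iff, lt_min_iff]
      exact ⟨⟨by linarith, by linarith⟩, ⟨by linarith, by linarith⟩⟩) (hB.union (hB.preimage hinj))
  rw [max_lt_iff] at hx1
  rw [lt_min_iff] at hx2
  rw [mem_union, not_or] at hxB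
  have hmem : ∀ y, z.2 - r < y → y < z.2 + r → ((x, y) : Plane) ∈ U := fun y h1 h2 => by
    refine hball ?_
    rw [Metric.mem_ball, Prod.dist_eq, max_lt_iff, Real.dist_eq, Real.dist_eq, abs_lt, abs_lt]
    exact ⟨⟨by simp only; linarith, by simp only; linarith⟩,
      ⟨by simp only; linarith, by simp only; linarith⟩⟩
  rcases hz with ⟨-, hz1, hz2⟩ | ⟨-, hz1, hz2⟩
  · obtain ⟨y, hy1, hy2⟩ := exists_between
      (show max 1 (z.2 - r) < min (1 + ε ^ 2) (z.2 + r) by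
        rw [max_lt_iff, lt_min_iff, lt_min_iff]
        exact ⟨⟨by linarith, by linarith⟩, ⟨by linarith, by linarith⟩⟩)
    rw [max_lt_iff] at hy1
    rw [lt_min_iff] at hy2
    have hR : ((x, y) : Plane) ∈ R1 a ε ∪ R2 a ε :=
      Or.inl ⟨⟨hx1.1.le, hx2.1.le⟩, ⟨hy1.1.le, hy2.1.le⟩⟩
    refine ⟨_, hmem y hy1.2 hy2.2, ?_, hR⟩
    have hn := near_of_mem_rectangle ha hε hR
    obtain ⟨d0, e1, d1, e2⟩ := T_near ha hn hx2.1
    obtain ⟨d2, e3⟩ := T_right_above ha hn hy1.1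
    have f1 : (T (quad a) lam)^[1] (x, y) = (-(4 / 5) * x, -(4 / 5) * y) := e1
    have f2 : (T (quad a) lam)^[2] (x, y) = (9 / 5 + 16 / 25 * x, 9 / 25 + 16 / 25 * y) := by
      rw [Function.iterate_succ_apply', f1, e2]
    have f3 : (T (quad a) lam)^[3] (x, y) =
        (-(36 / 25) - 64 / 125 * x, 189 / 125 - 64 / 125 * y) := by
      rw [Function.iterate_succ_apply', f2, e3]
    have hgood : Good a ((T (quad a) lam)^[3] (x, y)) := by
      rw [f3]
      have h3 := hn.2.2.1
      have h1 := hn.1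
      have h5 := hx2.1
      have h6 := hy1.1
      simp only at h3 h1
      rw [abs_of_pos (by linarith)] at h3
      have hle := ell_eq a
      have ha1 := ha.1
      have ha2 := ha.2
      norm_num at ha1 ha2
      refine ⟨⟨⟨?_, ?_, ?_, ?_⟩, ?_, ?_⟩, fun n hn => hxB.2 ⟨n, hn⟩⟩ <;> simp only <;>
        (try rw [abs_of_neg (by linarith)]) <;> linarith
    refine ⟨fun hp => d0 (Or.inl hp), fun k => ?_⟩
    rcases Nat.lt_or_ge k 3 with hk | hk
    · interval_cases k
      · exact fun h => d0 (Or.inr h)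
      · rw [f1]; exact fun h => d1 (Or.inr h)
      · rw [f2]; exact fun h => d2 (Or.inr h)
    · obtain ⟨j, rfl⟩ := Nat.exists_eq_add_of_le' hk
      rw [Function.iterate_add_apply]
      exact fun h => hgood.mem_billiardDomain ha j (Or.inr h)
  · obtain ⟨y, hy1, hy2⟩ := exists_between
      (show max (1 - ε ^ 2) (z.2 - r) < min 1 (z.2 + r) by
        rw [max_lt_iff, lt_min_iff, lt_min_iff]
        exact ⟨⟨by linarith, by linarith⟩, ⟨by linarith, by linarith⟩⟩)
    rw [max_lt_iff] at hy1
    rw [lt_min_iff] at hy2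
    have hR : ((x, y) : Plane) ∈ R1 a ε ∪ R2 a ε :=
      Or.inr ⟨⟨hx1.1.le, hx2.1.le⟩, ⟨hy1.1.le, hy2.1.le⟩⟩
    have hgood : Good a (x, y) :=
      ⟨⟨near_of_mem_rectangle ha hε hR, hx2.1, hy2.1⟩, fun n hn => hxB.1 ⟨n, hn⟩⟩
    exact ⟨_, hmem y hy1.2 hy2.2, hgood.mem_regularSet ha, hR⟩

theorem exists_good (ha : a ∈ Icc (0.3 : ℝ) 0.6) : ∃ p, Good a p := by
  have hz : ((-1, 1) : Plane) ∈ R1 a (1 / 8) ∪ R2 a (1 / 8) := by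
    have := neg_ell_lt ha
    refine Or.inr ⟨⟨?_, ?_⟩, ⟨?_, ?_⟩⟩ <;> norm_num
    linarith
  have hε : (1 / 8 : ℝ) ∈ Ioo (0 : ℝ) (1 / 4) := by norm_num
  obtain ⟨p, -, hp, hR⟩ := exists_regular_mem ha hε hz isOpen_univ trivial
  obtain ⟨k, hk⟩ := (near_of_mem_rectangle ha hε hR).exists_good ha hp.1 hp.2
  exact ⟨_, hk⟩

theorem exists_good_of_mem_rectangle (ha : a ∈ Icc (0.3 : ℝ) 0.6) {ε : ℝ}
    (hε : ε ∈ Ioo (0 : ℝ) (1 / 4)) {p : Plane}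
    (hp : p ∈ regularSet (quad a) lam ∩ (R1 a ε ∪ R2 a ε)) :
    ∃ k, Good a ((T (quad a) lam)^[k] p) :=
  (near_of_mem_rectangle ha hε hp.2).exists_good ha hp.1.1 hp.1.2

/-! ### Rational rotation number: the periodic orbit -/

theorem Good.dist_iterate_of_code_eq (ha : a ∈ Icc (0.3 : ℝ) 0.6) {p q : Plane} (hp : Good a p)
    (hq : Good a q) (h : ∀ i, code a p.1 i = code a q.1 i) (m : ℕ) :
    dist ((T (quad a) lam)^[m] p) ((T (quad a) lam)^[m] q) = lam ^ m * dist p q :=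
  (hp.dist_iterate ha hq (n := m) fun i _ => h i).2 m (le_time _ _)

theorem tendsto_lam_pow_mul (D : ℝ) : Tendsto (fun m : ℕ => lam ^ m * D) atTop (𝓝 0) := by
  have := (tendsto_pow_atTop_nhds_zero_of_lt_one (r := lam) (by norm_num [lam])
    (by norm_num [lam])).mul_const D
  rwa [zero_mul] at this

/-- A good point with periodic itinerary is asymptotic to a periodic orbit. -/
theorem Good.exists_periodicOrbit (ha : a ∈ Icc (0.3 : ℝ) 0.6) {p : Plane} (h : Good a p) {q : ℕ}
    (hq : 0 < q) (hper : ∀ i, code a p.1 (i + q) = code a p.1 i) :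
    ∃ w : ℕ → Plane, IsPeriodicOrbit (quad a) lam w ∧ range w ⊆ trap a ∧
      Tendsto (fun m : ℕ => dist ((T (quad a) lam)^[m] p) (w m)) atTop (𝓝 0) := by
  -- By periodicity the `N`-th iterate has the same itinerary as `p`, so for each `i` the points at
  -- times `i + k * N` form a geometric Cauchy sequence in `k`; its limit is `w i`.
  set N := time a p.1 q
  have hN : 0 < N := hq.trans_le (le_time _ _)
  obtain ⟨h1, h2, -⟩ := h.iterate_time ha q
  set D := dist p ((T (quad a) lam)^[N] p)
  have hD : ∀ m, dist ((T (quad a) lam)^[m] p) ((T (quad a) lam)^[m + N] p) = lam ^ m * D := by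
    intro m
    rw [Function.iterate_add_apply]
    refine h.dist_iterate_of_code_eq ha h1 (fun i => ?_) m
    rw [h2, code_iterate, hper]
  have hlam0 : 0 < lam := by norm_num [lam]
  have hlam1 : lam < 1 := by norm_num [lam]
  have hr : lam ^ N < 1 := pow_lt_one₀ hlam0.le hlam1 hN.ne'
  have hgeo : ∀ i k : ℕ, dist ((T (quad a) lam)^[i + k * N] p)
      ((T (quad a) lam)^[i + (k + 1) * N] p) ≤ lam ^ i * D * (lam ^ N) ^ k := by
    intro i k
    rw [show i + (k + 1) * N = i + k * N + N by ring, hD, pow_add, mul_comm k N, pow_mul]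
    apply le_of_eq; ring
  choose w hw using fun i => cauchySeq_tendsto_of_complete
    (cauchySeq_of_le_geometric (lam ^ N) (lam ^ i * D) hr (hgeo i))
  have hφ : ∀ i, Tendsto (fun k : ℕ => i + k * N) atTop atTop := fun i =>
    tendsto_atTop_mono (fun k => (Nat.le_mul_of_pos_right k hN).trans (Nat.le_add_left _ _))
      tendsto_id
  refine ⟨w, ⟨⟨N, hN, fun i => ?_⟩, fun i => ?_⟩, ?_, ?_⟩
  · refine tendsto_nhds_unique (hw (i + N)) (((tendsto_add_atTop_iff_nat 1).2 (hw i)).congr ?_)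
    intro k
    rw [show i + (k + 1) * N = i + N + k * N by ring]
  · refine h.step_of_tendsto ha (hφ i) (hw i) ((hw (i + 1)).congr fun k => ?_)
    rw [show i + 1 + k * N = i + k * N + 1 by ring]
  · rintro _ ⟨i, rfl⟩
    exact core_subset_trap ha (core_mono (by norm_num) (h.mem_core_zero ha (hφ i) (hw i)))
  · refine squeeze_zero (fun _ => dist_nonneg) (fun m => ?_)
      (tendsto_lam_pow_mul (D / (1 - lam ^ N)))
    have := dist_le_of_le_geometric_of_tendsto₀ (lam ^ N) (lam ^ m * D) hr (hgeo m) (hw m)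
    simp only [zero_mul, add_zero] at this
    rw [mul_div_assoc] at this
    exact this

/-- A good point whose itinerary is eventually a shift of that of `p` shares its asymptotics. -/
theorem Good.asymptoticToOrbit_of_code_eq (ha : a ∈ Icc (0.3 : ℝ) 0.6) {p q : Plane}
    (hp : Good a p) (hq : Good a q) {w : ℕ → Plane} (hw : IsPeriodicOrbit (quad a) lam w)
    (hlim : Tendsto (fun m : ℕ => dist ((T (quad a) lam)^[m] p) (w m)) atTop (𝓝 0))
    {n₁ n₂ : ℕ} (h : ∀ i, code a q.1 (i + n₂) = code a p.1 (i + n₁)) :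
    AsymptoticToOrbit (quad a) lam q w := by
  obtain ⟨⟨N, hN, hper⟩, -⟩ := hw
  obtain ⟨h1, h2, -⟩ := hp.iterate_time ha n₁
  obtain ⟨h3, h4, -⟩ := hq.iterate_time ha n₂
  refine asymptoticToOrbit_of_iterate hN hper (k := time a q.1 n₂) ⟨time a p.1 n₁, ?_⟩
  have h5 := h3.dist_iterate_of_code_eq ha h1 fun i => by
    rw [h2, h4, code_iterate, code_iterate, h]
  have h6 := (tendsto_add_atTop_iff_nat (time a p.1 n₁)).2 hlim
  have h7 := (tendsto_lam_pow_mul (dist ((T (quad a) lam)^[time a q.1 n₂] q)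
    ((T (quad a) lam)^[time a p.1 n₁] p))).add h6
  rw [add_zero] at h7
  refine squeeze_zero (fun _ => dist_nonneg) (fun m => ?_) h7
  refine (dist_triangle _ ((T (quad a) lam)^[m] ((T (quad a) lam)^[time a p.1 n₁] p)) _).trans ?_
  rw [h5, ← Function.iterate_add_apply]

/-- The itineraries for a rational rotation number. -/
theorem exists_code_eq_of_rational (ha : a ∈ Icc (0.3 : ℝ) 0.6) {p : ℤ} {q : ℕ} (hq : 0 < q)
    (hpq : IsCoprime p q) (h : CircleDeg1Lift.translationNumber (lift ha) = p / q) {x : ℝ}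
    (h1 : -ell a < x) (h2 : x < 0) : ∃ J : ℤ, ∃ n₀ : ℕ, ∀ n ≥ n₀,
      code a x n = decide ((J + n * p + p) / q = (J + n * p) / (q : ℤ)) := by
  obtain ⟨J, n₀, hJ⟩ := (lift ha).exists_floor_orbit_eq_of_rational hq hpq h (1 + x / ell a)
  refine ⟨J, n₀, fun n hn => ?_⟩
  rw [code_eq ha h1 h2, turns, turns, hJ n hn, hJ (n + 1) (by omega)]
  push_cast
  rw [show J + ((n : ℤ) + 1) * p = J + n * p + p by ring]

/-- Eventual codes are determined by the residue of `J + n * p` modulo `q`. Since `p` is invertible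
modulo `q`, a time shift aligns any two such sequences. -/
theorem exists_periodicOrbit_of_rational (ha : a ∈ Icc (0.3 : ℝ) 0.6)
    (h : CircleDeg1Lift.translationNumber (lift ha) ∈ range ((↑) : ℚ → ℝ)) :
    ∃ w : ℕ → Plane, IsPeriodicOrbit (quad a) lam w ∧ range w ⊆ trap a ∧
      ∀ p, Good a p → AsymptoticToOrbit (quad a) lam p w := by
  obtain ⟨r, hr⟩ := h
  have hq : 0 < r.den := r.den_pos
  have hpq : IsCoprime r.num (r.den : ℤ) := by
    rw [Int.isCoprime_iff_nat_coprime]; exact r.reduced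
  have hτ : CircleDeg1Lift.translationNumber (lift ha) = r.num / r.den := by
    rw [← hr, Rat.cast_def]
  have hq' : (r.den : ℤ) ≠ 0 := by exact_mod_cast hq.ne'
  have hC : ∀ z t : ℤ, decide ((z + r.den * t + r.num) / (r.den : ℤ) = (z + r.den * t) / (r.den : ℤ)) =
      decide ((z + r.num) / (r.den : ℤ) = z / (r.den : ℤ)) := by
    intro z t
    rw [show z + r.den * t + r.num = z + r.num + r.den * t by ring, Int.add_mul_ediv_left _ _ hq',
      Int.add_mul_ediv_left _ _ hq']
    simp
  obtain ⟨p₀, hp₀⟩ := exists_good ha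
  obtain ⟨J, n₀, hJ⟩ := exists_code_eq_of_rational ha hq hpq hτ hp₀.1.1.1 hp₀.1.2.1
  obtain ⟨h1, h2, -⟩ := hp₀.iterate_time ha n₀
  obtain ⟨w, hw, hwt, hlim⟩ := h1.exists_periodicOrbit ha hq fun i => by
    rw [h2, code_iterate, code_iterate, hJ _ (by omega), hJ _ (by omega), ← hC (J + (i + n₀ : ℕ) * r.num)
      r.num]
    push_cast
    ring_nf
  refine ⟨w, hw, hwt, fun p hp => ?_⟩
  obtain ⟨J', n₀', hJ'⟩ := exists_code_eq_of_rational ha hq hpq hτ hp.1.1.1 hp.1.2.1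
  obtain ⟨α, β, hαβ⟩ := hpq
  -- By Bézout, `A` times the numerator is congruent to `J - J' + n₀ * r.num` modulo the
  -- denominator. A multiple of the denominator is then added to reach a time not before `n₀'`.
  set A := (J - J' + n₀ * r.num) * α
  obtain ⟨n₂, hn₂⟩ : ∃ n₂ : ℕ, (n₂ : ℤ) = A + r.den * (|A| + n₀') := by
    refine ⟨(A + r.den * (|A| + n₀')).toNat, Int.toNat_of_nonneg ?_⟩
    have : (1 : ℤ) ≤ r.den := by exact_mod_cast hq
    nlinarith [neg_abs_le A, abs_nonneg A]
  have hn₂' : n₀' ≤ n₂ := by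
    have : (1 : ℤ) ≤ r.den := by exact_mod_cast hq
    zify
    nlinarith [neg_abs_le A, abs_nonneg A]
  refine h1.asymptoticToOrbit_of_code_eq ha hp hw hlim (n₁ := 0) (n₂ := n₂) fun i => ?_
  rw [h2, code_iterate, hJ _ (by omega), hJ' _ (by omega),
    ← hC (J + (i + 0 + n₀ : ℕ) * r.num) (-(J - J' + n₀ * r.num) * β + (|A| + n₀') * r.num)]
  have e : J' + ((i + n₂ : ℕ) : ℤ) * r.num = J + ((i + 0 + n₀ : ℕ) : ℤ) * r.num +
      r.den * (-(J - J' + n₀ * r.num) * β + (|A| + n₀') * r.num) := by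
    push_cast
    rw [hn₂]
    simp only [A]
    linear_combination (J - J' + n₀ * r.num) * hαβ
  rw [e]

/-- The distance between corresponding terms of the two sequences is periodic with period `N * N'`
and tends to 0, so it vanishes. -/
theorem sameOrbit_of_asymptotic {n : ℕ} {V : Fin n → Plane} {lam : ℝ} {p : Plane} {w w' : ℕ → Plane}
    {N N' : ℕ} (hN : 0 < N) (hN' : 0 < N') (hw : ∀ i, w (i + N) = w i) (hw' : ∀ i, w' (i + N') = w' i)
    (h : AsymptoticToOrbit V lam p w) (h' : AsymptoticToOrbit V lam p w') : SameOrbit w w' := by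
  obtain ⟨k, hk⟩ := h
  obtain ⟨k', hk'⟩ := h'
  have hmul : ∀ {N : ℕ} {w : ℕ → Plane}, (∀ i, w (i + N) = w i) → ∀ c i, w (i + c * N) = w i := by
    intro N w hw c
    induction c with
    | zero => simp
    | succ c ih => intro i; rw [← ih i, ← hw (i + c * N)]; ring_nf
  have h0 : Tendsto (fun m : ℕ => dist (w (m + k)) (w' (m + k'))) atTop (𝓝 0) := by
    have := hk.add hk'
    rw [add_zero] at this
    refine squeeze_zero (fun _ => dist_nonneg) (fun m => ?_) this
    exact dist_triangle_left _ _ _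
  have heq : ∀ m, w (m + k) = w' (m + k') := by
    intro m
    have hsub : Tendsto (fun c : ℕ => m + c * (N * N')) atTop atTop :=
      tendsto_atTop_mono (fun c => (Nat.le_mul_of_pos_right c (by positivity)).trans
        (Nat.le_add_left _ _)) tendsto_id
    have h1 := h0.comp hsub
    have h2 : (fun m : ℕ => dist (w (m + k)) (w' (m + k'))) ∘ (fun c : ℕ => m + c * (N * N'))
        = fun _ => dist (w (m + k)) (w' (m + k')) := by
      funext c
      simp only [Function.comp]
      rw [show m + c * (N * N') + k = m + k + (c * N') * N by ring, hmul hw,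
        show m + c * (N * N') + k' = m + k' + (c * N) * N' by ring, hmul hw']
    rw [h2] at h1
    exact dist_eq_zero.1 (tendsto_nhds_unique tendsto_const_nhds h1)
  refine ⟨k + k' * N' - k', fun i => ?_⟩
  have hk' : k' ≤ k' * N' := Nat.le_mul_of_pos_right _ hN'
  have := heq (i + k' * N' - k')
  rw [show i + k' * N' - k' + k' = i + k' * N' by omega, hmul hw'] at this
  rw [← this]
  congr 1
  omega

/-! ### Irrational rotation number: all limit sets coincide -/

open MeasureTheory

theorem time_add (x : ℝ) (n k : ℕ) :
    time a x (n + k) = time a x n + time a ((reduced a)^[n] x) k := by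
  rw [time, time, time, Finset.sum_range_add]
  refine congrArg _ (Finset.sum_congr rfl fun i _ => ?_)
  rw [code_iterate, add_comm]

/-- For irrational rotation numbers, every finite part of an itinerary recurs in every other
itinerary. -/
theorem exists_code_window (ha : a ∈ Icc (0.3 : ℝ) 0.6)
    (h : Irrational (CircleDeg1Lift.translationNumber (lift ha))) {x y : ℝ}
    (hx1 : -ell a < x) (hx2 : x < 0) (hy1 : -ell a < y) (hy2 : y < 0) :
    ∃ n₀, ∀ n ≥ n₀, ∀ r M : ℕ, ∃ n' ≥ M, ∀ i < r, code a y (n' + i) = code a x (n + i) := by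
  obtain ⟨θ, n₀, hθ⟩ := (lift ha).exists_floor_orbit_eq_of_irrational h (1 + x / ell a)
  obtain ⟨θ', n₀', hθ'⟩ := (lift ha).exists_floor_orbit_eq_of_irrational h (1 + y / ell a)
  refine ⟨n₀, fun n hn r M => ?_⟩
  obtain ⟨n', hn', k, hk⟩ := h.exists_floor_pattern
    (θ + n * CircleDeg1Lift.translationNumber (lift ha)) θ' r (max M n₀')
  have hturns : ∀ i ≤ r, turns ha y (n' + i) = turns ha x (n + i) + k := by
    intro i hi
    rw [turns, turns, hθ' _ (by omega), hθ _ (by omega), hk i hi]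
    push_cast
    ring_nf
  refine ⟨n', by omega, fun i hi => ?_⟩
  rw [code_eq ha hy1 hy2, code_eq ha hx1 hx2, add_assoc, add_assoc, hturns i hi.le,
    hturns (i + 1) hi]
  simp

theorem Good.dist_le (ha : a ∈ Icc (0.3 : ℝ) 0.6) {p q : Plane} (hp : Good a p) (hq : Good a q) :
    dist p q ≤ 3 := by
  have h1 := hp.1.1.1
  have h2 := hp.1.2.1
  have h3 := abs_le.1 hp.1.1.2.2.1
  have h4 := hq.1.1.1
  have h5 := hq.1.2.1
  have h6 := abs_le.1 hq.1.1.2.2.1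
  have ha1 := ha.1
  norm_num at ha1
  rw [ell_eq] at h1 h4
  rw [Prod.dist_eq, max_le_iff, Real.dist_eq, Real.dist_eq, abs_le, abs_le]
  exact ⟨⟨by linarith, by linarith⟩, ⟨by linarith, by linarith⟩⟩

/-- A late point of the first orbit near `z` is traced back by `r` returns, and the window of
symbols from there on is found in the other itinerary. Running both forward at least `r` steps
leaves a distance of at most `3 * lam ^ r`. -/
theorem limitSet_subset_limitSet (ha : a ∈ Icc (0.3 : ℝ) 0.6)
    (h : Irrational (CircleDeg1Lift.translationNumber (lift ha))) {p q : Plane}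
    (hp : Good a p) (hq : Good a q) : limitSet (quad a) lam p ⊆ limitSet (quad a) lam q := by
  intro z hz
  obtain ⟨n₀, hwin⟩ := exists_code_window ha h hp.1.1.1 hp.1.2.1 hq.1.1.1 hq.1.2.1
  have hlam0 : 0 ≤ lam := by norm_num [lam]
  have hlam1 : lam < 1 := by norm_num [lam]
  refine mapClusterPt_iff_frequently.2 fun s hs => frequently_atTop.2 fun M => ?_
  obtain ⟨η, hη, hball⟩ := Metric.mem_nhds_iff.1 hs
  obtain ⟨r, hr⟩ := exists_pow_lt_of_lt_one (show 0 < η / 6 by linarith) hlam1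
  obtain ⟨m, hm, hmz⟩ := frequently_atTop.1 (mapClusterPt_iff_frequently.1 hz _
    (Metric.ball_mem_nhds z (half_pos hη))) (6 * (n₀ + r + 2))
  obtain ⟨n, j, rfl, hj⟩ := exists_eq_time_add (a := a) p.1 m
  have h1 := time_le (a := a) p.1 n
  have h2 := word_length_le a (code a p.1 n)
  -- The window needs `r + 1` symbols: `r` for the full returns, and one for the `j` steps inside
  -- the last word.
  obtain ⟨n₁, rfl⟩ : ∃ n₁, n = n₁ + r := ⟨n - r, by omega⟩
  obtain ⟨n', hn', hcode⟩ := hwin n₁ (by omega) (r + 1) M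
  obtain ⟨hP, hPx, -⟩ := hp.iterate_time ha n₁
  obtain ⟨hQ, hQx, -⟩ := hq.iterate_time ha n'
  have hd := (hP.dist_iterate ha hQ (n := r + 1) fun i hi => by
    rw [hPx, hQx, code_iterate, code_iterate, add_comm i, add_comm i, hcode i hi]).2
  rw [hPx, time_succ, code_iterate, add_comm r n₁] at hd
  have hd' := hd (time a ((reduced a)^[n₁] p.1) r + j) (by omega)
  refine ⟨time a ((reduced a)^[n₁] p.1) r + j + time a q.1 n', ?_, hball ?_⟩
  · have := le_time (a := a) q.1 n'
    omega
  · rw [← Function.iterate_add_apply, ← Function.iterate_add_apply] at hd'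
    rw [time_add, show time a p.1 n₁ + time a ((reduced a)^[n₁] p.1) r + j =
      time a ((reduced a)^[n₁] p.1) r + j + time a p.1 n₁ by ring] at hmz
    have h5 : lam ^ (time a ((reduced a)^[n₁] p.1) r + j) ≤ lam ^ r :=
      pow_le_pow_of_le_one hlam0 hlam1.le
        ((le_time (a := a) _ r).trans (Nat.le_add_right _ _))
    have h6 := hP.dist_le ha hQ
    have h7 := pow_nonneg hlam0 (time a ((reduced a)^[n₁] p.1) r + j)
    rw [Metric.mem_ball] at hmz ⊢
    have h8 := dist_triangle_left
      ((T (quad a) lam)^[time a ((reduced a)^[n₁] p.1) r + j + time a q.1 n'] q) z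
      ((T (quad a) lam)^[time a ((reduced a)^[n₁] p.1) r + j + time a p.1 n₁] p)
    have h9 : lam ^ (time a ((reduced a)^[n₁] p.1) r + j) *
        dist ((T (quad a) lam)^[time a p.1 n₁] p) ((T (quad a) lam)^[time a q.1 n'] q) ≤
        lam ^ r * 3 := mul_le_mul h5 h6 dist_nonneg (pow_nonneg hlam0 r)
    linarith

/-! ### The limit set is a Cantor set -/

/-- The limit set of an orbit of the reduced map. -/
def reducedLimitSet (a x : ℝ) : Set ℝ := {t | MapClusterPt t atTop fun n => (reduced a)^[n] x}

theorem reduced_eq_symbol (x : ℝ) : reduced a x =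
    if symbol a x then -(4 / 5) * crossing a x else -(36 / 25) - 64 / 125 * crossing a x := by
  by_cases h : 0 < crossing a x <;> simp [reduced, symbol, h]

theorem exists_eventually_eq_of_finite {α ι : Type*} [Finite α] (l : Ultrafilter ι) (f : ι → α) :
    ∃ c, ∀ᶠ i in l, f i = c := by
  obtain ⟨c, hc⟩ := (l.map f).eq_pure_of_finite
  refine ⟨c, ?_⟩
  have : ({c} : Set α) ∈ l.map f := by rw [hc]; exact mem_singleton c
  exact this

theorem exists_tendsto_reduced (ha : a ∈ Icc (0.3 : ℝ) 0.6) {x : ℝ} (h1 : -ell a < x) (h2 : x < 0)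
    (l : Ultrafilter ℕ) {φ : ℕ → ℕ} (hφ : Tendsto φ l atTop) :
    ∃ t ∈ reducedLimitSet a x, Tendsto (fun m => (reduced a)^[φ m] x) l (𝓝 t) := by
  obtain ⟨t, -, ht⟩ := (isCompact_Icc (a := -ell a) (b := 0)).ultrafilter_le_nhds
    (l.map fun m => (reduced a)^[φ m] x) (by
      rw [Ultrafilter.coe_map, le_principal_iff, mem_map]
      filter_upwards with m
      obtain ⟨h3, h4⟩ := iterate_reduced_mem ha h1 h2 (φ m)
      exact ⟨h3.le, h4.le⟩)
  refine ⟨t, ?_, ht⟩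
  exact (show Tendsto (fun m => (reduced a)^[φ m] x) l (𝓝 t) from ht).mapClusterPt.of_comp
    (φ := φ) (u := fun n => (reduced a)^[n] x) hφ

theorem tendsto_of_ultrafilter_le {l : Ultrafilter ℕ} (hl : (l : Filter ℕ) ≤ atTop) {N : ℕ → ℕ}
    (hN : ∀ m, m ≤ 6 * N m + 6) : Tendsto N l atTop := by
  refine Tendsto.mono_left (tendsto_atTop.2 fun b => ?_) hl
  filter_upwards [eventually_ge_atTop (6 * b + 6)] with m hm
  have := hN m
  omega

theorem Good.tendsto_iterate_time (ha : a ∈ Icc (0.3 : ℝ) 0.6) {p : Plane} (h : Good a p)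
    {l : Filter ℕ} {φ : ℕ → ℕ} (hφ : Tendsto φ l atTop) {t : ℝ}
    (ht : Tendsto (fun k => (reduced a)^[φ k] p.1) l (𝓝 t)) :
    Tendsto (fun m => (T (quad a) lam)^[time a p.1 (φ m)] p) l (𝓝 (t, 1)) := by
  have h1 : Tendsto (fun m => ((T (quad a) lam)^[time a p.1 (φ m)] p).1) l (𝓝 t) := by
    refine ht.congr fun m => ?_
    rw [(h.iterate_time ha (φ m)).2.1]
  have h2 : Tendsto (fun m => ((T (quad a) lam)^[time a p.1 (φ m)] p).2) l (𝓝 1) := by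
    have h3 : Tendsto (fun n : ℕ => (64 / 125 : ℝ) ^ n) atTop (𝓝 0) :=
      tendsto_pow_atTop_nhds_zero_of_lt_one (by norm_num) (by norm_num)
    have h4 := (h3.comp hφ).const_sub 1
    rw [sub_zero] at h4
    refine tendsto_of_tendsto_of_tendsto_of_le_of_le h4 tendsto_const_nhds (fun m => ?_)
      fun m => ?_
    · have := (h.iterate_time ha (φ m)).2.2
      simp only [Function.comp]
      linarith
    · exact (h.iterate_time ha (φ m)).1.1.2.2.le
  exact h1.prodMk_nhds h2

/-- The points of the limit set, in terms of the reduced map. -/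
theorem Good.exists_of_mem_limitSet (ha : a ∈ Icc (0.3 : ℝ) 0.6) {p z : Plane} (h : Good a p)
    (hz : z ∈ limitSet (quad a) lam p) : ∃ b j, j < (word a b).length ∧
      ∃ t ∈ reducedLimitSet a p.1, z = ((word a b).take j).foldl reflect (t, 1) ∧
        ∀ δ > 0, {n | |(reduced a)^[n] p.1 - t| < δ ∧ code a p.1 n = b}.Infinite := by
  -- Along an ultrafilter the finite data, namely the symbol and the position inside the word, are
  -- eventually constant, and the bounded reduced orbit converges.
  obtain ⟨l, hl, hlz⟩ := mapClusterPt_iff_ultrafilter.1 hz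
  choose N j hNj hj using exists_eq_time_add (a := a) p.1
  have hN : Tendsto N l atTop := tendsto_of_ultrafilter_le hl fun m => by
    have h1 := hNj m
    have h2 := time_le (a := a) p.1 (N m)
    have h3 := word_length_le a (code a p.1 (N m))
    have h4 := hj m
    omega
  obtain ⟨b, hb⟩ := exists_eventually_eq_of_finite l fun m => code a p.1 (N m)
  obtain ⟨i, hi⟩ := exists_eventually_eq_of_finite l fun m =>
    (⟨j m, (hj m).trans_le (word_length_le _ _)⟩ : Fin 6)
  obtain ⟨t, ht, hlt⟩ := exists_tendsto_reduced ha h.1.1.1 h.1.2.1 l hN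
  have hlt' := h.tendsto_iterate_time ha hN hlt
  have hbi : ∀ᶠ m in l, code a p.1 (N m) = b ∧ j m = i := by
    filter_upwards [hb, hi] with m h1 h2
    exact ⟨h1, by rw [← h2]⟩
  obtain ⟨m₀, hm₀, hm₀'⟩ := hbi.exists
  refine ⟨b, i, by rw [← hm₀, ← hm₀']; exact hj m₀, t, ht, ?_, fun δ hδ => ?_⟩
  · refine tendsto_nhds_unique (f := fun m => (T (quad a) lam)^[m] p) hlz
      (((continuous_foldl_reflect _).tendsto _).comp hlt' |>.congr' ?_)
    filter_upwards [hbi] with m hm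
    conv_rhs => rw [hNj m]
    rw [h.iterate_time_add ha (hj m).le, hm.1, hm.2]
    rfl
  · rw [Nat.frequently_atTop_iff_infinite.symm, frequently_atTop]
    intro M
    obtain ⟨m, h1, h2, h3⟩ := (((Metric.tendsto_nhds.1 hlt) δ hδ).and
      (hb.and (hN.eventually (eventually_ge_atTop M)))).exists
    exact ⟨N m, h3, h1, h2⟩

theorem Good.mem_limitSet (ha : a ∈ Icc (0.3 : ℝ) 0.6) {p : Plane} (h : Good a p) {b : Bool}
    {j : ℕ} (hj : j < (word a b).length) {t : ℝ} {φ : ℕ → ℕ} (hφ : Tendsto φ atTop atTop)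
    (hcode : ∀ k, code a p.1 (φ k) = b)
    (ht : Tendsto (fun k => (reduced a)^[φ k] p.1) atTop (𝓝 t)) :
    ((word a b).take j).foldl reflect (t, 1) ∈ limitSet (quad a) lam p := by
  have hlt' := h.tendsto_iterate_time ha hφ ht
  have hlim : Tendsto (fun k => (T (quad a) lam)^[time a p.1 (φ k) + j] p) atTop
      (𝓝 (((word a b).take j).foldl reflect (t, 1))) := by
    refine (((continuous_foldl_reflect _).tendsto _).comp hlt').congr fun k => ?_
    rw [h.iterate_time_add ha (by rw [hcode k]; exact hj.le), hcode k]
    rfl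
  refine hlim.mapClusterPt.of_comp (φ := fun k => time a p.1 (φ k) + j)
    (u := fun m => (T (quad a) lam)^[m] p) ?_
  exact tendsto_atTop_mono (fun k => (le_time _ _).trans (Nat.le_add_right _ _)) hφ

theorem reducedLimitSet_subset (ha : a ∈ Icc (0.3 : ℝ) 0.6) {x : ℝ} (h1 : -ell a < x) (h2 : x < 0) :
    reducedLimitSet a x ⊆ Icc (-ell a) 0 := fun _ ht =>
  isClosed_Icc.mem_of_mapClusterPt ht (Eventually.of_forall fun n =>
    ⟨(iterate_reduced_mem ha h1 h2 n).1.le, (iterate_reduced_mem ha h1 h2 n).2.le⟩)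

theorem volume_image_affine (c d : ℝ) (s : Set ℝ) :
    volume ((fun t => c * t + d) '' s) = ENNReal.ofReal |c| * volume s := by
  have : (fun t => c * t + d) '' s = (fun t => t + d) '' ((fun t => c • t) '' s) := by
    rw [image_image]; rfl
  rw [this, image_add_right, measure_preimage_add_right, Set.image_smul, Measure.addHaar_smul]
  simp

/-- The limit sets of the reduced map are null sets. -/
theorem volume_reducedLimitSet (ha : a ∈ Icc (0.3 : ℝ) 0.6) {x : ℝ} (h1 : -ell a < x) (h2 : x < 0) :
    volume (reducedLimitSet a x) = 0 := by
  set K := reducedLimitSet a x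
  -- Every limit point is the image of a limit point of the preceding iterates under the affine
  -- extension of one of the branches; continuity of `reduced` is not needed.
  have hsub : K ⊆ (fun t => (4 / 5 * (64 / 125)) * t + -(4 / 5) * (9 / 5 * a - 36 / 25)) '' K ∪
      (fun t => (64 / 125 * (64 / 125)) * t + (-(36 / 25) - 64 / 125 * (9 / 5 * a - 36 / 25))) '' K := by
    intro t ht
    obtain ⟨l, hl, hlt⟩ := mapClusterPt_iff_ultrafilter.1 ht
    have hφ : Tendsto (fun n : ℕ => n - 1) l atTop := (tendsto_sub_atTop_nat 1).mono_left hl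
    obtain ⟨t', ht', hlt'⟩ := exists_tendsto_reduced ha h1 h2 l hφ
    obtain ⟨b, hb⟩ := exists_eventually_eq_of_finite l fun m => symbol a ((reduced a)^[m - 1] x)
    have he : ∀ᶠ m in (l : Filter ℕ), (reduced a)^[m] x =
        if b then -(4 / 5) * crossing a ((reduced a)^[m - 1] x)
        else -(36 / 25) - 64 / 125 * crossing a ((reduced a)^[m - 1] x) := by
      filter_upwards [hb, hl (eventually_ge_atTop 1)] with m hm hm1
      rw [← hm, ← reduced_eq_symbol, ← Function.iterate_succ_apply' (reduced a)]
      congr 1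
      omega
    have hlt2 : Tendsto (fun m => (reduced a)^[m] x) l (𝓝 t) := hlt
    cases b
    · right
      refine ⟨t', ht', ?_⟩
      have : Tendsto (fun m => -(36 / 25) - 64 / 125 * crossing a ((reduced a)^[m - 1] x)) l
          (𝓝 (-(36 / 25) - 64 / 125 * crossing a t')) := by
        have hc : Continuous fun t => -(36 / 25) - 64 / 125 * crossing a t := by
          unfold crossing; fun_prop
        exact (hc.tendsto t').comp hlt'
      have := tendsto_nhds_unique hlt2 (this.congr' (he.mono fun m hm => by simpa using hm.symm))
      rw [this]
      simp only [crossing]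
      ring
    · left
      refine ⟨t', ht', ?_⟩
      have : Tendsto (fun m => -(4 / 5) * crossing a ((reduced a)^[m - 1] x)) l
          (𝓝 (-(4 / 5) * crossing a t')) := by
        have hc : Continuous fun t => -(4 / 5) * crossing a t := by
          unfold crossing; fun_prop
        exact (hc.tendsto t').comp hlt'
      have := tendsto_nhds_unique hlt2 (this.congr' (he.mono fun m hm => by simpa using hm.symm))
      rw [this]
      simp only [crossing]
      ring
  -- The two slopes 256/625 and 4096/15625 have sum 10496/15625, which is less than 4/5.
  have hle : volume K ≤ ENNReal.ofReal (4 / 5) * volume K := by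
    refine (measure_mono hsub).trans ((measure_union_le _ _).trans ?_)
    rw [volume_image_affine, volume_image_affine, ← add_mul, ← ENNReal.ofReal_add (abs_nonneg _)
      (abs_nonneg _)]
    gcongr
    rw [abs_of_pos (by norm_num), abs_of_pos (by norm_num)]
    norm_num
  have hfin : volume K ≠ ⊤ := measure_ne_top_of_subset (reducedLimitSet_subset ha h1 h2) (by simp)
  lift volume K to NNReal using hfin with v
  have h3 : (v : ℝ) ≤ 4 / 5 * v := by
    have := ENNReal.toReal_mono (by finiteness) hle
    rwa [ENNReal.toReal_mul, ENNReal.toReal_ofReal (by norm_num)] at this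
  have h4 : (v : ℝ) = 0 := le_antisymm (by linarith) v.coe_nonneg
  simpa using h4

theorem subsingleton_of_isPreconnected_of_volume_eq_zero {s t : Set ℝ} (hs : IsPreconnected s)
    (hst : s ⊆ t) (ht : volume t = 0) : s.Subsingleton := by
  have key : ∀ x ∈ s, ∀ y ∈ s, ¬ x < y := by
    intro x hx y hy hxy
    have h1 := measure_mono_null ((hs.Icc_subset hx hy).trans hst) ht
    rw [Real.volume_Icc, ENNReal.ofReal_eq_zero] at h1
    linarith
  intro x hx y hy
  exact le_antisymm (not_lt.1 (key y hy x hx)) (not_lt.1 (key x hx y hy))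

/-- A connected subset has connected projections. The first lies in a finite union of affine images
of a null set, the second in two points, so both are single points. -/
theorem Good.isTotallyDisconnected_limitSet (ha : a ∈ Icc (0.3 : ℝ) 0.6) {p : Plane}
    (h : Good a p) : IsTotallyDisconnected (limitSet (quad a) lam p) := by
  intro s hs hpre
  choose β hβ using exists_fst_foldl_reflect
  have hfst : (Prod.fst '' s).Subsingleton := by
    refine subsingleton_of_isPreconnected_of_volume_eq_zero
      (t := ⋃ c : Bool × Fin 6, (fun t => (-lam) ^ ((word a c.1).take c.2).length * t +
        β ((word a c.1).take c.2)) '' reducedLimitSet a p.1)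
      (hpre.image _ continuous_fst.continuousOn) ?_ ?_
    · rintro _ ⟨z, hz, rfl⟩
      obtain ⟨b, j, hj, t, ht, rfl, -⟩ := h.exists_of_mem_limitSet ha (hs hz)
      refine mem_iUnion.2 ⟨(b, ⟨j, hj.trans_le (word_length_le _ _)⟩), t, ht, ?_⟩
      simp only
      rw [hβ]
    · refine measure_iUnion_null fun c => ?_
      rw [volume_image_affine, volume_reducedLimitSet ha h.1.1.1 h.1.2.1, mul_zero]
  have hsnd : (Prod.snd '' s).Subsingleton := by
    refine subsingleton_of_isPreconnected_of_volume_eq_zero (t := {1, -(4 / 5)})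
      (hpre.image _ continuous_snd.continuousOn) ?_ ((Set.toFinite _).measure_zero _)
    rintro _ ⟨z, hz, rfl⟩
    obtain ⟨φ, hφ, hlim⟩ := exists_subseq_of_mem_limitSet (hs hz)
    rcases h.mem_core_zero ha hφ.tendsto_atTop hlim with ⟨-, -, h1⟩ | ⟨-, -, h1⟩ | ⟨-, -, h1⟩
    · left; linarith [abs_eq_zero.1 (le_antisymm h1 (abs_nonneg _))]
    · right
      rw [mem_singleton_iff]; linarith [abs_eq_zero.1 (le_antisymm h1 (abs_nonneg _))]
    · left; linarith [abs_eq_zero.1 (le_antisymm h1 (abs_nonneg _))]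
  intro x hx y hy
  exact Prod.ext (hfst (mem_image_of_mem _ hx) (mem_image_of_mem _ hy))
    (hsnd (mem_image_of_mem _ hx) (mem_image_of_mem _ hy))

/-- The points of an orbit of the reduced map are ordered as those of an orbit of the rotation. -/
theorem le_of_iterate_le (ha : a ∈ Icc (0.3 : ℝ) 0.6) {x : ℝ} (h1 : -ell a < x) (h2 : x < 0)
    {m n : ℕ} (h : (reduced a)^[m] x ≤ (reduced a)^[n] x) :
    m * CircleDeg1Lift.translationNumber (lift ha) - turns ha x m ≤
      n * CircleDeg1Lift.translationNumber (lift ha) - turns ha x n := by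
  have hl := ell_pos ha
  have := (lift ha).orbit_order (s := 1 + x / ell a) (m := m) (m' := n)
    (k := -turns ha x m) (k' := -turns ha x n) (by
      rw [lift_iterate_coord ha h1 h2 m, lift_iterate_coord ha h1 h2 n]
      have : (reduced a)^[m] x / ell a ≤ (reduced a)^[n] x / ell a := by gcongr
      push_cast [turns]
      linarith)
  push_cast at this
  linarith

theorem eq_of_mul_sub_eq {ρ : ℝ} (h : Irrational ρ) {m n : ℕ} {k k' : ℤ}
    (he : m * ρ - k = n * ρ - k') : m = n := by
  by_contra hne
  refine (h.intCast_mul (m := (m : ℤ) - n) (by omega)).ne_int (k - k') ?_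
  push_cast
  linarith

theorem iterate_reduced_injective (ha : a ∈ Icc (0.3 : ℝ) 0.6)
    (h : Irrational (CircleDeg1Lift.translationNumber (lift ha))) {x : ℝ} (h1 : -ell a < x)
    (h2 : x < 0) : Function.Injective fun n => (reduced a)^[n] x := fun _ _ he =>
  eq_of_mul_sub_eq h (le_antisymm (le_of_iterate_le ha h1 h2 (le_of_eq he))
    (le_of_iterate_le ha h1 h2 (le_of_eq he.symm)))

/-- Between any two points of an orbit there are later points of that orbit. -/
theorem exists_iterate_between (ha : a ∈ Icc (0.3 : ℝ) 0.6)
    (h : Irrational (CircleDeg1Lift.translationNumber (lift ha))) {x : ℝ} (h1 : -ell a < x)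
    (h2 : x < 0) {m n : ℕ} (hmn : (reduced a)^[m] x < (reduced a)^[n] x) (M : ℕ) :
    ∃ i ≥ M, (reduced a)^[m] x < (reduced a)^[i] x ∧ (reduced a)^[i] x < (reduced a)^[n] x := by
  set ρ := CircleDeg1Lift.translationNumber (lift ha)
  have hl := ell_pos ha
  have hlt : m * ρ - turns ha x m < n * ρ - turns ha x n := by
    refine lt_of_le_of_ne (le_of_iterate_le ha h1 h2 hmn.le) fun he => ?_
    rw [eq_of_mul_sub_eq h he] at hmn
    exact lt_irrefl _ hmn
  obtain ⟨i, hi, k, hk1, hk2⟩ := h.exists_nat_mul_sub_int_mem_Ioo hlt M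
  have em := lift_iterate_coord ha h1 h2 m
  have en := lift_iterate_coord ha h1 h2 n
  have ei := lift_iterate_coord ha h1 h2 i
  have o1 : (lift ha)^[m] (1 + x / ell a) - turns ha x m < (lift ha)^[i] (1 + x / ell a) - k := by
    by_contra! hcon
    have := (lift ha).orbit_order (s := 1 + x / ell a) (m := i) (m' := m)
      (k := -k) (k' := -turns ha x m) (by push_cast; linarith)
    push_cast at this
    linarith
  have o2 : (lift ha)^[i] (1 + x / ell a) - k < (lift ha)^[n] (1 + x / ell a) - turns ha x n := by
    by_contra! hcon
    have := (lift ha).orbit_order (s := 1 + x / ell a) (m := n) (m' := i)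
      (k := -turns ha x n) (k' := -k) (by push_cast; linarith)
    push_cast at this
    linarith
  simp only [turns] at o1 o2
  obtain ⟨m1, m2⟩ := iterate_reduced_mem ha h1 h2 m
  obtain ⟨n1, n2⟩ := iterate_reduced_mem ha h1 h2 n
  -- After subtraction of `k` the point is caught between two points of `(0, 1)`, so `k` is its
  -- integer part.
  have hk : ⌊(lift ha)^[i] (1 + x / ell a)⌋ = k := by
    rw [Int.floor_eq_iff]
    constructor
    · linarith [(coord_mem ha m1 m2).1]
    · linarith [(coord_mem ha n1 n2).2]
  rw [hk] at ei
  refine ⟨i, hi, ?_, ?_⟩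
  · refine (div_lt_div_iff_of_pos_right hl).1 ?_
    linarith
  · refine (div_lt_div_iff_of_pos_right hl).1 ?_
    linarith

/-- Infinitely many terms lie strictly on one side of `t`; two of them span a closed interval that
misses `t`. Limits of orbit points inside it are therefore different from `t`. -/
theorem exists_lt_of_infinite {S : Set ℕ} (hS : S.Infinite) {u : ℕ → ℝ} (hu : Function.Injective u)
    (t : ℝ) : ∃ m ∈ S, ∃ n ∈ S, u m < u n ∧ (t < u m ∨ u n < t) := by
  have h1 : (S \ u ⁻¹' {t}).Infinite :=
    hS.sdiff ((finite_singleton t).preimage hu.injOn)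
  have h2 : S \ u ⁻¹' {t} = (S ∩ u ⁻¹' Ioi t) ∪ (S ∩ u ⁻¹' Iio t) := by
    ext n
    simp only [Set.mem_sdiff, mem_preimage, mem_singleton_iff, mem_union, mem_inter_iff, mem_Ioi, mem_Iio]
    rw [← and_or_left, ← ne_eq, ne_iff_lt_or_gt, or_comm]
  rw [h2, infinite_union] at h1
  rcases h1 with h1 | h1
  · obtain ⟨m, hm, n, hn, hmn⟩ := h1.nontrivial
    rcases lt_or_gt_of_ne (hu.ne hmn) with h3 | h3
    · exact ⟨m, hm.1, n, hn.1, h3, Or.inl hm.2⟩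
    · exact ⟨n, hn.1, m, hm.1, h3, Or.inl hn.2⟩
  · obtain ⟨m, hm, n, hn, hmn⟩ := h1.nontrivial
    rcases lt_or_gt_of_ne (hu.ne hmn) with h3 | h3
    · exact ⟨m, hm.1, n, hn.1, h3, Or.inr hn.2⟩
    · exact ⟨n, hn.1, m, hm.1, h3, Or.inr hm.2⟩

theorem symbol_eq_of_between {x y z : ℝ} {b : Bool} (hx : symbol a x = b) (hz : symbol a z = b)
    (hxy : x ≤ y) (hyz : y ≤ z) : symbol a y = b := by
  cases b
  · simp only [symbol, decide_eq_false_iff_not, not_lt] at *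
    refine le_trans ?_ hx
    unfold crossing; linarith
  · simp only [symbol, decide_eq_true_eq] at *
    refine lt_of_lt_of_le hz ?_
    unfold crossing; linarith

/-- The limit set has no isolated points. -/
theorem Good.exists_ne_mem_limitSet (ha : a ∈ Icc (0.3 : ℝ) 0.6)
    (hirr : Irrational (CircleDeg1Lift.translationNumber (lift ha))) {p z : Plane} (h : Good a p)
    (hz : z ∈ limitSet (quad a) lam p) {U : Set Plane} (hU : IsOpen U) (hzU : z ∈ U) :
    ∃ z' ∈ limitSet (quad a) lam p, z' ∈ U ∧ z' ≠ z := by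
  have hx1 := h.1.1.1
  have hx2 := h.1.2.1
  obtain ⟨b, j, hj, t, -, rfl, hinf⟩ := h.exists_of_mem_limitSet ha hz
  obtain ⟨β, hβ⟩ := exists_fst_foldl_reflect ((word a b).take j)
  have hcont : Continuous fun t : ℝ => ((word a b).take j).foldl reflect (t, 1) :=
    (continuous_foldl_reflect _).comp (by fun_prop)
  obtain ⟨δ, hδ, hball⟩ := Metric.isOpen_iff.1 (hU.preimage hcont) t hzU
  obtain ⟨m, hm, n, hn, hmn, hside⟩ := exists_lt_of_infinite (hinf δ hδ)
    (iterate_reduced_injective ha hirr hx1 hx2) t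
  choose φ hφM hφ1 hφ2 using exists_iterate_between ha hirr hx1 hx2 hmn
  have hφ : Tendsto φ atTop atTop := tendsto_atTop_mono hφM tendsto_id
  obtain ⟨t', ⟨ht1, ht2⟩, ψ, hψ, hlim⟩ := (isCompact_Icc (a := (reduced a)^[m] p.1)
    (b := (reduced a)^[n] p.1)).tendsto_subseq (x := fun k => (reduced a)^[φ k] p.1)
    fun k => ⟨(hφ1 k).le, (hφ2 k).le⟩
  -- The symbol is monotone in the first coordinate, so points between two points of symbol `b` have
  -- symbol `b`; the same word can thus be applied to the new limit.
  have hcode : ∀ k, code a p.1 (φ (ψ k)) = b := fun k =>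
    symbol_eq_of_between hm.2 hn.2 (hφ1 _).le (hφ2 _).le
  refine ⟨((word a b).take j).foldl reflect (t', 1),
    h.mem_limitSet ha hj (hφ.comp hψ.tendsto_atTop) hcode hlim, ?_, fun he => ?_⟩
  · refine hball ?_
    rw [Metric.mem_ball, Real.dist_eq, abs_lt]
    have h1 := abs_lt.1 hm.1
    have h2 := abs_lt.1 hn.1
    constructor <;> linarith
  · have he' := congrArg Prod.fst he
    rw [hβ, hβ] at he'
    have hne : (-lam) ^ ((word a b).take j).length ≠ 0 := pow_ne_zero _ (by norm_num [lam])
    have : t' = t := mul_left_cancel₀ hne (add_right_cancel he')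
    rcases hside with h1 | h1 <;> linarith

theorem Good.isCantorSet_limitSet (ha : a ∈ Icc (0.3 : ℝ) 0.6)
    (hirr : Irrational (CircleDeg1Lift.translationNumber (lift ha))) {p : Plane} (h : Good a p) :
    IsCantorSet (limitSet (quad a) lam p) := by
  have : CompactSpace (limitSet (quad a) lam p) := isCompact_iff_compactSpace.1 (h.isCompact_limitSet ha)
  have : Nonempty (limitSet (quad a) lam p) := (h.limitSet_nonempty ha).to_subtype
  have : TotallyDisconnectedSpace (limitSet (quad a) lam p) :=
    totallyDisconnectedSpace_subtype_iff.2 (h.isTotallyDisconnected_limitSet ha)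
  refine nonempty_homeomorph_cantorSpace fun z hz => ?_
  obtain ⟨U, hU, he⟩ := isOpen_induced_iff.1 hz
  have hzU : z.1 ∈ U := by
    have : z ∈ Subtype.val ⁻¹' U := by rw [he]; exact mem_singleton z
    exact this
  obtain ⟨z', hz', hzU', hne⟩ := h.exists_ne_mem_limitSet ha hirr z.2 hU hzU
  have : (⟨z', hz'⟩ : limitSet (quad a) lam p) ∈ ({z} : Set (limitSet (quad a) lam p)) := by
    rw [← he]; exact hzU'
  exact hne (congrArg Subtype.val (mem_singleton_iff.1 this))

end OuterBilliards

end

/-! ### The theorem -/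

theorem theorem3p5 (a : ℝ) (ha : a ∈ Set.Icc (0.3 : ℝ) 0.6) :
    ∃ ρ : ℝ, IsRotationNumber a ρ ∧
      (∀ ρ' : ℝ, IsRotationNumber a ρ' → ∃ k : ℤ, ρ' = ρ + k) ∧
      ∃ ε₀ : ℝ, 0 < ε₀ ∧
        (ρ ∈ Set.range ((↑) : ℚ → ℝ) →
          ∃ w : ℕ → Plane,
            IsPeriodicOrbit (quad a) lam w ∧ IsAttracting (quad a) lam w ∧
            (∀ ε ∈ Set.Ioo 0 ε₀, ∀ p ∈ regularSet (quad a) lam ∩ (R1 a ε ∪ R2 a ε),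
              AsymptoticToOrbit (quad a) lam p w) ∧
            ∀ w' : ℕ → Plane,
              IsPeriodicOrbit (quad a) lam w' → IsAttracting (quad a) lam w' →
              (∃ ε ∈ Set.Ioo 0 ε₀, (∃ i, w' i ∈ R1 a ε ∪ R2 a ε) ∨
                ∀ p ∈ regularSet (quad a) lam ∩ (R1 a ε ∪ R2 a ε),
                  AsymptoticToOrbit (quad a) lam p w') →
              SameOrbit w w') ∧
        (Irrational ρ →
          ∃ K : Set Plane,
            IsCantorSet K ∧ IsInvariant (quad a) lam K ∧
            (∀ ε ∈ Set.Ioo 0 ε₀, ∀ p ∈ regularSet (quad a) lam ∩ (R1 a ε ∪ R2 a ε),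
              AsymptoticToSet (quad a) lam p K) ∧
            ∀ K' : Set Plane, IsCantorSet K' → IsInvariant (quad a) lam K' →
              (∃ ε ∈ Set.Ioo 0 ε₀, ∀ p ∈ regularSet (quad a) lam ∩ (R1 a ε ∪ R2 a ε),
                AsymptoticToSet (quad a) lam p K') →
              K' = K) := by
  -- The vertex `A` belongs to the rectangles at every scale, so they contain regular points; these
  -- serve as witnesses for uniqueness.
  have hsub : ∀ ε ∈ Ioo (0 : ℝ) (1 / 4), ((0, 1) : Plane) ∈ R1 a ε ∪ R2 a ε := by
    intro ε hε
    have := neg_ell_lt ha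
    refine Or.inl ⟨⟨?_, ?_⟩, ⟨?_, ?_⟩⟩ <;> norm_num
    · linarith [hε.2]
    · positivity
  refine ⟨CircleDeg1Lift.translationNumber (lift ha), isRotationNumber_translationNumber ha,
    fun ρ' h => isRotationNumber_unique ha h, 1 / 4, by norm_num, fun hρ => ?_, fun hρ => ?_⟩
  · obtain ⟨w, hw, hwt, hall⟩ := exists_periodicOrbit_of_rational ha hρ
    obtain ⟨N, hN, hper⟩ := hw.1
    have hrect : ∀ ε ∈ Ioo (0 : ℝ) (1 / 4), ∀ p ∈ regularSet (quad a) lam ∩ (R1 a ε ∪ R2 a ε),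
        AsymptoticToOrbit (quad a) lam p w := fun ε hε p hp => by
      obtain ⟨k, hk⟩ := exists_good_of_mem_rectangle ha hε hp
      exact asymptoticToOrbit_of_iterate hN hper (hall _ hk)
    refine ⟨w, hw, ⟨trap a, isOpen_trap, hwt, fun p hp => ?_⟩, hrect, ?_⟩
    · obtain ⟨k, hk⟩ := exists_good_of_mem_trap ha hp.2 hp.1
      exact asymptoticToOrbit_of_iterate hN hper (hall _ hk)
    -- In both cases some regular point of the rectangles is asymptotic to `w` and to `w'`: one near
    -- a term of `w'` by attraction, or any one by assumption.
    · rintro w' ⟨⟨N', hN', hper'⟩, -⟩ ⟨U, hU, hwU, hattr⟩ ⟨ε, hε, ⟨i, hi⟩ | hasym⟩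
      · obtain ⟨p, hpU, hp⟩ := exists_regular_mem ha hε hi hU (hwU (mem_range_self i))
        exact sameOrbit_of_asymptotic hN hN' hper hper' (hrect ε hε p hp) (hattr p ⟨hp.1, hpU⟩)
      · obtain ⟨p, -, hp⟩ := exists_regular_mem ha hε (hsub ε hε) isOpen_univ trivial
        exact sameOrbit_of_asymptotic hN hN' hper hper' (hrect ε hε p hp) (hasym p hp)
  · obtain ⟨p₀, hp₀⟩ := exists_good ha
    have hrect : ∀ ε ∈ Ioo (0 : ℝ) (1 / 4), ∀ p ∈ regularSet (quad a) lam ∩ (R1 a ε ∪ R2 a ε),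
        AsymptoticToSet (quad a) lam p (limitSet (quad a) lam p₀) := fun ε hε p hp => by
      obtain ⟨k, hk⟩ := exists_good_of_mem_rectangle ha hε hp
      rw [(limitSet_subset_limitSet ha hρ hp₀ hk).antisymm (limitSet_subset_limitSet ha hρ hk hp₀)]
      exact asymptoticToSet_of_iterate (hk.asymptoticToSet_limitSet ha)
    refine ⟨limitSet (quad a) lam p₀, hp₀.isCantorSet_limitSet ha hρ, hp₀.isInvariant_limitSet ha,
      hrect, ?_⟩
    rintro K' - - ⟨ε, hε, hK'⟩
    obtain ⟨p, -, hp⟩ := exists_regular_mem ha hε (hsub ε hε) isOpen_univ trivial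
    rw [← (hK' p hp).2, (hrect ε hε p hp).2]
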